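/- Let $\mathcal H=H^0_{\rm loc}(\mathbb R^3,\mathbb C^4)$ be the space of (classes of) functions $\psi:\mathbb R^3\to\mathbb C^4$ with $\|\psi\|_{0,R}^2=\int_{|x|<R}|\psi(x)|^2dx<\infty$ for all $R>0$, with the topology of these seminorms. Fix $\zeta\in C_0^\infty(\mathbb R^3)$ with $\zeta(0)\neq0$; for $s\in\mathbb R$ let $\mathcal H^{s}=H^s_{\rm loc}(\mathbb R^3,\mathbb C^4)$ be the space of $\mathbb C^4$-valued distributions $u$ on $\mathbb R^3$ with $\|u\|_{s,R}=\|\Lambda^s(\zeta(\cdot/R)u)\|_{L^2(\mathbb R^3)}<\infty$ for all $R>0$, with the topology of these seminorms, where $\Lambda^s$ is the Fourier multiplier with symbol $(1+|k|^2)^{s/2}$. Let $m>0$ and consider the Dirac equation $\dot\psi=[-\alpha\cdot\nabla-i\beta m]\psi$, $\psi(\cdot,0)=\psi_0$, where $\alpha_k=\begin{pmatrix}0&\sigma_k\\ \sigma_k&0\end{pmatrix}$ and $\beta=\begin{pmatrix}I&0\\0&-I\end{pmatrix}$, and $\sigma_1,\sigma_2,\sigma_3$ are the Pauli matrices. For $\psi_0\in\mathcal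 H$ let $U(t)\psi_0=\psi(\cdot,t)$, where $\psi\in C(\mathbb R,\mathcal H)$ is the solution of this Cauchy problem in the sense of distributions. Let $\mu_0$ be a Borel probability measure on $\mathcal H$, the law of a random function $\psi_0(\omega,x)$ that is jointly measurable in $(\omega,x)$, on the probability space $(\mathcal H,\mathcal B(\mathcal H),\mu_0)$ with $\psi_0(\omega,x)=\omega(x)$ almost everywhere; write $E$ for the expectation. For $v\in\mathbb C^4$ let $\mathcal R v=(\mathrm{Re}\,v,\mathrm{Im}\,v)\in\mathbb R^8$, with components $\mathcal R^jv$, and put $\langle\psi,\phi\rangle=\sum_{j=1}^8\int\mathcal R^j\psi\,\mathcal R^j\phi\,dx$. Assume: * **S0.** $E\psi_0(x)=0$ for almost all $x$. * **S1.** There are functions $q_0^{ij}$ with $E\big(\mathcal R^i\psi_0(x)\mathcal R^j\psi_0(y)\big)=q_0^{ij}(x-y)$ for almost all $x,y\in\mathbb R^3$, $i,j=1,\dots,8$. * **S2.** $E|\psi_0(x)|^2=e_0$ for almost all $x$, with a constant $e_0<\infty$. * **S3.** $\varphi(r)\to0$ as $r\to\infty$ and $\int_0^\infty r^2\varphi^{1/2}(r)\,dr<\infty$,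 where $$\varphi(r)=\sup\frac{|\mu_0(A\cap B)-\mu_0(A)\mu_0(B)|}{\mu_0(B)},$$ the supremum being over all bounded open $\mathcal A,\mathcal B\subset\mathbb R^3$ with $\mathrm{dist}(\mathcal A,\mathcal B)\ge r$ and all $A\in\sigma(\mathcal A)$, $B\in\sigma(\mathcal B)$ with $\mu_0(B)>0$; here $\sigma(\mathcal A)$ is the $\sigma$-algebra on $\mathcal H$ generated by the functionals $\psi\mapsto\langle\psi,\phi\rangle$, $\phi\in C_0^\infty(\mathbb R^3,\mathbb C^4)$, $\mathrm{supp}\,\phi\subset\mathcal A$. For $t\in\mathbb R$ let $\mu_t$ be the law of $U(t)\psi_0$, that is, the image of $\mu_0$ under $U(t)$. Then for every $\varepsilon>0$ the family of measures $\{\mu_t,\ t\in\mathbb R\}$ is weakly compact in $\mathcal H^{-\varepsilon}$: the images of the $\mu_t$ under the embedding $\mathcal H\subset\mathcal H^{-\varepsilon}$ form a relatively compact set in the space of Borel probability measures on $\mathcal H^{-\varepsilon}$ with the topology of weak convergence. (Here the Cauchy problem has exactly one solution for every $\psi_0\in\mathcal H$, and $U(t)$ and the embedding $\mathcal H\subset\mathcal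 H^{-\varepsilon}$ are continuous, so that these measures are well defined.) -/

import Mathlib

open MeasureTheory Filter Topology TopologicalSpace
open scoped Distributions SchwartzMap ENNReal NNReal LineDeriv

noncomputable section

namespace DiracStat

/-- Physical space `ℝ³`. -/
abbrev Space3 : Type := EuclideanSpace ℝ (Fin 3)

/-- The space of values `ℂ⁴` with its Hermitian norm. -/
abbrev Spinor : Type := EuclideanSpace ℂ (Fin 4)

/-! ### The phase space `H = H⁰_loc(ℝ³, ℂ⁴) = L²_loc(ℝ³, ℂ⁴)` -/

/-- Classes of a.e. equal functions that are square integrable on each ball `|x| < R`. -/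
def l2locSubmodule : Submodule ℂ (Space3 →ₘ[volume] Spinor) where
  carrier := {f | ∀ R : ℝ, 0 < R → MemLp f 2 (volume.restrict (Metric.ball (0 : Space3) R))}
  zero_mem' := fun _ _ => (memLp_congr_ae (ae_restrict_of_ae AEEqFun.coeFn_zero)).2 MemLp.zero
  add_mem' := fun {f g} hf hg R hR =>
    (memLp_congr_ae (ae_restrict_of_ae (AEEqFun.coeFn_add f g))).2 ((hf R hR).add (hg R hR))
  smul_mem' := fun c f hf R hR =>
    (memLp_congr_ae (ae_restrict_of_ae (AEEqFun.coeFn_smul c f))).2 ((hf R hR).const_smul c)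

/-- The phase space `H`. -/
def L2Loc : Type := l2locSubmodule

namespace L2Loc

instance : AddCommGroup L2Loc := inferInstanceAs (AddCommGroup l2locSubmodule)
instance : Module ℂ L2Loc := inferInstanceAs (Module ℂ l2locSubmodule)

/-- An element of `H` is used as a function through a representative of its class. -/
instance : CoeFun L2Loc (fun _ => Space3 → Spinor) := ⟨fun ψ => (ψ.1 : Space3 →ₘ[volume] Spinor)⟩

theorem memLp_ball (ψ : L2Loc) {R : ℝ} (hR : 0 < R) :
    MemLp ψ 2 (volume.restrict (Metric.ball (0 : Space3) R)) := ψ.2 R hR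

/-- Restriction to the ball `|x| < R`, with values in `L²(|x| < R)`. -/
def restrictBall (R : Set.Ioi (0 : ℝ)) :
    L2Loc →ₗ[ℂ] Lp Spinor 2 (volume.restrict (Metric.ball (0 : Space3) (R : ℝ))) where
  toFun ψ := (ψ.memLp_ball R.2).toLp ψ
  map_add' f g := by
    rw [← MemLp.toLp_add]
    exact MemLp.toLp_congr _ _ (ae_restrict_of_ae (AEEqFun.coeFn_add f.1 g.1))
  map_smul' c f := by
    rw [RingHom.id_apply, ← MemLp.toLp_const_smul]
    exact MemLp.toLp_congr _ _ (ae_restrict_of_ae (AEEqFun.coeFn_smul c f.1))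

/-- The local energy seminorms `‖ψ‖_{0,R} = (∫_{|x|<R} |ψ(x)|² dx)^{1/2}`, `R > 0`. -/
def energySeminorm : SeminormFamily ℂ L2Loc (Set.Ioi (0 : ℝ)) := fun R =>
  (normSeminorm ℂ (Lp Spinor 2 (volume.restrict (Metric.ball (0 : Space3) (R : ℝ))))).comp
    (restrictBall R)

instance : TopologicalSpace L2Loc := energySeminorm.moduleFilterBasis.topology

theorem withSeminorms : WithSeminorms energySeminorm := ⟨rfl⟩

instance : MeasurableSpace L2Loc := borel L2Loc
instance : BorelSpace L2Loc := ⟨rfl⟩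

theorem locallyIntegrable (ψ : L2Loc) : LocallyIntegrable ψ volume := by
  intro x
  refine ⟨Metric.ball 0 (‖x‖ + 1), Metric.isOpen_ball.mem_nhds (by simp), ?_⟩
  have : IsFiniteMeasure ((volume : Measure Space3).restrict (Metric.ball 0 (‖x‖ + 1))) :=
    isFiniteMeasure_restrict.2 measure_ball_lt_top.ne
  exact (ψ.memLp_ball (by positivity)).integrable (by norm_num)

/-- The distribution `φ ↦ ∫ φ ψ dx` of `ψ ∈ H`. -/
def toDistribution (ψ : L2Loc) : 𝓓'((⊤ : Opens Space3), Spinor) :=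
  (TestFunction.integralAgainstBilinCLM (ContinuousLinearMap.lsmul ℝ ℝ) volume ψ :
    𝓓((⊤ : Opens Space3), ℝ) →L[ℝ] Spinor)

theorem toDistribution_apply (ψ : L2Loc) (φ : 𝓓((⊤ : Opens Space3), ℝ)) :
    ψ.toDistribution φ = ∫ x, φ x • ψ x :=
  TestFunction.integralAgainstBilinCLM_eq_integral (ψ.locallyIntegrable.locallyIntegrableOn _)

end L2Loc

/-! ### The Dirac equation -/

/-- The Pauli matrices `σ₁, σ₂, σ₃`. -/
def pauli : Fin 3 → Matrix (Fin 2) (Fin 2) ℂ :=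
  ![!![0, 1; 1, 0], !![0, -Complex.I; Complex.I, 0], !![1, 0; 0, -1]]

/-- The Dirac matrices `α_k`, in `2 × 2` blocks `(0, σ_k; σ_k, 0)`. -/
def diracAlpha (k : Fin 3) : Matrix (Fin 4) (Fin 4) ℂ :=
  (Matrix.fromBlocks 0 (pauli k) (pauli k) 0).submatrix (finSumFinEquiv (m := 2) (n := 2)).symm
    (finSumFinEquiv (m := 2) (n := 2)).symm

/-- The Dirac matrix `β`, in `2 × 2` blocks `(I, 0; 0, -I)`. -/
def diracBeta : Matrix (Fin 4) (Fin 4) ℂ :=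
  (Matrix.fromBlocks 1 0 0 (-1)).submatrix (finSumFinEquiv (m := 2) (n := 2)).symm
    (finSumFinEquiv (m := 2) (n := 2)).symm

/-- A constant `4 × 4` matrix acting on the values of a `ℂ⁴`-valued distribution. -/
def matMul (A : Matrix (Fin 4) (Fin 4) ℂ) :
    𝓓'((⊤ : Opens Space3), Spinor) →L[ℝ] 𝓓'((⊤ : Opens Space3), Spinor) :=
  Distribution.mapCLM ((Matrix.toEuclideanCLM (n := Fin 4) (𝕜 := ℂ) A).restrictScalars ℝ)

/-- `u ↦ [-α·∇ - iβm] u` on distributions. -/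
def diracOperator (m : ℝ) (u : 𝓓'((⊤ : Opens Space3), Spinor)) :
    𝓓'((⊤ : Opens Space3), Spinor) :=
  -(∑ k : Fin 3, matMul (diracAlpha k) (∂_{(EuclideanSpace.single k (1 : ℝ) : Space3)} u)) -
    matMul ((Complex.I * (m : ℂ)) • diracBeta) u

/-- `ψ ∈ C(ℝ, H)` solves the Cauchy problem `∂ₜψ = [-α·∇ - iβm] ψ`, `ψ(0) = ψ₀`; the equation
holds in the sense of distributions in `x`, for every time `t`. -/
structure IsDiracSolution (m : ℝ) (ψ₀ : L2Loc) (ψ : ℝ → L2Loc) : Prop where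
  continuous : Continuous ψ
  initial : ψ 0 = ψ₀
  equation : ∀ (φ : 𝓓((⊤ : Opens Space3), ℝ)) (t : ℝ),
    HasDerivAt (fun s => (ψ s).toDistribution φ) (diracOperator m (ψ t).toDistribution φ) t

open Classical in
/-- The dynamics `U(t) : ψ₀ ↦ ψ(·, t)`, where `ψ` is the solution with initial datum `ψ₀`
(the value `0` for a datum without solution is never used: the Cauchy problem is well posed). -/
def diracFlow (m t : ℝ) (ψ₀ : L2Loc) : L2Loc :=
  if h : ∃ ψ : ℝ → L2Loc, IsDiracSolution m ψ₀ ψ then h.choose t else 0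

/-- The law `μ_t` of `U(t)ψ₀`, for `ψ₀` with law `μ₀`. -/
def timeLaw (m : ℝ) (μ₀ : Measure L2Loc) (t : ℝ) : Measure L2Loc := μ₀.map (diracFlow m t)

/-! ### The local Sobolev spaces `H^s_loc(ℝ³, ℂ⁴)` -/

/-- The test function `x ↦ ζ(x/R)`. -/
def dilate (ζ : 𝓓((⊤ : Opens Space3), ℂ)) (R : Set.Ioi (0 : ℝ)) : 𝓓((⊤ : Opens Space3), ℂ) where
  toFun x := ζ ((R : ℝ)⁻¹ • x)
  contDiff' := ζ.contDiff.comp (contDiff_const_smul _)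
  hasCompactSupport' := ζ.hasCompactSupport.comp_homeomorph
    (Homeomorph.smulOfNeZero (R : ℝ)⁻¹ (inv_ne_zero (ne_of_gt R.2)))
  tsupport_subset' := fun _ _ => trivial

theorem testFunction_hasTemperateGrowth (χ : 𝓓((⊤ : Opens Space3), ℂ)) :
    Function.HasTemperateGrowth (χ : Space3 → ℂ) :=
  (χ.hasCompactSupport.toSchwartzMap χ.contDiff).hasTemperateGrowth

/-- `f ↦ χ f` from Schwartz functions to smooth functions supported in the support of `χ`. -/
def cutoffLinear (χ : 𝓓((⊤ : Opens Space3), ℂ)) :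
    𝓢(Space3, ℂ) →ₗ[ℝ] 𝓓_{⟨tsupport χ, χ.hasCompactSupport⟩}(Space3, ℂ) where
  toFun f := ContDiffMapSupportedIn.of_support_subset (f := fun x => χ x * f x)
    (χ.contDiff.mul (f.smooth _))
    ((Function.support_mul_subset_left _ _).trans (subset_tsupport _))
  map_add' f g := by ext x; exact mul_add _ _ _
  map_smul' c f := by ext x; exact mul_smul_comm c (χ x) (f x)

theorem cutoffLinear_continuous (χ : 𝓓((⊤ : Opens Space3), ℂ)) : Continuous (cutoffLinear χ) := by
  refine (ContDiffMapSupportedIn.withSeminorms ℝ Space3 ℂ ⊤ _).continuous_of_continuous_comp _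
    fun i => ?_
  let q : Seminorm ℝ 𝓢(Space3, ℂ) := (SchwartzMap.seminorm ℝ 0 i).comp
    ((SchwartzMap.smulLeftCLM ℂ (χ : Space3 → ℂ)).toLinearMap.restrictScalars ℝ)
  have hq : Continuous q :=
    ((schwartz_withSeminorms ℝ Space3 ℂ).continuous_seminorm (0, i)).comp
      (SchwartzMap.smulLeftCLM ℂ (χ : Space3 → ℂ)).continuous
  refine Seminorm.continuous_of_le hq fun f => ?_
  refine (ContDiffMapSupportedIn.seminorm_top_le_iff ℝ (apply_nonneg _ _) i _).2 fun x _ => ?_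
  have h := SchwartzMap.norm_iteratedFDeriv_le_seminorm ℝ
    (SchwartzMap.smulLeftCLM ℂ (χ : Space3 → ℂ) f) i x
  rw [SchwartzMap.smulLeftCLM_apply (testFunction_hasTemperateGrowth χ)] at h
  exact h

/-- `f ↦ χ f` from Schwartz functions to test functions. -/
def cutoff (χ : 𝓓((⊤ : Opens Space3), ℂ)) : 𝓢(Space3, ℂ) →L[ℝ] 𝓓((⊤ : Opens Space3), ℂ) :=
  (TestFunction.ofSupportedInCLM ℝ (Set.subset_univ _)).comp
    ⟨cutoffLinear χ, cutoffLinear_continuous χ⟩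

theorem cutoff_apply (χ : 𝓓((⊤ : Opens Space3), ℂ)) (f : 𝓢(Space3, ℂ)) (x : Space3) :
    cutoff χ f x = χ x * f x := rfl

/-- The value `u(g) = u(Re g) + i u(Im g)` of a distribution on a complex test function. -/
def distEval (u : 𝓓'((⊤ : Opens Space3), Spinor)) : 𝓓((⊤ : Opens Space3), ℂ) →L[ℝ] Spinor :=
  u.comp (TestFunction.postcompCLM Complex.reCLM) +
    (ContinuousLinearMap.lsmul ℝ ℂ Complex.I).comp
      (u.comp (TestFunction.postcompCLM Complex.imCLM))

theorem distEval_apply (u : 𝓓'((⊤ : Opens Space3), Spinor)) (g : 𝓓((⊤ : Opens Space3), ℂ)) :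
    distEval u g = u (TestFunction.postcompCLM Complex.reCLM g) +
      Complex.I • u (TestFunction.postcompCLM Complex.imCLM g) := rfl

theorem distEval_smul (u : 𝓓'((⊤ : Opens Space3), Spinor)) (c : ℂ)
    (g : 𝓓((⊤ : Opens Space3), ℂ)) : distEval u (c • g) = c • distEval u g := by
  have h1 : TestFunction.postcompCLM (n := ⊤) (Ω := (⊤ : Opens Space3)) Complex.reCLM (c • g) =
      c.re • TestFunction.postcompCLM Complex.reCLM g -
        c.im • TestFunction.postcompCLM Complex.imCLM g := by
    ext x
    exact Complex.mul_re c (g x)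
  have h2 : TestFunction.postcompCLM (n := ⊤) (Ω := (⊤ : Opens Space3)) Complex.imCLM (c • g) =
      c.re • TestFunction.postcompCLM Complex.imCLM g +
        c.im • TestFunction.postcompCLM Complex.reCLM g := by
    ext x
    exact (Complex.mul_im c (g x)).trans (congrArg _ rfl)
  rw [distEval_apply, distEval_apply, h1, h2, map_sub, map_add, map_smul, map_smul, map_smul,
    map_smul]
  generalize u (TestFunction.postcompCLM Complex.reCLM g) = a
  generalize u (TestFunction.postcompCLM Complex.imCLM g) = b
  ext i
  simp only [PiLp.add_apply, PiLp.sub_apply, PiLp.smul_apply, smul_eq_mul, Complex.real_smul]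
  conv_rhs => rw [← Complex.re_add_im c]
  linear_combination (-(c.im : ℂ) * b i) * Complex.I_sq

/-- The product `χ u` of a distribution `u` and a test function `χ`. It has compact support and is
given as a tempered distribution, `(χ u)(f) = u(χ f)`. -/
def cutoffDistribution (χ : 𝓓((⊤ : Opens Space3), ℂ)) :
    𝓓'((⊤ : Opens Space3), Spinor) →ₗ[ℂ] 𝓢'(Space3, Spinor) where
  toFun u :=
    { toFun := fun f => distEval u (cutoff χ f)
      map_add' := fun f g => by simp
      map_smul' := fun c f => by
        have h : cutoff χ (c • f) = c • cutoff χ f := by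
          ext x
          exact mul_smul_comm c (χ x) (f x)
        rw [h, distEval_smul, RingHom.id_apply]
      cont := by fun_prop }
  map_add' u v := by
    ext1 f
    change u _ + v _ + Complex.I • (u _ + v _) = u _ + Complex.I • u _ + (v _ + Complex.I • v _)
    rw [smul_add]; abel
  map_smul' c u := by
    ext1 f
    change c • u _ + Complex.I • (c • u _) = c • (u _ + Complex.I • u _)
    rw [smul_add, smul_comm]

/-- The symbol `⟨k⟩^s = (1 + |k|²)^{s/2}`, written in the frequency variable `ξ = k / 2π` of
Mathlib's Fourier transform. -/
def besselSymbol (s : ℝ) (ξ : Space3) : ℂ := (((1 + ‖(2 * Real.pi) • ξ‖ ^ 2) ^ (s / 2) : ℝ) : ℂ)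

theorem besselSymbol_hasTemperateGrowth (s : ℝ) : (besselSymbol s).HasTemperateGrowth := by
  have h1 : Function.HasTemperateGrowth
      fun ξ : Space3 => (((1 + ‖ξ‖ ^ 2) ^ (s / 2) : ℝ) : ℂ) := by fun_prop
  have h2 : Function.HasTemperateGrowth fun ξ : Space3 => (2 * Real.pi) • ξ :=
    ((2 * Real.pi) • ContinuousLinearMap.id ℝ Space3).hasTemperateGrowth
  exact h1.comp h2

/-- The operator `Λ^s v = F⁻¹(⟨k⟩^s F v)` on tempered distributions. -/
def bessel (s : ℝ) : 𝓢'(Space3, Spinor) →L[ℂ] 𝓢'(Space3, Spinor) :=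
  TemperedDistribution.fourierMultiplierCLM Spinor (besselSymbol s)

/-- Distributions `u` with `Λ^s (ζ(·/R) u) ∈ L²(ℝ³)` for all `R > 0`. -/
def sobolevLocSubmodule (ζ : 𝓓((⊤ : Opens Space3), ℂ)) (s : ℝ) :
    Submodule ℂ 𝓓'((⊤ : Opens Space3), Spinor) where
  carrier := {u | ∀ R : Set.Ioi (0 : ℝ), ∃ v : Lp Spinor 2 (volume : Measure Space3),
    (v : 𝓢'(Space3, Spinor)) = bessel s (cutoffDistribution (dilate ζ R) u)}
  zero_mem' R := ⟨0, by
    rw [map_zero, map_zero]; exact map_zero (Lp.toTemperedDistributionCLM Spinor volume 2)⟩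
  add_mem' {u w} hu hw R := by
    obtain ⟨a, ha⟩ := hu R
    obtain ⟨b, hb⟩ := hw R
    refine ⟨a + b, ?_⟩
    rw [map_add, map_add, ← ha, ← hb]
    exact map_add (Lp.toTemperedDistributionCLM Spinor volume 2) a b
  smul_mem' c u hu R := by
    obtain ⟨a, ha⟩ := hu R
    refine ⟨c • a, ?_⟩
    rw [map_smul, map_smul, ← ha]
    exact map_smul (Lp.toTemperedDistributionCLM Spinor volume 2) c a

/-- The local Sobolev space `H^s_loc(ℝ³, ℂ⁴)`, with the cutoff function `ζ`. -/
def SobolevLoc (ζ : 𝓓((⊤ : Opens Space3), ℂ)) (s : ℝ) : Type := sobolevLocSubmodule ζ s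

namespace SobolevLoc

variable {ζ : 𝓓((⊤ : Opens Space3), ℂ)} {s : ℝ}

instance : AddCommGroup (SobolevLoc ζ s) := inferInstanceAs (AddCommGroup (sobolevLocSubmodule ζ s))
instance : Module ℂ (SobolevLoc ζ s) := inferInstanceAs (Module ℂ (sobolevLocSubmodule ζ s))

theorem toTemperedDistribution_injective : Function.Injective
    (Lp.toTemperedDistributionCLM Spinor (volume : Measure Space3) 2) :=
  LinearMap.ker_eq_bot.1 Lp.ker_toTemperedDistributionCLM_eq_bot

/-- `u ↦ Λ^s (ζ(·/R) u)`, with values in `L²(ℝ³)`. -/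
def localize (R : Set.Ioi (0 : ℝ)) :
    SobolevLoc ζ s →ₗ[ℂ] Lp Spinor 2 (volume : Measure Space3) where
  toFun u := (u.2 R).choose
  map_add' u w := by
    apply toTemperedDistribution_injective
    rw [map_add]
    refine ((u + w).2 R).choose_spec.trans ?_
    refine Eq.trans ?_ (congrArg₂ (· + ·) (u.2 R).choose_spec (w.2 R).choose_spec).symm
    rw [← map_add, ← map_add]; rfl
  map_smul' c u := by
    apply toTemperedDistribution_injective
    rw [RingHom.id_apply, map_smul]
    refine ((c • u).2 R).choose_spec.trans ?_
    refine Eq.trans ?_ (congrArg (c • ·) (u.2 R).choose_spec).symm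
    rw [← map_smul, ← map_smul]; rfl

theorem localize_spec (R : Set.Ioi (0 : ℝ)) (u : SobolevLoc ζ s) :
    (localize R u : 𝓢'(Space3, Spinor)) = bessel s (cutoffDistribution (dilate ζ R) u.1) :=
  (u.2 R).choose_spec

/-- The seminorms `‖u‖_{s,R} = ‖Λ^s (ζ(·/R) u)‖_{L²(ℝ³)}`, `R > 0`. -/
def sobolevSeminorm : SeminormFamily ℂ (SobolevLoc ζ s) (Set.Ioi (0 : ℝ)) := fun R =>
  (normSeminorm ℂ (Lp Spinor 2 (volume : Measure Space3))).comp (localize R)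

instance : TopologicalSpace (SobolevLoc ζ s) :=
  (sobolevSeminorm (ζ := ζ) (s := s)).moduleFilterBasis.topology

theorem withSeminorms : WithSeminorms (sobolevSeminorm (ζ := ζ) (s := s)) := ⟨rfl⟩

instance : MeasurableSpace (SobolevLoc ζ s) := borel _
instance : BorelSpace (SobolevLoc ζ s) := ⟨rfl⟩

end SobolevLoc

theorem cutoff_toDistribution (χ : 𝓓((⊤ : Opens Space3), ℂ)) (ψ : L2Loc) :
    ∃ v : Lp Spinor 2 (volume : Measure Space3),
      (v : 𝓢'(Space3, Spinor)) = cutoffDistribution χ ψ.toDistribution := by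
  obtain ⟨r, hr⟩ := χ.hasCompactSupport.isCompact.isBounded.subset_ball (0 : Space3)
  have hr' : tsupport χ ⊆ Metric.ball (0 : Space3) (max r 1) :=
    hr.trans (Metric.ball_subset_ball (le_max_left _ _))
  have hsupp : Function.support (fun x => χ x • ψ x) ⊆ Metric.ball (0 : Space3) (max r 1) :=
    (Function.support_smul_subset_left _ _).trans ((subset_tsupport _).trans hr')
  have hmem : MemLp (fun x => χ x • ψ x) 2 (volume : Measure Space3) := by
    have h : MemLp (fun x => χ x • ψ x) 2
        (volume.restrict (Metric.ball (0 : Space3) (max r 1))) :=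
      (ψ.memLp_ball (lt_max_of_lt_right one_pos)).smul (p := ∞) χ.memLp_top
    rw [← memLp_indicator_iff_restrict measurableSet_ball] at h
    rwa [Set.indicator_eq_self.2 hsupp] at h
  refine ⟨hmem.toLp _, ?_⟩
  ext1 f
  rw [Lp.toTemperedDistribution_apply]
  change _ = distEval ψ.toDistribution (cutoff χ f)
  rw [distEval_apply, L2Loc.toDistribution_apply, L2Loc.toDistribution_apply, ← integral_smul,
    ← integral_add]
  · refine integral_congr_ae ?_
    filter_upwards [hmem.coeFn_toLp] with x hx
    rw [hx]
    change _ = (χ x * f x).re • ψ x + Complex.I • (χ x * f x).im • ψ x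
    ext i
    simp only [PiLp.add_apply, PiLp.smul_apply, smul_eq_mul, Complex.real_smul]
    linear_combination (-ψ x i) * Complex.re_add_im (χ x * f x)
  · exact TestFunction.integrable_bilin (ContinuousLinearMap.lsmul ℝ ℝ)
      (ψ.locallyIntegrable.locallyIntegrableOn _) _
  · exact Integrable.smul Complex.I <| TestFunction.integrable_bilin
      (ContinuousLinearMap.lsmul ℝ ℝ) (ψ.locallyIntegrable.locallyIntegrableOn _) _

theorem bessel_of_nonpos {s : ℝ} (hs : s ≤ 0) (v : Lp Spinor 2 (volume : Measure Space3)) :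
    ∃ w : Lp Spinor 2 (volume : Measure Space3),
      (w : 𝓢'(Space3, Spinor)) = bessel s (v : 𝓢'(Space3, Spinor)) := by
  have h0 : TemperedDistribution.MemSobolev 0 2 (v : 𝓢'(Space3, Spinor)) :=
    TemperedDistribution.memSobolev_zero_iff.2 ⟨v, rfl⟩
  obtain ⟨w, hw⟩ := TemperedDistribution.memSobolev_zero_iff.1
    (h0.fourierMultiplierCLM_of_bounded (besselSymbol_hasTemperateGrowth s) ⟨1, fun ξ => by
      rw [besselSymbol, Complex.norm_real, Real.norm_eq_abs, abs_of_nonneg (by positivity)]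
      exact Real.rpow_le_one_of_one_le_of_nonpos (by nlinarith [norm_nonneg ((2 * Real.pi) • ξ)])
        (by linarith)⟩)
  exact ⟨w, hw.symm⟩

/-- The embedding `H = H⁰_loc ⊂ H^s_loc` for `s ≤ 0`: a function as a distribution. -/
def embed (ζ : 𝓓((⊤ : Opens Space3), ℂ)) {s : ℝ} (hs : s ≤ 0) (ψ : L2Loc) : SobolevLoc ζ s :=
  ⟨ψ.toDistribution, fun R => by
    obtain ⟨v, hv⟩ := cutoff_toDistribution (dilate ζ R) ψ
    obtain ⟨w, hw⟩ := bessel_of_nonpos hs v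
    exact ⟨w, by rw [hw, hv]⟩⟩

/-! ### The initial measure -/

/-- The real components `ℛ v = (Re v₁, …, Re v₄, Im v₁, …, Im v₄)` of `v ∈ ℂ⁴`. -/
def realComp (v : Spinor) : Fin (4 + 4) → ℝ :=
  Fin.append (fun k => (v k).re) (fun k => (v k).im)

/-- `Ψ(ω, x)` is the random function with law `μ₀`, on the canonical probability space
`(H, B(H), μ₀)`: it is measurable in `(ω, x)` (for the completed product `σ`-algebra), and
`Ψ(ω, x) = ω(x)` for almost all `(ω, x)`. -/
def IsRandomField (μ₀ : Measure L2Loc) (Ψ : L2Loc → Space3 → Spinor) : Prop :=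
  AEMeasurable (fun p : L2Loc × Space3 => Ψ p.1 p.2) (μ₀.prod volume) ∧
    ∀ᵐ ω ∂μ₀, Ψ ω =ᵐ[volume] ω

/-- `⟨ψ, φ⟩ = ∑ⱼ ∫ ℛʲψ ℛʲφ dx` for a test function `φ` with support in `A`. -/
def pairing {A : Opens Space3} (ψ : L2Loc) (φ : 𝓓(A, Spinor)) : ℝ :=
  ∑ j, ∫ x, realComp (ψ x) j * realComp (φ x) j

/-- The `σ`-algebra `σ(A)` in `H` generated by `ψ ↦ ⟨ψ, φ⟩`, `supp φ ⊂ A`. -/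
@[reducible] def localSigma (A : Opens Space3) : MeasurableSpace L2Loc :=
  ⨆ φ : 𝓓(A, Spinor), (borel ℝ).comap (fun ψ => pairing ψ φ)

/-- The Ibragimov-Linnik mixing coefficient `φ(r)`: the supremum of
`|μ(S ∩ T) - μ(S) μ(T)| / μ(T)` over `S ∈ σ(A)`, `T ∈ σ(B)` with `μ(T) > 0`, and over bounded open
sets `A`, `B` at distance at least `r`. -/
def mixingCoeff (μ : Measure L2Loc) (r : ℝ) : ℝ≥0∞ :=
  ⨆ (A : Opens Space3) (B : Opens Space3) (_ : Bornology.IsBounded (A : Set Space3))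
    (_ : Bornology.IsBounded (B : Set Space3)) (_ : ∀ x ∈ A, ∀ y ∈ B, r ≤ dist x y)
    (S : Set L2Loc) (T : Set L2Loc) (_ : MeasurableSet[localSigma A] S)
    (_ : MeasurableSet[localSigma B] T) (_ : 0 < μ T),
    ENNReal.ofReal (|μ.real (S ∩ T) - μ.real S * μ.real T| / μ.real T)

/-- The conditions on the initial measure `μ₀` and its random function `Ψ`. -/
structure InitialConditions (μ₀ : Measure L2Loc) (Ψ : L2Loc → Space3 → Spinor) : Prop where
  /-- zero mean -/
  zero_mean : ∀ᵐ x : Space3, ∫ ω, Ψ ω x ∂μ₀ = 0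
  /-- translation-invariant correlation functions -/
  correlation : ∃ q₀ : Fin (4 + 4) → Fin (4 + 4) → Space3 → ℝ, ∀ i j,
    ∀ᵐ p : Space3 × Space3,
      ∫ ω, realComp (Ψ ω p.1) i * realComp (Ψ ω p.2) j ∂μ₀ = q₀ i j (p.1 - p.2)
  /-- finite mean charge density `e₀ = E|ψ₀(x)|²` -/
  charge : ∃ e₀ : ℝ≥0, ∀ᵐ x : Space3, ∫⁻ ω, ‖Ψ ω x‖ₑ ^ 2 ∂μ₀ = e₀
  /-- strong uniform mixing -/
  mixing : Tendsto (mixingCoeff μ₀) atTop (𝓝 0)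
  /-- rate of mixing -/
  mixing_rate : ∫⁻ r in Set.Ioi (0 : ℝ), ENNReal.ofReal (r ^ 2) * mixingCoeff μ₀ r ^ (1 / 2 : ℝ) < ∞

end DiracStat

end

open DiracStat

/-! By Prokhorov's theorem it suffices to show that the laws of `U(t)ψ₀` are tight in `H^{-ε}_loc`.
This follows from a bound on the mean local energy that is uniform in time, together with
compactness of the embedding of `L²_loc` into `H^{-ε}_loc` on locally bounded sets.

Dynamics. The Dirac equation is a symmetric hyperbolic system. Integrating `|u|²` against a weight
`f(⟨x⟩ + ct)`, with `f` decreasing and `c` at least the sum of the norms of the matrices, gives an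
energy that cannot grow (`antitone_weighted_energy`). Mollification carries the estimate over to
weak solutions: the energy in a ball of radius `R` at time `t` is at most the initial energy in the
ball of radius `R + c|t| + 3` (`IsWeakSol.locEnergy_le`). Uniqueness follows; existence is obtained
by the Fourier transform for `L²` data and by gluing for local data. The flow is therefore linear,
continuous and commutes with translations.

Uniform energy bound. The covariance of `ψ₀` depends only on `x - y`, so second moments of bounded
linear functionals of the field are translation invariant, and so is the mean energy `N(t)` of
`U(t)ψ₀` in balls of radius `R` (`lintegral_locEnergy_translate`). Pack `K³` disjoint such balls
into a ball of radius `5RK`, with `RK ≥ c|t| + 3`. Their total mean energy `K³ N(t)` is at most the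
mean initial energy in the ball of radius `6RK`, which is `e₀ (6RK)³ |B₁|`. Division by `K³` removes
all dependence on `t` (`exists_lintegral_locEnergy_diracFlow_le`).

Compactness. With suitable weights `aₙ ≠ 0`, Markov's inequality bounds the weighted energy `∑ aₙ²
∫_{|x|<n+1} |ψ|²` outside small probability, uniformly in `t`. A function of bounded weighted energy
is a step function times an element of a ball of `L²`. That ball is weakly compact, and weak
convergence gives pointwise convergence of localized Fourier transforms, hence convergence in every
negative Sobolev seminorm (`isCompact_embed_shellMul`). -/

noncomputable section

namespace DiracStat

/-! ### Local energies, extension by zero, translations -/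

namespace L2Loc

/-- The local energy `∫_{|x|<R} |ψ|² dx`. -/
def locEnergy (ψ : L2Loc) (R : ℝ) : ℝ≥0∞ := ∫⁻ x in Metric.ball (0 : Space3) R, ‖ψ x‖ₑ ^ 2

theorem coeFn_add (ψ φ : L2Loc) : ⇑(ψ + φ) =ᵐ[volume] ⇑ψ + ⇑φ := AEEqFun.coeFn_add ψ.1 φ.1
theorem coeFn_sub (ψ φ : L2Loc) : ⇑(ψ - φ) =ᵐ[volume] ⇑ψ - ⇑φ := AEEqFun.coeFn_sub ψ.1 φ.1
theorem coeFn_smul (c : ℂ) (ψ : L2Loc) : ⇑(c • ψ) =ᵐ[volume] c • ⇑ψ := AEEqFun.coeFn_smul c ψ.1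

theorem ext {ψ φ : L2Loc} (h : ψ =ᵐ[volume] φ) : ψ = φ := Subtype.ext (AEEqFun.ext h)

theorem aestronglyMeasurable (ψ : L2Loc) : AEStronglyMeasurable ψ volume := ψ.1.aestronglyMeasurable

theorem coeFn_restrictBall (R : Set.Ioi (0 : ℝ)) (ψ : L2Loc) :
    restrictBall R ψ =ᵐ[volume.restrict (Metric.ball (0 : Space3) (R : ℝ))] ψ :=
  (ψ.memLp_ball R.2).coeFn_toLp

theorem enorm_Lp_two_sq {μ : Measure Space3} (f : Lp Spinor 2 μ) :
    ‖f‖ₑ ^ 2 = ∫⁻ x, ‖f x‖ₑ ^ 2 ∂μ := by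
  rw [Lp.enorm_def, eLpNorm_eq_lintegral_rpow_enorm_toReal (by norm_num) (by norm_num)]
  rw [← ENNReal.rpow_natCast, ← ENNReal.rpow_mul]
  norm_num

theorem enorm_restrictBall_sq (R : Set.Ioi (0 : ℝ)) (ψ : L2Loc) :
    ‖restrictBall R ψ‖ₑ ^ 2 = ψ.locEnergy R := by
  rw [enorm_Lp_two_sq]
  refine lintegral_congr_ae ?_
  filter_upwards [coeFn_restrictBall R ψ] with x hx
  rw [hx]

theorem norm_restrictBall_le {R S : Set.Ioi (0 : ℝ)} {ψ φ : L2Loc} {C : ℝ} (hC : 0 ≤ C)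
    (h : ψ.locEnergy R ≤ ENNReal.ofReal C ^ 2 * φ.locEnergy S) :
    ‖restrictBall R ψ‖ ≤ C * ‖restrictBall S φ‖ := by
  rw [← enorm_restrictBall_sq, ← enorm_restrictBall_sq, ← mul_pow,
    ENNReal.pow_le_pow_left_iff two_ne_zero] at h
  rwa [← ofReal_norm, ← ofReal_norm, ← ENNReal.ofReal_mul hC,
    ENNReal.ofReal_le_ofReal_iff (by positivity)] at h

theorem locEnergy_mono (ψ : L2Loc) {R S : ℝ} (h : R ≤ S) : ψ.locEnergy R ≤ ψ.locEnergy S :=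
  lintegral_mono_set (Metric.ball_subset_ball h)

theorem ae_eq_zero_of_locEnergy {ψ : L2Loc} {R : ℝ} (h : ψ.locEnergy R = 0) :
    ∀ᵐ x, x ∈ Metric.ball (0 : Space3) R → ψ x = 0 := by
  rw [← ae_restrict_iff' measurableSet_ball]
  rw [locEnergy, lintegral_eq_zero_iff' (by have := ψ.aestronglyMeasurable; fun_prop)] at h
  filter_upwards [h] with x hx
  simpa using hx

theorem locEnergy_sub_eq_zero_iff {ψ φ : L2Loc} {R : ℝ} :
    (ψ - φ).locEnergy R = 0 ↔ ∀ᵐ x, x ∈ Metric.ball (0 : Space3) R → ψ x = φ x := by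
  constructor
  · intro h
    filter_upwards [ae_eq_zero_of_locEnergy h, coeFn_sub ψ φ] with x hx h' hxR
    have := hx hxR
    rw [h', Pi.sub_apply, sub_eq_zero] at this
    exact this
  · intro h
    have : ∀ᵐ x, x ∈ Metric.ball (0 : Space3) R → (ψ - φ) x = 0 := by
      filter_upwards [h, coeFn_sub ψ φ] with x hx h' hxR
      rw [h', Pi.sub_apply, hx hxR, sub_self]
    rw [locEnergy, setLIntegral_congr_fun_ae (g := 0) measurableSet_ball
      (this.mono fun x hx h' => by simp [hx h'])]
    simp

theorem eq_of_locEnergy {ψ φ : L2Loc} (h : ∀ R : ℝ, 0 < R → (ψ - φ).locEnergy R = 0) : ψ = φ := by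
  refine ext ?_
  have h' : ∀ n : ℕ, ∀ᵐ x, x ∈ Metric.ball (0 : Space3) (n + 1) → ψ x = φ x := fun n =>
    locEnergy_sub_eq_zero_iff.1 (h _ (by positivity))
  filter_upwards [ae_all_iff.2 h'] with x hx
  obtain ⟨n, hn⟩ := exists_nat_gt ‖x‖
  exact hx n (by rw [mem_ball_zero_iff]; linarith)

theorem aestronglyMeasurable_of_ball {f : Space3 → Spinor}
    (hf : ∀ R : ℝ, 0 < R → AEStronglyMeasurable f (volume.restrict (Metric.ball (0 : Space3) R))) :
    AEStronglyMeasurable f volume := by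
  have h := (aestronglyMeasurable_iUnion_iff (μ := volume) (f := f)
    (s := fun n : ℕ => Metric.ball (0 : Space3) (n + 1))).2 fun n => hf _ (by positivity)
  have hU : (⋃ n : ℕ, Metric.ball (0 : Space3) ((n : ℝ) + 1)) = Set.univ := by
    refine Set.eq_univ_of_forall fun x => Set.mem_iUnion.2 ?_
    obtain ⟨n, hn⟩ := exists_nat_gt ‖x‖
    exact ⟨n, by rw [mem_ball_zero_iff]; linarith⟩
  rwa [hU, Measure.restrict_univ] at h

/-- The class of a locally square integrable function. -/
def ofFun (f : Space3 → Spinor)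
    (hf : ∀ R : ℝ, 0 < R → MemLp f 2 (volume.restrict (Metric.ball (0 : Space3) R))) : L2Loc :=
  ⟨AEEqFun.mk f (aestronglyMeasurable_of_ball fun R hR => (hf R hR).1), fun R hR =>
    (memLp_congr_ae (ae_restrict_of_ae (AEEqFun.coeFn_mk _ _))).2 (hf R hR)⟩

theorem coeFn_ofFun {f : Space3 → Spinor}
    (hf : ∀ R : ℝ, 0 < R → MemLp f 2 (volume.restrict (Metric.ball (0 : Space3) R))) :
    ofFun f hf =ᵐ[volume] f := AEEqFun.coeFn_mk _ _

/-- Global `L²` functions as elements of `H`. -/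
def ofLp : Lp Spinor 2 (volume : Measure Space3) →ₗ[ℂ] L2Loc where
  toFun f := ⟨f.1, fun _ _ => (Lp.memLp f).restrict _⟩
  map_add' _ _ := rfl
  map_smul' _ _ := rfl

theorem coeFn_ofLp (f : Lp Spinor 2 (volume : Measure Space3)) : ⇑(ofLp f) = ⇑f := rfl

theorem locEnergy_ofLp_le (f : Lp Spinor 2 (volume : Measure Space3)) (R : ℝ) :
    (ofLp f).locEnergy R ≤ ‖f‖ₑ ^ 2 := by
  rw [enorm_Lp_two_sq]
  exact setLIntegral_le_lintegral _ _

theorem continuous_of_restrictBall {X : Type*} [TopologicalSpace X] {F : X → L2Loc}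
    (h : ∀ R : Set.Ioi (0 : ℝ), ∀ x, Tendsto (fun y => ‖restrictBall R (F y - F x)‖) (𝓝 x) (𝓝 0)) :
    Continuous F := by
  rw [continuous_iff_continuousAt]
  intro x
  rw [ContinuousAt, withSeminorms.tendsto_nhds]
  intro R ε hε
  filter_upwards [(h R x).eventually (gt_mem_nhds hε)] with y hy
  exact hy

theorem continuous_restrictBall (R : Set.Ioi (0 : ℝ)) : Continuous (restrictBall R) := by
  have : IsTopologicalAddGroup L2Loc := withSeminorms.topologicalAddGroup
  refine WithSeminorms.continuous_normedSpace_rng _ withSeminorms (restrictBall R) ?_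
  exact ⟨{R}, 1, by simp [energySeminorm]⟩

theorem continuous_ofLp : Continuous ofLp := by
  refine continuous_of_restrictBall fun R f => ?_
  refine squeeze_zero (fun _ => norm_nonneg _) (g := fun g => ‖g - f‖) (fun g => ?_) ?_
  · rw [← map_sub]
    have := locEnergy_ofLp_le (g - f) R
    rwa [← enorm_restrictBall_sq, ENNReal.pow_le_pow_left_iff two_ne_zero, enorm_le_iff_norm_le]
      at this
  · exact tendsto_iff_norm_sub_tendsto_zero.1 tendsto_id

/-- Extension by zero of square integrable functions on a ball. -/
def zeroExtend (R : Set.Ioi (0 : ℝ)) :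
    Lp Spinor 2 (volume.restrict (Metric.ball (0 : Space3) (R : ℝ))) →ₗ[ℂ]
      Lp Spinor 2 (volume : Measure Space3) where
  toFun f := ((memLp_indicator_iff_restrict measurableSet_ball).2 (Lp.memLp f)).toLp
    ((Metric.ball (0 : Space3) (R : ℝ)).indicator f)
  map_add' f g := by
    rw [← MemLp.toLp_add]
    refine MemLp.toLp_congr _ _ ?_
    rw [← Set.indicator_add']
    exact (ae_eq_restrict_iff_indicator_ae_eq measurableSet_ball).1 (Lp.coeFn_add f g)
  map_smul' c f := by
    rw [RingHom.id_apply, ← MemLp.toLp_const_smul]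
    refine MemLp.toLp_congr _ _ ?_
    refine ((ae_eq_restrict_iff_indicator_ae_eq measurableSet_ball).1 (Lp.coeFn_smul c f)).trans ?_
    exact (Set.indicator_const_smul (M := Spinor) _ c f).eventuallyEq

theorem coeFn_zeroExtend (R : Set.Ioi (0 : ℝ))
    (f : Lp Spinor 2 (volume.restrict (Metric.ball (0 : Space3) (R : ℝ)))) :
    zeroExtend R f =ᵐ[volume] (Metric.ball (0 : Space3) (R : ℝ)).indicator f := by
  rw [zeroExtend, LinearMap.coe_mk, AddHom.coe_mk]
  exact MemLp.coeFn_toLp _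

theorem restrictBall_zeroExtend (R : Set.Ioi (0 : ℝ))
    (f : Lp Spinor 2 (volume.restrict (Metric.ball (0 : Space3) (R : ℝ)))) :
    restrictBall R (ofLp (zeroExtend R f)) = f := by
  refine Lp.ext ?_
  filter_upwards [coeFn_restrictBall R (ofLp (zeroExtend R f)),
    ae_restrict_of_ae (coeFn_zeroExtend R f), ae_restrict_mem measurableSet_ball] with x h1 h2 h3
  rw [h1, coeFn_ofLp, h2, Set.indicator_of_mem h3]

theorem zeroExtend_restrictBall_ae (R : Set.Ioi (0 : ℝ)) (ψ : L2Loc) :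
    ∀ᵐ x, x ∈ Metric.ball (0 : Space3) (R : ℝ) → ofLp (zeroExtend R (restrictBall R ψ)) x = ψ x := by
  rw [← ae_restrict_iff' measurableSet_ball]
  filter_upwards [coeFn_restrictBall R ψ,
    ae_restrict_of_ae (coeFn_zeroExtend R (restrictBall R ψ)), ae_restrict_mem measurableSet_ball]
    with x h1 h2 h3
  rw [coeFn_ofLp, h2, Set.indicator_of_mem h3, h1]

theorem memLp_translate (a : Space3) (ψ : L2Loc) (R : ℝ) (hR : 0 < R) :
    MemLp (fun x => ψ (x + a)) 2 (volume.restrict (Metric.ball (0 : Space3) R)) := by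
  -- Cutting off to a larger ball makes the function globally square integrable, so that translation
  -- invariance of Lebesgue measure applies; on `|x| < R` the cutoff is not seen after the shift.
  have h : MemLp ((Metric.ball (0 : Space3) (R + ‖a‖)).indicator ψ) 2 volume :=
    (memLp_indicator_iff_restrict measurableSet_ball).2 (ψ.memLp_ball (by positivity))
  have h' := (h.comp_measurePreserving (measurePreserving_add_right volume a)).restrict
    (Metric.ball (0 : Space3) R)
  refine (memLp_congr_ae ?_).1 h'
  filter_upwards [ae_restrict_mem measurableSet_ball] with x hx
  refine Set.indicator_of_mem ?_ _
  rw [mem_ball_zero_iff] at hx ⊢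
  exact (norm_add_le _ _).trans_lt (by linarith)

/-- The translate `x ↦ ψ(x + a)`. -/
def translate (a : Space3) (ψ : L2Loc) : L2Loc := ofFun (fun x => ψ (x + a)) (memLp_translate a ψ)

theorem coeFn_translate (a : Space3) (ψ : L2Loc) :
    translate a ψ =ᵐ[volume] fun x => ψ (x + a) := coeFn_ofFun _

theorem translate_sub (a : Space3) (ψ φ : L2Loc) :
    translate a (ψ - φ) = translate a ψ - translate a φ := by
  refine ext ?_
  filter_upwards [coeFn_translate a (ψ - φ), coeFn_translate a ψ, coeFn_translate a φ,
    coeFn_sub (translate a ψ) (translate a φ),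
    (measurePreserving_add_right volume a).quasiMeasurePreserving.ae (coeFn_sub ψ φ)]
    with x h1 h2 h3 h4 h5
  rw [h1, h4, Pi.sub_apply, h2, h3, h5, Pi.sub_apply]

theorem locEnergy_translate (a : Space3) (ψ : L2Loc) (R : ℝ) :
    (translate a ψ).locEnergy R = ∫⁻ x in Metric.ball a R, ‖ψ x‖ₑ ^ 2 := by
  rw [locEnergy, lintegral_congr_ae (g := fun x => ‖ψ (x + a)‖ₑ ^ 2)]
  · have := (measurePreserving_add_right volume a).setLIntegral_comp_preimage_emb
      (measurableEmbedding_addRight a) (fun x => ‖ψ x‖ₑ ^ 2) (Metric.ball a R)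
    rw [← this]
    congr 2
    ext x
    simp [dist_eq_norm]
  · filter_upwards [ae_restrict_of_ae (coeFn_translate a ψ)] with x hx
    rw [hx]

theorem locEnergy_translate_le (a : Space3) (ψ : L2Loc) (R : ℝ) :
    (translate a ψ).locEnergy R ≤ ψ.locEnergy (R + ‖a‖) := by
  rw [locEnergy_translate]
  refine lintegral_mono_set fun x hx => ?_
  rw [mem_ball_zero_iff]
  rw [mem_ball_iff_norm] at hx
  calc ‖x‖ = ‖(x - a) + a‖ := by simp
    _ ≤ _ := norm_add_le _ _
    _ < _ := by linarith

theorem continuous_translate (a : Space3) : Continuous (translate a) := by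
  refine continuous_of_restrictBall fun R ψ => ?_
  have h := ((continuous_restrictBall ⟨R + ‖a‖, by have := R.2; simp only [Set.mem_Ioi] at *; positivity⟩).tendsto ψ)
  rw [tendsto_iff_norm_sub_tendsto_zero] at h
  refine squeeze_zero (fun _ => norm_nonneg _) (fun φ => ?_) h
  rw [← translate_sub, ← map_sub]
  refine (norm_restrictBall_le (C := 1) zero_le_one ?_).trans (one_mul _).le
  simpa using locEnergy_translate_le a (φ - ψ) R

theorem integrable_smul {φ : Space3 → ℝ} (hφ : Continuous φ) (hc : HasCompactSupport φ)
    (ψ : L2Loc) : Integrable (fun x => φ x • ψ x) :=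
  ψ.locallyIntegrable.integrable_smul_left_of_hasCompactSupport hφ hc

end L2Loc

/-! ### The weak formulation of a symmetric hyperbolic system -/

/-- The standard basis of `ℝ³`. -/
abbrev stdBasis (k : Fin 3) : Space3 := EuclideanSpace.single k (1 : ℝ)

/-- Weak solutions in `C(ℝ, H)` of the system `∂ₜψ = -∑ₖ Aₖ ∂ₖψ - iBψ`. -/
structure IsWeakSol (A : Fin 3 → Spinor →L[ℂ] Spinor) (B : Spinor →L[ℂ] Spinor)
    (ψ : ℝ → L2Loc) : Prop where
  continuous : Continuous ψ
  equation : ∀ φ : Space3 → ℝ, ContDiff ℝ (⊤ : ℕ∞) φ → HasCompactSupport φ → ∀ t : ℝ,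
    HasDerivAt (fun s => ∫ x, φ x • ψ s x)
      (∑ k, A k (∫ x, fderiv ℝ φ x (stdBasis k) • ψ t x) -
        Complex.I • B (∫ x, φ x • ψ t x)) t

/-- The matrices of the Dirac equation as operators. -/
def alphaOp (k : Fin 3) : Spinor →L[ℂ] Spinor := Matrix.toEuclideanCLM (n := Fin 4) (𝕜 := ℂ) (diracAlpha k)

/-- The mass term of the Dirac equation as an operator. -/
def massOp (m : ℝ) : Spinor →L[ℂ] Spinor :=
  Matrix.toEuclideanCLM (n := Fin 4) (𝕜 := ℂ) ((m : ℂ) • diracBeta)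

/-- The minus sign from moving the derivative onto the test function cancels the one in front of
`α·∇`. From here on distributions are replaced by integrals, and only self-adjointness of the
coefficients matters, a class that also contains the time-reversed system. -/
theorem isDiracSolution_iff (m : ℝ) (ψ₀ : L2Loc) (ψ : ℝ → L2Loc) :
    IsDiracSolution m ψ₀ ψ ↔ IsWeakSol alphaOp (massOp m) ψ ∧ ψ 0 = ψ₀ := by
  have key : ∀ (φ : 𝓓((⊤ : Opens Space3), ℝ)) (t : ℝ),
      diracOperator m (ψ t).toDistribution φ =
        ∑ k, alphaOp k (∫ x, fderiv ℝ φ x (stdBasis k) • ψ t x) -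
        Complex.I • massOp m (∫ x, φ x • ψ t x) := by
    intro φ t
    have h1 : ∀ k : Fin 3, (∂_{(EuclideanSpace.single k (1 : ℝ) : Space3)} (ψ t).toDistribution) φ =
        -∫ x, fderiv ℝ φ x (stdBasis k) • ψ t x := by
      intro k
      rw [Distribution.lineDerivOp_apply_apply, map_neg, L2Loc.toDistribution_apply]
      congr 1
    have h2 : diracOperator m (ψ t).toDistribution φ =
      -(∑ k : Fin 3, alphaOp k ((∂_{(EuclideanSpace.single k (1 : ℝ) : Space3)} (ψ t).toDistribution) φ)) -
      Matrix.toEuclideanCLM (n := Fin 4) (𝕜 := ℂ) ((Complex.I * (m : ℂ)) • diracBeta) ((ψ t).toDistribution φ) := by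
      simp only [diracOperator, Fin.sum_univ_three]
      rfl
    rw [h2]
    simp only [h1, map_neg, Finset.sum_neg_distrib, neg_neg, L2Loc.toDistribution_apply]
    rw [mul_smul, map_smul]
    rfl
  constructor
  · intro h
    refine ⟨⟨h.continuous, fun φ hφ hc t => ?_⟩, h.initial⟩
    let Φ : 𝓓((⊤ : Opens Space3), ℝ) := ⟨φ, hφ, hc, fun _ _ => trivial⟩
    have := h.equation Φ t
    rw [key] at this
    simp only [L2Loc.toDistribution_apply] at this
    exact this
  · rintro ⟨h, h0⟩
    refine ⟨h.continuous, h0, fun φ t => ?_⟩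
    rw [key]
    simp only [L2Loc.toDistribution_apply]
    exact h.equation φ φ.contDiff φ.hasCompactSupport t

theorem isSelfAdjoint_alphaOp (k : Fin 3) : IsSelfAdjoint (alphaOp k) := by
  have h : IsSelfAdjoint (diracAlpha k) := by
    change (diracAlpha k).conjTranspose = diracAlpha k
    fin_cases k <;>
    · ext i j
      fin_cases i <;> fin_cases j <;>
      simp [diracAlpha, pauli, finSumFinEquiv, Matrix.fromBlocks, Matrix.conjTranspose_apply, Fin.addCases]
  exact h.map _

theorem isSelfAdjoint_massOp (m : ℝ) : IsSelfAdjoint (massOp m) := by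
  have h : IsSelfAdjoint ((m : ℂ) • diracBeta) := by
    change ((m : ℂ) • diracBeta).conjTranspose = (m : ℂ) • diracBeta
    ext i j
    fin_cases i <;> fin_cases j <;>
    simp [diracBeta, finSumFinEquiv, Matrix.fromBlocks, Matrix.conjTranspose_apply, Fin.addCases]
  exact h.map _

/-! ### Linearity and symmetries of weak solutions. -/

namespace IsWeakSol

variable {A : Fin 3 → Spinor →L[ℂ] Spinor} {B : Spinor →L[ℂ] Spinor} {ψ χ : ℝ → L2Loc}

theorem integral_sub (φ : Space3 → ℝ) (hφ : Continuous φ) (hc : HasCompactSupport φ) (f g : L2Loc) :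
    ∫ x, φ x • (f - g) x = (∫ x, φ x • f x) - ∫ x, φ x • g x := by
  rw [← MeasureTheory.integral_sub (f.integrable_smul hφ hc) (g.integrable_smul hφ hc)]
  refine integral_congr_ae ?_
  filter_upwards [L2Loc.coeFn_sub f g] with x hx
  rw [hx, Pi.sub_apply, smul_sub]

theorem integral_add (φ : Space3 → ℝ) (hφ : Continuous φ) (hc : HasCompactSupport φ) (f g : L2Loc) :
    ∫ x, φ x • (f + g) x = (∫ x, φ x • f x) + ∫ x, φ x • g x := by
  rw [← MeasureTheory.integral_add (f.integrable_smul hφ hc) (g.integrable_smul hφ hc)]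
  refine integral_congr_ae ?_
  filter_upwards [L2Loc.coeFn_add f g] with x hx
  rw [hx, Pi.add_apply, smul_add]

theorem integral_smul (φ : Space3 → ℝ) (c : ℂ) (f : L2Loc) :
    ∫ x, φ x • (c • f) x = c • (∫ x, φ x • f x) := by
  rw [← MeasureTheory.integral_smul]
  refine integral_congr_ae ?_
  filter_upwards [L2Loc.coeFn_smul c f] with x hx
  rw [hx, Pi.smul_apply, smul_comm]

theorem continuous_fderiv_apply {φ : Space3 → ℝ} (hφ : ContDiff ℝ (⊤ : ℕ∞) φ) (v : Space3) :
    Continuous fun x => fderiv ℝ φ x v :=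
  (hφ.continuous_fderiv (by simp)).clm_apply continuous_const

theorem hasCompactSupport_fderiv_apply {φ : Space3 → ℝ} (hc : HasCompactSupport φ) (v : Space3) :
    HasCompactSupport fun x => fderiv ℝ φ x v := hc.fderiv_apply ℝ v

theorem add (h : IsWeakSol A B ψ) (h' : IsWeakSol A B χ) : IsWeakSol A B (ψ + χ) := by
  have : IsTopologicalAddGroup L2Loc := L2Loc.withSeminorms.topologicalAddGroup
  refine ⟨h.continuous.add h'.continuous, fun φ hφ hc t => ?_⟩
  have := (h.equation φ hφ hc t).add (h'.equation φ hφ hc t)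
  refine (this.congr_deriv ?_).congr_of_eventuallyEq (Eventually.of_forall fun s => ?_)
  · simp only [Pi.add_apply]
    rw [integral_add φ hφ.continuous hc, map_add, smul_add]
    simp only [integral_add _ (continuous_fderiv_apply hφ _) (hasCompactSupport_fderiv_apply hc _),
      map_add, Finset.sum_add_distrib]
    abel
  · exact integral_add φ hφ.continuous hc _ _

theorem smul (h : IsWeakSol A B ψ) (c : ℂ) : IsWeakSol A B (c • ψ) := by
  have : ContinuousSMul ℂ L2Loc := L2Loc.withSeminorms.continuousSMul
  refine ⟨h.continuous.const_smul c, fun φ hφ hc t => ?_⟩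
  have := (h.equation φ hφ hc t).const_smul c
  refine (this.congr_deriv ?_).congr_of_eventuallyEq (Eventually.of_forall fun s => ?_)
  · simp only [Pi.smul_apply]
    simp only [integral_smul, map_smul, ← Finset.smul_sum, smul_sub]
    rw [smul_comm c]
  · exact integral_smul φ c _

theorem sub (h : IsWeakSol A B ψ) (h' : IsWeakSol A B χ) : IsWeakSol A B (ψ - χ) := by
  have := h.add (h'.smul (-1))
  rwa [neg_one_smul, ← sub_eq_add_neg] at this

/-- Changing the sign of the coefficients keeps them self-adjoint and keeps their norms, so
estimates for `t ≥ 0` transfer to `t ≤ 0`. -/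
theorem reverse (h : IsWeakSol A B ψ) : IsWeakSol (-A) (-B) (fun t => ψ (-t)) := by
  refine ⟨h.continuous.comp continuous_neg, fun φ hφ hc t => ?_⟩
  have := (h.equation φ hφ hc (-t)).scomp t (hasDerivAt_neg t)
  refine this.congr_deriv ?_
  simp only [Pi.neg_apply, neg_apply, Finset.sum_neg_distrib, smul_neg, neg_smul, one_smul]
  abel

theorem translate (h : IsWeakSol A B ψ) (a : Space3) :
    IsWeakSol A B (fun t => (ψ t).translate a) := by
  have key : ∀ (φ : Space3 → ℝ) (f : L2Loc),
      ∫ x, φ x • f.translate a x = ∫ x, φ (x - a) • f x := by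
    intro φ f
    rw [← integral_add_right_eq_self (μ := volume) (fun x => φ (x - a) • f x) a]
    refine integral_congr_ae ?_
    filter_upwards [f.coeFn_translate a] with x hx
    simp only [add_sub_cancel_right, hx]
  refine ⟨(L2Loc.continuous_translate a).comp h.continuous, fun φ hφ hc t => ?_⟩
  have hφ' : ContDiff ℝ (⊤ : ℕ∞) fun x => φ (x - a) := hφ.comp (contDiff_id.sub contDiff_const)
  have hc' : HasCompactSupport fun x => φ (x - a) :=
    hc.comp_homeomorph (Homeomorph.subRight a)
  have := h.equation _ hφ' hc' t
  simp only [key]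
  simpa only [fderiv_comp_sub] using this

end IsWeakSol

end DiracStat

end

noncomputable section

namespace DiracStat

/-! ### Mollification -/

/-- The mollification `ρ * ψ`. -/
def mollify (ρ : Space3 → ℝ) (ψ : L2Loc) (x : Space3) : Spinor := ∫ y, ρ (x - y) • ψ y

theorem mollify_eq_convolution (ρ : Space3 → ℝ) (ψ : L2Loc) :
    mollify ρ ψ = convolution ρ ψ (ContinuousLinearMap.lsmul ℝ ℝ) volume := by
  ext1 x
  exact convolution_lsmul_swap.symm

theorem contDiff_mollify {ρ : Space3 → ℝ} (hρ : ContDiff ℝ (⊤ : ℕ∞) ρ) (hc : HasCompactSupport ρ)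
    (ψ : L2Loc) : ContDiff ℝ (⊤ : ℕ∞) (mollify ρ ψ) := by
  rw [mollify_eq_convolution]
  exact hc.contDiff_convolution_left _ hρ ψ.locallyIntegrable

theorem fderiv_mollify {ρ : Space3 → ℝ} (hρ : ContDiff ℝ (⊤ : ℕ∞) ρ) (hc : HasCompactSupport ρ)
    (ψ : L2Loc) (x v : Space3) :
    fderiv ℝ (mollify ρ ψ) x v = mollify (fun z => fderiv ℝ ρ z v) ψ x := by
  rw [mollify_eq_convolution]
  unfold mollify
  have hg : LocallyIntegrable ψ volume := ψ.locallyIntegrable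
  generalize (ψ : Space3 → Spinor) = g at hg
  have h := hc.hasFDerivAt_convolution_left (ContinuousLinearMap.lsmul ℝ ℝ (E := Spinor))
    (hρ.of_le (by exact_mod_cast le_top)) hg x
  have hi := ((hc.fderiv ℝ).convolutionExists_left
    ((ContinuousLinearMap.lsmul ℝ ℝ (E := Spinor)).precompL Space3)
      (hρ.continuous_fderiv (by simp)) hg x).integrable_swap
  rw [h.fderiv, convolution_eq_swap, ContinuousLinearMap.integral_apply hi]
  rfl

/-- For `‖x‖ ≤ r` and `supp κ` in a ball of radius `d`, only points of norm below `r + d`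
contribute, and on that ball the `L¹` norm is controlled by the `L²` norm. The constants are
independent of `ψ`. -/
theorem norm_mollify_le {κ : Space3 → ℝ} (hκ : Continuous κ) (hc : HasCompactSupport κ) (r : ℝ) :
    ∃ (C : ℝ) (S : Set.Ioi (0 : ℝ)), ∀ (ψ : L2Loc) (x : Space3), ‖x‖ ≤ r →
      ‖mollify κ ψ x‖ ≤ C * ‖L2Loc.restrictBall S ψ‖ := by
  obtain ⟨M, hM⟩ := hκ.bounded_above_of_compact_support hc
  obtain ⟨d, hd⟩ := hc.isCompact.isBounded.subset_ball (0 : Space3)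
  let S : Set.Ioi (0 : ℝ) := ⟨max 1 (r + d), Set.mem_Ioi.2 (lt_max_of_lt_left one_pos)⟩
  set μ := (volume : Measure Space3).restrict (Metric.ball (0 : Space3) (S : ℝ)) with hμ
  have hfin : IsFiniteMeasure μ := isFiniteMeasure_restrict.2 measure_ball_lt_top.ne
  refine ⟨M * μ.real Set.univ ^ (1 / 2 : ℝ), S, fun ψ x hx => ?_⟩
  have hM0 : 0 ≤ M := (norm_nonneg _).trans (hM 0)
  have hint : Integrable (L2Loc.restrictBall S ψ) μ := (Lp.memLp _).integrable (by norm_num)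
  have h1 : mollify κ ψ x = ∫ y, κ (x - y) • L2Loc.restrictBall S ψ y ∂μ := by
    rw [mollify, ← setIntegral_eq_integral_of_forall_compl_eq_zero
      (s := Metric.ball (0 : Space3) (S : ℝ))]
    · refine integral_congr_ae ?_
      filter_upwards [L2Loc.coeFn_restrictBall S ψ] with y hy
      rw [hy]
    · intro y hy
      have : x - y ∉ tsupport κ := by
        intro h
        have h2 := hd h
        rw [mem_ball_zero_iff] at h2
        apply hy
        rw [mem_ball_zero_iff]
        calc ‖y‖ = ‖x - (x - y)‖ := by simp
          _ ≤ ‖x‖ + ‖x - y‖ := norm_sub_le _ _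
          _ < r + d := by linarith
          _ ≤ _ := le_max_right _ _
      rw [image_eq_zero_of_notMem_tsupport this, zero_smul]
  have h2 : ∫ y, ‖L2Loc.restrictBall S ψ y‖ ∂μ ≤
      ‖L2Loc.restrictBall S ψ‖ * μ.real Set.univ ^ (1 / 2 : ℝ) := by
    have h3 := eLpNorm_le_eLpNorm_mul_rpow_measure_univ (p := 1) (q := 2) (μ := μ) (by norm_num)
      (Lp.aestronglyMeasurable (L2Loc.restrictBall S ψ))
    rw [eLpNorm_one_eq_lintegral_enorm] at h3
    have h4 := ENNReal.toReal_mono (ENNReal.mul_ne_top (Lp.eLpNorm_ne_top _)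
      (ENNReal.rpow_ne_top_of_nonneg (by norm_num) (measure_ne_top _ _))) h3
    rw [← integral_norm_eq_lintegral_enorm hint.1, ENNReal.toReal_mul, ← ENNReal.toReal_rpow,
      ← Lp.norm_def] at h4
    refine h4.trans (le_of_eq ?_)
    congr 2
    norm_num
  rw [h1]
  calc _ ≤ ∫ y, ‖κ (x - y) • L2Loc.restrictBall S ψ y‖ ∂μ := norm_integral_le_integral_norm _
    _ ≤ ∫ y, M * ‖L2Loc.restrictBall S ψ y‖ ∂μ := by
      refine integral_mono_of_nonneg (Eventually.of_forall fun _ => norm_nonneg _)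
        (hint.norm.const_mul M) (Eventually.of_forall fun y => ?_)
      simp only [norm_smul]
      gcongr
      exact hM _
    _ = M * ∫ y, ‖L2Loc.restrictBall S ψ y‖ ∂μ := integral_const_mul _ _
    _ ≤ M * (‖L2Loc.restrictBall S ψ‖ * μ.real Set.univ ^ (1 / 2 : ℝ)) := by gcongr
    _ = _ := by ring

/-- A continuous seminorm of `ψ t` is bounded on a compact time interval. With `κ` the mollifier or
one of its derivatives, this supplies the domination needed to differentiate the energy integral in
time. -/
theorem norm_mollify_le_of_continuous {κ : Space3 → ℝ} (hκ : Continuous κ)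
    (hc : HasCompactSupport κ) {ψ : ℝ → L2Loc} (hψ : Continuous ψ) (r T : ℝ) :
    ∃ C : ℝ, ∀ t, |t| ≤ T → ∀ x, ‖x‖ ≤ r → ‖mollify κ (ψ t) x‖ ≤ C := by
  obtain ⟨C, S, hCS⟩ := norm_mollify_le hκ hc r
  have hcont : Continuous fun t => C * ‖L2Loc.restrictBall S (ψ t)‖ :=
    continuous_const.mul ((L2Loc.continuous_restrictBall S).comp hψ).norm
  obtain ⟨K, hK⟩ := (isCompact_Icc (a := -T) (b := T)).bddAbove_image hcont.continuousOn
  refine ⟨K, fun t ht x hx => (hCS _ x hx).trans (hK ⟨t, ?_, rfl⟩)⟩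
  exact abs_le.1 ht

/-- Testing the weak equation with `y ↦ ρ (x - y)` shows that the mollification is a classical
solution: the coefficients are constant, and the `y`-derivative of this test function is minus the
derivative of `ρ` at `x - y`. -/
theorem hasDerivAt_mollify {A : Fin 3 → Spinor →L[ℂ] Spinor} {B : Spinor →L[ℂ] Spinor}
    {ψ : ℝ → L2Loc} (h : IsWeakSol A B ψ) {ρ : Space3 → ℝ} (hρ : ContDiff ℝ (⊤ : ℕ∞) ρ)
    (hc : HasCompactSupport ρ) (t : ℝ) (x : Space3) :
    HasDerivAt (fun s => mollify ρ (ψ s) x)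
      (-(∑ k, A k (fderiv ℝ (mollify ρ (ψ t)) x (stdBasis k))) -
        Complex.I • B (mollify ρ (ψ t) x)) t := by
  have h1 := h.equation (fun y => ρ (x - y)) (hρ.comp (contDiff_const.sub contDiff_id))
    (hc.comp_homeomorph (Homeomorph.subLeft x)) t
  refine h1.congr_deriv ?_
  congr 1
  rw [← Finset.sum_neg_distrib]
  refine Finset.sum_congr rfl fun k _ => ?_
  rw [fderiv_mollify hρ hc, mollify, ← map_neg, ← integral_neg]
  congr 2
  ext1 y
  have h2 : HasFDerivAt (fun y => ρ (x - y)) ((fderiv ℝ ρ (x - y)).comp (-ContinuousLinearMap.id ℝ Space3)) y :=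
    ((hρ.differentiable (by simp)) (x - y)).hasFDerivAt.comp y ((hasFDerivAt_id y).const_sub x)
  rw [h2.fderiv, ContinuousLinearMap.comp_apply, neg_apply, map_neg, neg_smul]
  rfl

/-- Since `ρ` is a probability density, Cauchy-Schwarz with `ρ = ρ^{1/2} ρ^{1/2}` gives `|ρ * ψ|² ≤
ρ * |ψ|²`. After Tonelli, a point `y` contributes only if it lies within `δ` of the ball. -/
theorem lintegral_mollify_sq_le {ρ : Space3 → ℝ} (hρ : Continuous ρ) (hc : HasCompactSupport ρ)
    (hnn : ∀ x, 0 ≤ ρ x) (hint : ∫ x, ρ x = 1) {δ : ℝ} (hδ : ∀ x, δ ≤ ‖x‖ → ρ x = 0)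
    (ψ : L2Loc) (R : ℝ) :
    ∫⁻ x in Metric.ball (0 : Space3) R, ‖mollify ρ ψ x‖ₑ ^ 2 ≤ ψ.locEnergy (R + δ) := by
  have hl1 : ∫⁻ x, ENNReal.ofReal (ρ x) = 1 := by
    rw [← ofReal_integral_eq_lintegral_ofReal (hρ.integrable_of_hasCompactSupport hc)
      (Eventually.of_forall hnn), hint, ENNReal.ofReal_one]
  have hm := ψ.aestronglyMeasurable.aemeasurable.enorm
  have hρm : Measurable fun x => ENNReal.ofReal (ρ x) := hρ.measurable.ennreal_ofReal
  have hpt : ∀ x, ‖mollify ρ ψ x‖ₑ ^ 2 ≤ ∫⁻ y, ENNReal.ofReal (ρ (x - y)) * ‖ψ y‖ₑ ^ 2 := by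
    intro x
    have h1 : ‖mollify ρ ψ x‖ₑ ≤ ∫⁻ y, ENNReal.ofReal (ρ (x - y)) * ‖ψ y‖ₑ := by
      refine (enorm_integral_le_lintegral_enorm _).trans (le_of_eq ?_)
      congr 1
      ext1 y
      rw [enorm_smul, Real.enorm_of_nonneg (hnn _)]
    have hρx : Measurable fun y => ENNReal.ofReal (ρ (x - y)) := hρm.comp (measurable_const_sub x)
    have h2 := ENNReal.lintegral_mul_le_Lp_mul_Lq volume Real.HolderConjugate.two_two
      (f := fun y => ENNReal.ofReal (ρ (x - y)) ^ (1 / 2 : ℝ))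
      (g := fun y => ENNReal.ofReal (ρ (x - y)) ^ (1 / 2 : ℝ) * ‖ψ y‖ₑ)
      (hρx.pow_const _).aemeasurable ((hρx.pow_const _).aemeasurable.mul hm)
    simp only [Pi.mul_apply] at h2
    have e1 : ∀ y, ENNReal.ofReal (ρ (x - y)) ^ (1 / 2 : ℝ) *
        (ENNReal.ofReal (ρ (x - y)) ^ (1 / 2 : ℝ) * ‖ψ y‖ₑ) =
        ENNReal.ofReal (ρ (x - y)) * ‖ψ y‖ₑ := by
      intro y
      rw [← mul_assoc, ← ENNReal.rpow_add_of_nonneg _ _ (by norm_num) (by norm_num)]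
      norm_num
    have e2 : ∀ y, (ENNReal.ofReal (ρ (x - y)) ^ (1 / 2 : ℝ)) ^ (2 : ℝ) =
        ENNReal.ofReal (ρ (x - y)) := by
      intro y
      rw [← ENNReal.rpow_mul]
      norm_num
    have e3 : ∫⁻ y, ENNReal.ofReal (ρ (x - y)) = 1 := by
      rw [lintegral_sub_left_eq_self (fun y => ENNReal.ofReal (ρ y)) x, hl1]
    simp only [e1, ENNReal.mul_rpow_of_nonneg _ _ (zero_le_two : (0 : ℝ) ≤ 2), e2, e3,
      ENNReal.one_rpow, one_mul] at h2
    calc _ ≤ (∫⁻ y, ENNReal.ofReal (ρ (x - y)) * ‖ψ y‖ₑ) ^ 2 := by gcongr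
      _ ≤ ((∫⁻ y, ENNReal.ofReal (ρ (x - y)) * ‖ψ y‖ₑ ^ (2 : ℝ)) ^ (1 / 2 : ℝ)) ^ 2 := by gcongr
      _ = _ := by
        rw [← ENNReal.rpow_natCast, ← ENNReal.rpow_mul]
        norm_num
  calc _ ≤ ∫⁻ x in Metric.ball (0 : Space3) R,
        ∫⁻ y, ENNReal.ofReal (ρ (x - y)) * ‖ψ y‖ₑ ^ 2 := lintegral_mono hpt
    _ = ∫⁻ y, ∫⁻ x in Metric.ball (0 : Space3) R,
        ENNReal.ofReal (ρ (x - y)) * ‖ψ y‖ₑ ^ 2 := by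
      refine lintegral_lintegral_swap ?_
      refine AEMeasurable.mul ?_ ((hm.pow_const 2).comp_snd)
      exact (hρm.comp (measurable_fst.sub measurable_snd)).aemeasurable
    _ ≤ ∫⁻ y, (Metric.ball (0 : Space3) (R + δ)).indicator (fun y => ‖ψ y‖ₑ ^ 2) y := by
      refine lintegral_mono fun y => ?_
      have hρy : Measurable fun x => ENNReal.ofReal (ρ (x - y)) := hρm.comp (measurable_sub_const y)
      rw [lintegral_mul_const'' _ hρy.aemeasurable]
      by_cases hy : y ∈ Metric.ball (0 : Space3) (R + δ)
      · rw [Set.indicator_of_mem hy]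
        refine mul_le_of_le_one_left' ?_
        refine (setLIntegral_le_lintegral _ _).trans (le_of_eq ?_)
        rw [lintegral_sub_right_eq_self (fun y => ENNReal.ofReal (ρ y)) y, hl1]
      · rw [Set.indicator_of_notMem hy]
        refine (mul_eq_zero_of_left ?_ _).le
        rw [setLIntegral_congr_fun (g := fun _ => 0) measurableSet_ball, lintegral_zero]
        intro x hx
        rw [mem_ball_zero_iff] at hx hy
        simp only
        rw [hδ, ENNReal.ofReal_zero]
        have := norm_sub_norm_le y x
        rw [norm_sub_rev] at this
        linarith
    _ = _ := lintegral_indicator measurableSet_ball _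

/-! ### Energy estimate for smooth solutions -/

open scoped InnerProductSpace

theorem re_inner_apply_comm {C : Spinor →L[ℂ] Spinor} (hC : IsSelfAdjoint C) (v w : Spinor) :
    (⟪v, C w⟫_ℂ).re = (⟪w, C v⟫_ℂ).re := by
  rw [← ContinuousLinearMap.adjoint_inner_left, hC.adjoint_eq, ← inner_conj_symm, Complex.conj_re]

/-- `⟪v, C v⟫` is real. This removes the mass term from the energy balance and, with the whole
symbol as `C`, makes the propagator isometric. -/
theorem re_inner_I_smul_apply {C : Spinor →L[ℂ] Spinor} (hC : IsSelfAdjoint C) (v : Spinor) :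
    (⟪v, Complex.I • C v⟫_ℂ).re = 0 := by
  have h : (⟪v, C v⟫_ℂ).im = 0 := by
    rw [← Complex.conj_eq_iff_im, inner_conj_symm, ← ContinuousLinearMap.adjoint_inner_right,
      hC.adjoint_eq]
  rw [inner_smul_right, Complex.mul_re, h]
  simp

theorem hasDerivAt_norm_sq {u : ℝ → Spinor} {u' : Spinor} {t : ℝ} (h : HasDerivAt u u' t) :
    HasDerivAt (fun s => ‖u s‖ ^ 2) (2 * (⟪u t, u'⟫_ℂ).re) t := by
  have h1 := Complex.reCLM.hasFDerivAt.comp_hasDerivAt t (h.inner ℂ h)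
  have h2 : ∀ s, ‖u s‖ ^ 2 = Complex.reCLM (⟪u s, u s⟫_ℂ) := fun s => by
    rw [inner_self_eq_norm_sq_to_K]
    simp [← Complex.ofReal_pow]
  simp only [h2]
  refine h1.congr_deriv ?_
  rw [Complex.reCLM_apply, Complex.add_re, ← inner_conj_symm u', Complex.conj_re, two_mul]

/-- Self-adjointness makes both terms of the product rule equal, so the transport term in the
derivative of `|u|²` is the divergence of the flux `⟪u, Aₖ u⟫`. -/
theorem fderiv_re_inner {C : Spinor →L[ℂ] Spinor} (hC : IsSelfAdjoint C) {u : Space3 → Spinor}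
    (hu : ContDiff ℝ 1 u) (x v : Space3) :
    fderiv ℝ (fun y => (⟪u y, C (u y)⟫_ℂ).re) x v = 2 * (⟪u x, C (fderiv ℝ u x v)⟫_ℂ).re := by
  have h0 := (hu.differentiable (by norm_num) x).hasFDerivAt
  have h1 : HasFDerivAt (fun y => C (u y)) ((C.restrictScalars ℝ).comp (fderiv ℝ u x)) x :=
    (C.restrictScalars ℝ).hasFDerivAt.comp x h0
  have h2 := Complex.reCLM.hasFDerivAt.comp x (h0.inner ℂ h1)
  have h3 : HasFDerivAt (fun y => (⟪u y, C (u y)⟫_ℂ).re) _ x := h2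
  rw [h3.fderiv]
  change (⟪u x, C (fderiv ℝ u x v)⟫_ℂ + ⟪fderiv ℝ u x v, C (u x)⟫_ℂ).re = _
  rw [Complex.add_re, re_inner_apply_comm hC (fderiv ℝ u x v), two_mul]

theorem contDiff_re_inner (C : Spinor →L[ℂ] Spinor) {u : Space3 → Spinor}
    (hu : ContDiff ℝ 1 u) : ContDiff ℝ 1 (fun y => (⟪u y, C (u y)⟫_ℂ).re) :=
  Complex.reCLM.contDiff.comp (hu.inner ℂ ((C.restrictScalars ℝ).contDiff.comp hu))

/-- The smooth substitute `(1 + |x|²)^{1/2}` for `|x|`. -/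
def japaneseBracket (x : Space3) : ℝ := Real.sqrt (1 + ‖x‖ ^ 2)

theorem contDiff_japaneseBracket : ContDiff ℝ (⊤ : ℕ∞) japaneseBracket :=
  (contDiff_const.add (contDiff_norm_sq ℝ)).sqrt fun x => by positivity

theorem norm_le_japaneseBracket (x : Space3) : ‖x‖ ≤ japaneseBracket x :=
  Real.le_sqrt_of_sq_le (by linarith)

theorem japaneseBracket_le (x : Space3) : japaneseBracket x ≤ 1 + ‖x‖ := by
  refine Real.sqrt_le_iff.2 ⟨by positivity, ?_⟩
  nlinarith [norm_nonneg x]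

/-- The derivative is `xₖ / ⟨x⟩`. The bound `1` is what lets a weight moving with speed `∑ ‖Aₖ‖`
outrun the flux. -/
theorem abs_fderiv_japaneseBracket_le (x : Space3) (k : Fin 3) :
    |fderiv ℝ japaneseBracket x (stdBasis k)| ≤ 1 := by
  have h1 : HasFDerivAt (fun y : Space3 => 1 + ‖y‖ ^ 2) (2 • innerSL ℝ x) x :=
    ((hasStrictFDerivAt_norm_sq x).hasFDerivAt).const_add 1
  have h2 : HasFDerivAt japaneseBracket _ x := h1.sqrt (by positivity)
  have hj : (0 : ℝ) < Real.sqrt (1 + ‖x‖ ^ 2) := by positivity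
  rw [h2.fderiv]
  simp only [smul_apply, innerSL_apply_apply, smul_eq_mul, nsmul_eq_mul]
  rw [abs_mul, abs_mul, abs_of_pos (by positivity)]
  have h3 : |⟪x, stdBasis k⟫_ℝ| ≤ Real.sqrt (1 + ‖x‖ ^ 2) := by
    refine (abs_real_inner_le_norm _ _).trans ?_
    rw [PiLp.norm_single, norm_one, mul_one]
    exact norm_le_japaneseBracket x
  rw [Nat.cast_ofNat, abs_two]
  calc _ ≤ 1 / (2 * Real.sqrt (1 + ‖x‖ ^ 2)) * (2 * Real.sqrt (1 + ‖x‖ ^ 2)) := by gcongr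
    _ = 1 := by field_simp

end DiracStat

end

noncomputable section

namespace DiracStat

open scoped InnerProductSpace

theorem integral_weight_mul_fderiv {θ V : Space3 → ℝ} (hθ : ContDiff ℝ 1 θ)
    (hc : HasCompactSupport θ) (hV : ContDiff ℝ 1 V) (v : Space3) :
    ∫ x, θ x * fderiv ℝ V x v = -∫ x, fderiv ℝ θ x v * V x := by
  have h1 : Continuous fun x => fderiv ℝ θ x v :=
    (hθ.continuous_fderiv (by norm_num)).clm_apply continuous_const
  have h2 : Continuous fun x => fderiv ℝ V x v :=
    (hV.continuous_fderiv (by norm_num)).clm_apply continuous_const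
  refine integral_mul_fderiv_eq_neg_fderiv_mul_of_integrable ?_ ?_ ?_ ?_ ?_
  · exact (h1.mul hV.continuous).integrable_of_hasCompactSupport (hc.fderiv_apply ℝ v).mul_right
  · exact (hθ.continuous.mul h2).integrable_of_hasCompactSupport hc.mul_right
  · exact (hθ.continuous.mul hV.continuous).integrable_of_hasCompactSupport hc.mul_right
  · exact fun x _ => hθ.differentiable (by norm_num) x
  · exact fun x _ => hV.differentiable (by norm_num) x

/-- The energy with a weight that moves outward faster than the waves does not grow. -/
theorem antitone_weighted_energy {A : Fin 3 → Spinor →L[ℂ] Spinor} {B : Spinor →L[ℂ] Spinor}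
    (hA : ∀ k, IsSelfAdjoint (A k)) (hB : IsSelfAdjoint B) {c : ℝ} (hc : ∑ k, ‖A k‖ ≤ c)
    {u : ℝ → Space3 → Spinor} (hu : ∀ t, ContDiff ℝ 1 (u t))
    (heq : ∀ t x, HasDerivAt (fun s => u s x)
      (-(∑ k, A k (fderiv ℝ (u t) x (stdBasis k))) - Complex.I • B (u t x)) t)
    (hbd : ∀ r T : ℝ, ∃ C : ℝ, ∀ t, |t| ≤ T → ∀ x, ‖x‖ ≤ r → ‖u t x‖ ≤ C)
    (hbd' : ∀ (k : Fin 3) (r T : ℝ), ∃ C : ℝ, ∀ t, |t| ≤ T → ∀ x, ‖x‖ ≤ r →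
      ‖fderiv ℝ (u t) x (stdBasis k)‖ ≤ C)
    {f : ℝ → ℝ} (hf : ContDiff ℝ (⊤ : ℕ∞) f) (hanti : Antitone f)
    {a : ℝ} (hsupp : ∀ s, a ≤ s → f s = 0) :
    Antitone fun t => ∫ x, f (japaneseBracket x + c * t) * ‖u t x‖ ^ 2 := by
  have hf' : Continuous (deriv f) := hf.continuous_deriv (by simp)
  have hdf : ∀ s, HasDerivAt f (deriv f s) s := fun s => (hf.differentiable (by simp) s).hasDerivAt
  have hsupp' : ∀ s, a < s → deriv f s = 0 := by
    intro s hs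
    have : f =ᶠ[𝓝 s] fun _ => 0 := by
      filter_upwards [lt_mem_nhds hs] with y hy using hsupp y hy.le
    rw [this.deriv_eq, deriv_const]
  -- The time derivative of the integrand, with the transport term already written as a divergence
  -- so that it can be integrated by parts.
  set F' : ℝ → Space3 → ℝ := fun t x => c * deriv f (japaneseBracket x + c * t) * ‖u t x‖ ^ 2 -
    f (japaneseBracket x + c * t) *
      ∑ k, fderiv ℝ (fun y => (⟪u t y, A k (u t y)⟫_ℂ).re) x (stdBasis k) with hF'
  have hjc := contDiff_japaneseBracket.continuous
  have hθ : ∀ t, ContDiff ℝ 1 fun x => f (japaneseBracket x + c * t) := fun t =>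
    (hf.comp (contDiff_japaneseBracket.add contDiff_const)).of_le (by exact_mod_cast le_top)
  have hθc : ∀ t, HasCompactSupport fun x => f (japaneseBracket x + c * t) := by
    intro t
    refine HasCompactSupport.intro (isCompact_closedBall (0 : Space3) (a - c * t)) fun x hx => ?_
    rw [mem_closedBall_zero_iff, not_le] at hx
    exact hsupp _ (by linarith [norm_le_japaneseBracket x])
  have hV : ∀ t k, ContDiff ℝ 1 fun y => (⟪u t y, A k (u t y)⟫_ℂ).re := fun t k =>
    contDiff_re_inner (A k) (hu t)
  have hVc : ∀ t k, Continuous fun x =>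
      fderiv ℝ (fun y => (⟪u t y, A k (u t y)⟫_ℂ).re) x (stdBasis k) := fun t k =>
    ((hV t k).continuous_fderiv (by norm_num)).clm_apply continuous_const
  have hF'c : ∀ t, Continuous (F' t) := fun t => by
    have := (hu t).continuous
    have := (hθ t).continuous
    have h2 : Continuous fun x => deriv f (japaneseBracket x + c * t) :=
      hf'.comp (hjc.add continuous_const)
    have h3 : Continuous fun x =>
      ∑ k, fderiv ℝ (fun y => (⟪u t y, A k (u t y)⟫_ℂ).re) x (stdBasis k) :=
      continuous_finsetSum _ fun k _ => hVc t k
    fun_prop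
  have hderiv : ∀ t x, HasDerivAt (fun s => f (japaneseBracket x + c * s) * ‖u s x‖ ^ 2)
      (F' t x) t := by
    intro t x
    have h1 : HasDerivAt (fun s => japaneseBracket x + c * s) c t := by
      simpa using ((hasDerivAt_id t).const_mul c).const_add (japaneseBracket x)
    have h2 := ((hdf (japaneseBracket x + c * t)).comp t h1).mul (hasDerivAt_norm_sq (heq t x))
    refine h2.congr_deriv ?_
    rw [hF']
    simp only [fderiv_re_inner (hA _) (hu t), Function.comp]
    rw [inner_sub_right, inner_neg_right, Complex.sub_re, re_inner_I_smul_apply hB, inner_sum,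
      Complex.neg_re, Complex.re_sum, ← Finset.mul_sum]
    ring
  have hmain : ∀ t₀, HasDerivAt (fun t => ∫ x, f (japaneseBracket x + c * t) * ‖u t x‖ ^ 2)
      (∫ x, F' t₀ x) t₀ := by
    intro t₀
    -- For all times within `1` of `t₀` the weight and its derivative vanish beyond radius `r`, so
    -- one ball serves for the domination.
    set r := a + |c| * (|t₀| + 1) with hr
    have hzero : ∀ t, |t| ≤ |t₀| + 1 → ∀ x, r < ‖x‖ → F' t x = 0 := by
      intro t ht x hx
      have h1 : a < japaneseBracket x + c * t := by
        have h2 : -(|c| * (|t₀| + 1)) ≤ c * t := by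
          refine neg_le_of_abs_le ?_
          rw [abs_mul]
          gcongr
        linarith [norm_le_japaneseBracket x]
      rw [hF']
      simp only [hsupp _ h1.le, hsupp' _ h1, mul_zero, zero_mul, sub_zero]
    obtain ⟨C₀, hC₀⟩ := hbd r (|t₀| + 1)
    choose C hC using fun k => hbd' k r (|t₀| + 1)
    -- `[-K, K]` contains every argument `⟨x⟩ + ct` that occurs for `‖x‖ ≤ r` and these times,
    -- because `⟨x⟩ ≤ 1 + r`.
    set K := |a| + |r| + 1 + |c| * (|t₀| + 1) with hK
    obtain ⟨M, hM⟩ := (isCompact_Icc (a := -K) (b := K)).exists_bound_of_continuousOn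
      hf.continuous.continuousOn
    obtain ⟨M', hM'⟩ := (isCompact_Icc (a := -K) (b := K)).exists_bound_of_continuousOn
      hf'.continuousOn
    set b := |c| * M' * C₀ ^ 2 + M * ∑ k, 2 * (C₀ * (‖A k‖ * C k)) with hb
    have hbound : ∀ t, |t| ≤ |t₀| + 1 → ∀ x, ‖F' t x‖ ≤
        (Metric.closedBall (0 : Space3) r).indicator (fun _ => b) x := by
      intro t ht x
      by_cases hx : ‖x‖ ≤ r
      · rw [Set.indicator_of_mem (mem_closedBall_zero_iff.2 hx)]
        have hmem : japaneseBracket x + c * t ∈ Set.Icc (-K) K := by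
          have h2 : |c * t| ≤ |c| * (|t₀| + 1) := by rw [abs_mul]; gcongr
          have h3 := norm_le_japaneseBracket x
          have h4 := japaneseBracket_le x
          have h5 := abs_le.1 h2
          have h6 := le_abs_self r
          have h7 := norm_nonneg x
          have h8 := abs_nonneg a
          constructor <;> linarith [h5.1, h5.2]
        have h1 := hM _ hmem
        have h2 := hM' _ hmem
        have h3 := hC₀ t ht x hx
        have h0 : 0 ≤ C₀ := (norm_nonneg _).trans h3
        have hM0 : 0 ≤ M := (norm_nonneg _).trans h1
        have hM0' : 0 ≤ M' := (norm_nonneg _).trans h2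
        rw [hF']
        simp only
        refine (norm_sub_le _ _).trans (add_le_add ?_ ?_)
        · rw [norm_mul, norm_mul, norm_pow, norm_norm, Real.norm_eq_abs c]
          gcongr
        · rw [norm_mul]
          gcongr
          refine norm_sum_le_of_le _ fun k _ => ?_
          rw [fderiv_re_inner (hA k) (hu t), norm_mul, Real.norm_ofNat]
          gcongr
          refine (Complex.abs_re_le_norm _).trans ((norm_inner_le_norm _ _).trans ?_)
          gcongr
          exact ((A k).le_opNorm _).trans (by gcongr; exact hC k t ht x hx)
      · rw [hzero t ht x (not_le.1 hx), norm_zero, Set.indicator_of_notMem]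
        rwa [mem_closedBall_zero_iff]
    have hs : Metric.ball t₀ 1 ∈ 𝓝 t₀ := Metric.ball_mem_nhds _ one_pos
    have hs' : ∀ t ∈ Metric.ball t₀ 1, |t| ≤ |t₀| + 1 := by
      intro t ht
      rw [Metric.mem_ball, Real.dist_eq] at ht
      have := abs_sub_abs_le_abs_sub t t₀
      linarith
    refine (hasDerivAt_integral_of_dominated_loc_of_deriv_le (F' := F')
      (bound := (Metric.closedBall (0 : Space3) r).indicator fun _ => b) hs ?_ ?_ ?_ ?_ ?_ ?_).2
    · refine Eventually.of_forall fun t => ?_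
      exact ((hθ t).continuous.mul ((hu t).continuous.norm.pow 2)).aestronglyMeasurable
    · exact ((hθ t₀).continuous.mul ((hu t₀).continuous.norm.pow 2)).integrable_of_hasCompactSupport
        (hθc t₀).mul_right
    · exact (hF'c t₀).aestronglyMeasurable
    · exact Eventually.of_forall fun x t ht => hbound t (hs' t ht) x
    · exact (integrable_indicator_iff Metric.isClosed_closedBall.measurableSet).2
        (integrableOn_const (isCompact_closedBall _ _).measure_lt_top.ne)
    · exact Eventually.of_forall fun x t _ => hderiv t x
  refine antitone_of_deriv_nonpos (fun t => (hmain t).differentiableAt) fun t => ?_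
  rw [(hmain t).deriv]
  have hθd : ∀ x k, fderiv ℝ (fun x => f (japaneseBracket x + c * t)) x (stdBasis k) =
      deriv f (japaneseBracket x + c * t) * fderiv ℝ japaneseBracket x (stdBasis k) := by
    intro x k
    have h1 : HasFDerivAt (fun y => japaneseBracket y + c * t) (fderiv ℝ japaneseBracket x) x :=
      ((contDiff_japaneseBracket.differentiable (by simp) x).hasFDerivAt).add_const _
    have h2 := (hdf (japaneseBracket x + c * t)).comp_hasFDerivAt x h1
    have h3 : HasFDerivAt (fun x => f (japaneseBracket x + c * t)) _ x := h2
    rw [h3.fderiv]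
    rfl
  have hI1 : Integrable fun x => c * deriv f (japaneseBracket x + c * t) * ‖u t x‖ ^ 2 := by
    have h1 : HasCompactSupport fun x => deriv f (japaneseBracket x + c * t) := by
      refine HasCompactSupport.intro (isCompact_closedBall (0 : Space3) (a - c * t)) fun x hx => ?_
      rw [mem_closedBall_zero_iff, not_le] at hx
      exact hsupp' _ (by linarith [norm_le_japaneseBracket x])
    have h2 : Continuous fun x => deriv f (japaneseBracket x + c * t) :=
      hf'.comp (hjc.add continuous_const)
    have h3 := (hu t).continuous
    exact Continuous.integrable_of_hasCompactSupport (by fun_prop) (h1.mul_left.mul_right)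
  have hI2 : ∀ k, Integrable fun x => f (japaneseBracket x + c * t) *
      fderiv ℝ (fun y => (⟪u t y, A k (u t y)⟫_ℂ).re) x (stdBasis k) := fun k =>
    ((hθ t).continuous.mul (hVc t k)).integrable_of_hasCompactSupport (hθc t).mul_right
  have hI3 : ∀ k, Integrable fun x =>
      fderiv ℝ (fun x => f (japaneseBracket x + c * t)) x (stdBasis k) *
        (⟪u t x, A k (u t x)⟫_ℂ).re := fun k => by
    have h1 := ((hθ t).continuous_fderiv (by norm_num)).clm_apply
      (continuous_const (y := stdBasis k))
    exact (h1.mul (hV t k).continuous).integrable_of_hasCompactSupport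
      ((hθc t).fderiv_apply ℝ _).mul_right
  -- Integration by parts moves the divergence onto the compactly supported weight.
  have hkey : ∫ x, F' t x = ∫ x, (c * deriv f (japaneseBracket x + c * t) * ‖u t x‖ ^ 2 +
      ∑ k, fderiv ℝ (fun x => f (japaneseBracket x + c * t)) x (stdBasis k) *
        (⟪u t x, A k (u t x)⟫_ℂ).re) := by
    rw [hF']
    simp only [Finset.mul_sum]
    rw [integral_sub hI1 (integrable_finsetSum _ fun k _ => hI2 k),
      integral_add hI1 (integrable_finsetSum _ fun k _ => hI3 k),
      integral_finsetSum _ fun k _ => hI2 k, integral_finsetSum _ fun k _ => hI3 k]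
    simp only [integral_weight_mul_fderiv (hθ t) (hθc t) (hV t _)]
    rw [Finset.sum_neg_distrib, sub_neg_eq_add]
  rw [hkey]
  -- With `d = f' ≤ 0`, the flux term is at most `(-d) ∑ ‖Aₖ‖ |u|² ≤ -c d |u|²`, so it is absorbed
  -- by `c d |u|²`, the term coming from the motion of the weight.
  refine integral_nonpos fun x => ?_
  have hd : deriv f (japaneseBracket x + c * t) ≤ 0 := hanti.deriv_nonpos
  set d := deriv f (japaneseBracket x + c * t) with hd'
  have hsum : ∑ k, fderiv ℝ (fun x => f (japaneseBracket x + c * t)) x (stdBasis k) *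
      (⟪u t x, A k (u t x)⟫_ℂ).re ≤ ∑ k, (-d) * (‖A k‖ * ‖u t x‖ ^ 2) := by
    refine Finset.sum_le_sum fun k _ => ?_
    rw [hθd]
    refine (le_abs_self _).trans ?_
    rw [abs_mul, abs_mul, abs_of_nonpos hd]
    have h1 : |(⟪u t x, A k (u t x)⟫_ℂ).re| ≤ ‖A k‖ * ‖u t x‖ ^ 2 := by
      refine (Complex.abs_re_le_norm _).trans ((norm_inner_le_norm _ _).trans ?_)
      calc _ ≤ ‖u t x‖ * (‖A k‖ * ‖u t x‖) := by gcongr; exact (A k).le_opNorm _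
        _ = _ := by ring
    have h2 := abs_fderiv_japaneseBracket_le x k
    have h3 : 0 ≤ -d := by linarith
    calc -d * |fderiv ℝ japaneseBracket x (stdBasis k)| * |(⟪u t x, A k (u t x)⟫_ℂ).re|
        ≤ -d * 1 * (‖A k‖ * ‖u t x‖ ^ 2) := by gcongr
      _ = _ := by ring
  rw [← Finset.mul_sum, ← Finset.sum_mul] at hsum
  have h4 : (-d) * ((∑ k, ‖A k‖) * ‖u t x‖ ^ 2) ≤ (-d) * (c * ‖u t x‖ ^ 2) := by
    have h3 : 0 ≤ -d := by linarith
    gcongr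
  change c * d * ‖u t x‖ ^ 2 + _ ≤ 0
  linarith

/-- Energy estimate in a forward cone for smooth solutions. -/
theorem lintegral_sq_le_of_smooth {A : Fin 3 → Spinor →L[ℂ] Spinor} {B : Spinor →L[ℂ] Spinor}
    (hA : ∀ k, IsSelfAdjoint (A k)) (hB : IsSelfAdjoint B) {c : ℝ} (hc : ∑ k, ‖A k‖ ≤ c)
    {u : ℝ → Space3 → Spinor} (hu : ∀ t, ContDiff ℝ 1 (u t))
    (heq : ∀ t x, HasDerivAt (fun s => u s x)
      (-(∑ k, A k (fderiv ℝ (u t) x (stdBasis k))) - Complex.I • B (u t x)) t)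
    (hbd : ∀ r T : ℝ, ∃ C : ℝ, ∀ t, |t| ≤ T → ∀ x, ‖x‖ ≤ r → ‖u t x‖ ≤ C)
    (hbd' : ∀ (k : Fin 3) (r T : ℝ), ∃ C : ℝ, ∀ t, |t| ≤ T → ∀ x, ‖x‖ ≤ r →
      ‖fderiv ℝ (u t) x (stdBasis k)‖ ≤ C) {t : ℝ} (ht : 0 ≤ t) (R : ℝ) :
    ∫⁻ x in Metric.ball (0 : Space3) R, ‖u t x‖ₑ ^ 2 ≤
      ∫⁻ x in Metric.ball (0 : Space3) (R + c * t + 2), ‖u 0 x‖ₑ ^ 2 := by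
  -- The weight is `1` up to `S` and `0` from `S + 1` on. Since `‖x‖ ≤ ⟨x⟩ ≤ 1 + ‖x‖`, it equals `1`
  -- on `‖x‖ < R` at time `t`, and at time `0` it lives in `‖x‖ < S + 1 = R + ct + 2`.
  set S := 1 + R + c * t with hS
  set f : ℝ → ℝ := fun s => Real.smoothTransition (S + 1 - s) with hf
  have hfs : ContDiff ℝ (⊤ : ℕ∞) f :=
    Real.smoothTransition.contDiff.comp (contDiff_const.sub contDiff_id)
  have hanti : Antitone f := fun s s' h => Real.smoothTransition.monotone (by linarith)
  have hsupp : ∀ s, S + 1 ≤ s → f s = 0 := fun s hs =>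
    Real.smoothTransition.zero_of_nonpos (by linarith)
  have h := antitone_weighted_energy hA hB hc hu heq hbd hbd' hfs hanti hsupp ht
  simp only [mul_zero, add_zero] at h
  have hjc := contDiff_japaneseBracket.continuous
  have hcs : ∀ b : ℝ, HasCompactSupport fun x => f (japaneseBracket x + b) := by
    intro b
    refine HasCompactSupport.intro (isCompact_closedBall (0 : Space3) (S + 1 - b)) fun x hx => ?_
    rw [mem_closedBall_zero_iff, not_le] at hx
    exact hsupp _ (by linarith [norm_le_japaneseBracket x])
  have hconv : ∀ (s b : ℝ), ENNReal.ofReal (∫ x, f (japaneseBracket x + b) * ‖u s x‖ ^ 2) =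
      ∫⁻ x, ENNReal.ofReal (f (japaneseBracket x + b)) * ‖u s x‖ₑ ^ 2 := by
    intro s b
    rw [ofReal_integral_eq_lintegral_ofReal]
    · congr 1
      ext1 x
      rw [ENNReal.ofReal_mul (Real.smoothTransition.nonneg _), ENNReal.ofReal_pow (norm_nonneg _),
        ofReal_norm]
    · have := (hu s).continuous
      have := hfs.continuous
      exact Continuous.integrable_of_hasCompactSupport (by fun_prop) (hcs b).mul_right
    · exact Eventually.of_forall fun x =>
        mul_nonneg (Real.smoothTransition.nonneg _) (by positivity)
  have h' := ENNReal.ofReal_le_ofReal h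
  have h0 := hconv 0 0
  simp only [add_zero] at h0
  rw [hconv, h0] at h'
  calc _ = ∫⁻ x in Metric.ball (0 : Space3) R,
        ENNReal.ofReal (f (japaneseBracket x + c * t)) * ‖u t x‖ₑ ^ 2 := by
          refine setLIntegral_congr_fun measurableSet_ball fun x hx => ?_
          rw [mem_ball_zero_iff] at hx
          have : f (japaneseBracket x + c * t) = 1 :=
            Real.smoothTransition.one_of_one_le (by linarith [japaneseBracket_le x])
          simp only [this, ENNReal.ofReal_one, one_mul]
    _ ≤ _ := setLIntegral_le_lintegral _ _
    _ ≤ _ := h'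
    _ ≤ ∫⁻ x, (Metric.ball (0 : Space3) (R + c * t + 2)).indicator (fun x => ‖u 0 x‖ₑ ^ 2) x := by
      refine lintegral_mono fun x => ?_
      by_cases hx : x ∈ Metric.ball (0 : Space3) (R + c * t + 2)
      · rw [Set.indicator_of_mem hx]
        refine mul_le_of_le_one_left' ?_
        rw [← ENNReal.ofReal_one]
        exact ENNReal.ofReal_le_ofReal (Real.smoothTransition.le_one _)
      · rw [Set.indicator_of_notMem hx]
        rw [mem_ball_zero_iff, not_lt] at hx
        rw [hsupp _ (by linarith [norm_le_japaneseBracket x]), ENNReal.ofReal_zero, zero_mul]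
    _ = _ := lintegral_indicator measurableSet_ball _

/-! ### Finite propagation speed and uniqueness for weak solutions. -/

namespace IsWeakSol

variable {A : Fin 3 → Spinor →L[ℂ] Spinor} {B : Spinor →L[ℂ] Spinor} {ψ χ : ℝ → L2Loc}

/-- The smooth estimate applies to mollifications and costs `2` in the radius; mollifiers of radius
at most `1` cost another `1`, whence the `3`. Fatou's lemma removes the mollification at time `t`.
-/
theorem locEnergy_le_of_nonneg (hA : ∀ k, IsSelfAdjoint (A k)) (hB : IsSelfAdjoint B) {c : ℝ}
    (hc : ∑ k, ‖A k‖ ≤ c) (h : IsWeakSol A B ψ) {t : ℝ} (ht : 0 ≤ t) (R : ℝ) :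
    (ψ t).locEnergy R ≤ (ψ 0).locEnergy (R + c * t + 3) := by
  -- The inner radius is half the outer one: almost everywhere convergence for merely locally
  -- integrable functions needs a bounded ratio of the two radii.
  let b : ℕ → ContDiffBump (0 : Space3) := fun n =>
    ⟨(1 / 2) * (1 / ((n : ℝ) + 1)), 1 / ((n : ℝ) + 1), by positivity, by
      have : (0 : ℝ) < 1 / ((n : ℝ) + 1) := by positivity
      linarith⟩
  let ρ : ℕ → Space3 → ℝ := fun n => (b n).normed volume
  have hρ : ∀ n, ContDiff ℝ (⊤ : ℕ∞) (ρ n) := fun n => (b n).contDiff_normed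
  have hρc : ∀ n, HasCompactSupport (ρ n) := fun n => (b n).hasCompactSupport_normed
  have hstep : ∀ n, ∫⁻ x in Metric.ball (0 : Space3) R, ‖mollify (ρ n) (ψ t) x‖ₑ ^ 2 ≤
      (ψ 0).locEnergy (R + c * t + 3) := by
    intro n
    refine (lintegral_sq_le_of_smooth hA hB hc (u := fun s => mollify (ρ n) (ψ s))
      (fun s => (contDiff_mollify (hρ n) (hρc n) _).of_le (by exact_mod_cast le_top))
      (fun s x => hasDerivAt_mollify h (hρ n) (hρc n) s x)
      (fun r T => norm_mollify_le_of_continuous (hρ n).continuous (hρc n) h.continuous r T)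
      (fun k r T => ?_) ht R).trans ?_
    · simp only [fderiv_mollify (hρ n) (hρc n)]
      exact norm_mollify_le_of_continuous (continuous_fderiv_apply (hρ n) _)
        (hasCompactSupport_fderiv_apply (hρc n) _) h.continuous r T
    · refine (lintegral_mollify_sq_le (hρ n).continuous (hρc n) (fun x => (b n).nonneg_normed x)
        ((b n).integral_normed) (δ := 1) (fun x hx => ?_) (ψ 0) _).trans
        (L2Loc.locEnergy_mono _ (by linarith))
      rw [← Function.notMem_support, (b n).support_normed_eq, mem_ball_zero_iff, not_lt]
      refine le_trans ?_ hx
      change 1 / ((n : ℝ) + 1) ≤ 1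
      rw [div_le_one (by positivity)]
      linarith [Nat.cast_nonneg (α := ℝ) n]
  have hlim : ∀ᵐ x, Tendsto (fun n => mollify (ρ n) (ψ t) x) atTop (𝓝 (ψ t x)) := by
    have h1 := ContDiffBump.ae_convolution_tendsto_right_of_locallyIntegrable (φ := b)
      (l := atTop) (K := 2) (μ := volume) tendsto_one_div_add_atTop_nhds_zero_nat
      (Eventually.of_forall fun n => by
        change 1 / ((n : ℝ) + 1) ≤ 2 * ((1 / 2) * (1 / ((n : ℝ) + 1)))
        linarith) (ψ t).locallyIntegrable
    filter_upwards [h1] with x hx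
    simp only [mollify_eq_convolution]
    exact hx
  calc (ψ t).locEnergy R = ∫⁻ x in Metric.ball (0 : Space3) R,
        liminf (fun n => ‖mollify (ρ n) (ψ t) x‖ₑ ^ 2) atTop := by
          refine lintegral_congr_ae ?_
          filter_upwards [ae_restrict_of_ae hlim] with x hx
          exact ((((ENNReal.continuous_pow 2).comp continuous_enorm).tendsto _).comp hx).liminf_eq.symm
    _ ≤ liminf (fun n => ∫⁻ x in Metric.ball (0 : Space3) R, ‖mollify (ρ n) (ψ t) x‖ₑ ^ 2) atTop :=
      lintegral_liminf_le fun n => by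
        have := (contDiff_mollify (hρ n) (hρc n) (ψ t)).continuous
        exact (this.enorm.measurable).pow_const 2
    _ ≤ _ := liminf_le_of_frequently_le' (Frequently.of_forall hstep)

/-- Finite propagation speed, with the energy bound. -/
theorem locEnergy_le (hA : ∀ k, IsSelfAdjoint (A k)) (hB : IsSelfAdjoint B) {c : ℝ}
    (hc : ∑ k, ‖A k‖ ≤ c) (h : IsWeakSol A B ψ) (t R : ℝ) :
    (ψ t).locEnergy R ≤ (ψ 0).locEnergy (R + c * |t| + 3) := by
  rcases le_total 0 t with ht | ht
  · rw [abs_of_nonneg ht]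
    exact h.locEnergy_le_of_nonneg hA hB hc ht R
  · rw [abs_of_nonpos ht]
    have hA' : ∀ k, IsSelfAdjoint ((-A) k) := fun k => by
      change ContinuousLinearMap.adjoint (-A k) = -A k
      rw [map_neg, (hA k).adjoint_eq]
    have hB' : IsSelfAdjoint (-B) := by
      change ContinuousLinearMap.adjoint (-B) = -B
      rw [map_neg, hB.adjoint_eq]
    have := h.reverse.locEnergy_le_of_nonneg (fun k => hA' k) hB' (by simpa using hc)
      (neg_nonneg.2 ht) R
    simpa using this

/-- The difference solves the system with zero initial energy in every ball. -/
theorem unique (hA : ∀ k, IsSelfAdjoint (A k)) (hB : IsSelfAdjoint B) (h : IsWeakSol A B ψ)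
    (h' : IsWeakSol A B χ) (h0 : ψ 0 = χ 0) : ψ = χ := by
  ext1 t
  refine L2Loc.eq_of_locEnergy fun R _ => ?_
  have := (h.sub h').locEnergy_le hA hB le_rfl t R
  refine le_antisymm (this.trans ?_) zero_le
  rw [Pi.sub_apply]
  exact (L2Loc.locEnergy_sub_eq_zero_iff.2 (by rw [h0]; simp)).le

end IsWeakSol

end DiracStat

end

noncomputable section

namespace DiracStat

open scoped InnerProductSpace FourierTransform

/-! ### Solutions with square integrable data -/

section FourierSolution

variable (A : Fin 3 → Spinor →L[ℂ] Spinor) (B : Spinor →L[ℂ] Spinor)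

/-- The symbol of the system in the frequency variable of Mathlib's Fourier transform. -/
def symbolOp (ξ : Space3) : Spinor →L[ℂ] Spinor :=
  ∑ k, ((2 * Real.pi * ξ k : ℝ) : ℂ) • A k + B

/-- The evolution operator at a fixed frequency. -/
def propagator (t : ℝ) (ξ : Space3) : Spinor →L[ℂ] Spinor :=
  NormedSpace.exp (t • (-(Complex.I • symbolOp A B ξ)))

theorem continuous_symbolOp : Continuous (symbolOp A B) := by
  unfold symbolOp
  fun_prop

theorem continuous_propagator (t : ℝ) : Continuous (propagator A B t) := by
  let _ : NormedAlgebra ℚ (Spinor →L[ℂ] Spinor) := NormedAlgebra.restrictScalars ℚ ℂ _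
  exact NormedSpace.exp_continuous.comp
    (((continuous_symbolOp A B).const_smul Complex.I).neg.const_smul t)

theorem propagator_zero (ξ : Space3) : propagator A B 0 ξ = 1 := by
  have h : (0 : ℝ) • (-(Complex.I • symbolOp A B ξ)) = 0 :=
    ContinuousLinearMap.ext fun v => zero_smul ℝ ((-(Complex.I • symbolOp A B ξ)) v)
  rw [propagator, h, NormedSpace.exp_zero]

theorem hasDerivAt_propagator_apply (t : ℝ) (ξ : Space3) (v : Spinor) :
    HasDerivAt (fun s => propagator A B s ξ v)
      (-(Complex.I • symbolOp A B ξ (propagator A B t ξ v))) t := by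
  have h := hasDerivAt_exp_smul_const' (𝕂 := ℝ) (-(Complex.I • symbolOp A B ξ)) t
  have h2 := (((ContinuousLinearMap.apply ℂ Spinor v).restrictScalars ℝ).hasFDerivAt).comp_hasDerivAt
    t h
  exact h2

variable {A B}

theorem isSelfAdjoint_symbolOp (hA : ∀ k, IsSelfAdjoint (A k)) (hB : IsSelfAdjoint B)
    (ξ : Space3) : IsSelfAdjoint (symbolOp A B ξ) := by
  change ContinuousLinearMap.adjoint (symbolOp A B ξ) = symbolOp A B ξ
  rw [symbolOp, map_add, map_sum, hB.adjoint_eq]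
  congr 1
  refine Finset.sum_congr rfl fun k _ => ?_
  rw [map_smulₛₗ, (hA k).adjoint_eq, Complex.conj_ofReal]

/-- The generator is `-i` times a self-adjoint operator, so the squared norm has zero derivative in
time. -/
theorem norm_propagator_apply (hA : ∀ k, IsSelfAdjoint (A k)) (hB : IsSelfAdjoint B) (t : ℝ)
    (ξ : Space3) (v : Spinor) : ‖propagator A B t ξ v‖ = ‖v‖ := by
  have h : ∀ s, HasDerivAt (fun s => ‖propagator A B s ξ v‖ ^ 2) 0 s := by
    intro s
    refine (hasDerivAt_norm_sq (hasDerivAt_propagator_apply A B s ξ v)).congr_deriv ?_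
    rw [inner_neg_right, Complex.neg_re,
      re_inner_I_smul_apply (isSelfAdjoint_symbolOp hA hB ξ), neg_zero, mul_zero]
  have h1 := is_const_of_deriv_eq_zero (fun s => (h s).differentiableAt) (fun s => (h s).deriv) t 0
  simp only [propagator_zero, one_apply_eq_self] at h1
  exact (pow_left_inj₀ (norm_nonneg _) (norm_nonneg _) two_ne_zero).1 h1

theorem memLp_propagator (hA : ∀ k, IsSelfAdjoint (A k)) (hB : IsSelfAdjoint B) (t : ℝ)
    (g : Lp Spinor 2 (volume : Measure Space3)) :
    MemLp (fun ξ => propagator A B t ξ (g ξ)) 2 volume := by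
  refine (Lp.memLp g).of_le ?_ (Eventually.of_forall fun ξ => (norm_propagator_apply hA hB _ _ _).le)
  exact (ContinuousLinearMap.apply ℂ Spinor).flip.aestronglyMeasurable_comp₂
    (continuous_propagator A B t).aestronglyMeasurable (Lp.aestronglyMeasurable g)

/-- The evolved function on the Fourier side. -/
def fourierEvolution (hA : ∀ k, IsSelfAdjoint (A k)) (hB : IsSelfAdjoint B)
    (g : Lp Spinor 2 (volume : Measure Space3)) (t : ℝ) : Lp Spinor 2 (volume : Measure Space3) :=
  (memLp_propagator hA hB t g).toLp _

theorem coeFn_fourierEvolution (hA : ∀ k, IsSelfAdjoint (A k)) (hB : IsSelfAdjoint B)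
    (g : Lp Spinor 2 (volume : Measure Space3)) (t : ℝ) :
    fourierEvolution hA hB g t =ᵐ[volume] fun ξ => propagator A B t ξ (g ξ) :=
  MemLp.coeFn_toLp _

theorem fourierEvolution_zero (hA : ∀ k, IsSelfAdjoint (A k)) (hB : IsSelfAdjoint B)
    (g : Lp Spinor 2 (volume : Measure Space3)) : fourierEvolution hA hB g 0 = g := by
  refine Lp.ext ?_
  filter_upwards [coeFn_fourierEvolution hA hB g 0] with ξ h
  rw [h, propagator_zero, one_apply_eq_self]

/-- Dominated convergence: the integrand tends to zero at each frequency, and isometry of the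
propagator bounds it by `4|g|²`. -/
theorem continuous_fourierEvolution (hA : ∀ k, IsSelfAdjoint (A k)) (hB : IsSelfAdjoint B)
    (g : Lp Spinor 2 (volume : Measure Space3)) : Continuous (fourierEvolution hA hB g) := by
  rw [continuous_iff_continuousAt]
  intro t₀
  rw [ContinuousAt, tendsto_iff_edist_tendsto_0]
  have h2 : Tendsto (fun t => edist (fourierEvolution hA hB g t) (fourierEvolution hA hB g t₀) ^ 2)
      (𝓝 t₀) (𝓝 0) := by
    have h3 : ∀ t, edist (fourierEvolution hA hB g t) (fourierEvolution hA hB g t₀) ^ 2 =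
        ∫⁻ ξ, ‖propagator A B t ξ (g ξ) - propagator A B t₀ ξ (g ξ)‖ₑ ^ 2 := by
      intro t
      rw [edist_eq_enorm_sub, L2Loc.enorm_Lp_two_sq]
      refine lintegral_congr_ae ?_
      filter_upwards [coeFn_fourierEvolution hA hB g t, coeFn_fourierEvolution hA hB g t₀,
        Lp.coeFn_sub (fourierEvolution hA hB g t) (fourierEvolution hA hB g t₀)] with ξ e1 e2 e3
      rw [e3, Pi.sub_apply, e1, e2]
    simp only [h3]
    have h4 : ∫⁻ ξ : Space3, (0 : ℝ≥0∞) = 0 := lintegral_zero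
    rw [← h4]
    refine tendsto_lintegral_filter_of_dominated_convergence'
      (fun ξ => 4 * ‖g ξ‖ₑ ^ 2) ?_ ?_ ?_ ?_
    · refine Eventually.of_forall fun t => ?_
      exact (((memLp_propagator hA hB t g).1.sub
        (memLp_propagator hA hB t₀ g).1).enorm.pow_const 2)
    · refine Eventually.of_forall fun t => Eventually.of_forall fun ξ => ?_
      have h5 : ‖propagator A B t ξ (g ξ) - propagator A B t₀ ξ (g ξ)‖ₑ ≤ 2 * ‖g ξ‖ₑ := by
        refine (enorm_sub_le).trans (le_of_eq ?_)
        have e : ∀ t, ‖propagator A B t ξ (g ξ)‖ₑ = ‖g ξ‖ₑ := fun t => by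
          rw [← ofReal_norm, norm_propagator_apply hA hB, ofReal_norm]
        rw [e, e, two_mul]
      calc _ ≤ (2 * ‖g ξ‖ₑ) ^ 2 := by gcongr
        _ = _ := by rw [mul_pow]; norm_num
    · rw [lintegral_const_mul' _ _ (by norm_num), ← L2Loc.enorm_Lp_two_sq]
      exact ENNReal.mul_ne_top (by norm_num) (ENNReal.pow_ne_top enorm_ne_top)
    · refine Eventually.of_forall fun ξ => ?_
      have h5 : Tendsto (fun t => propagator A B t ξ (g ξ) - propagator A B t₀ ξ (g ξ)) (𝓝 t₀)
          (𝓝 0) := by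
        rw [← sub_self (propagator A B t₀ ξ (g ξ))]
        exact (hasDerivAt_propagator_apply A B t₀ ξ (g ξ)).continuousAt.tendsto.sub_const _
      have h6 := (((ENNReal.continuous_pow 2).comp (continuous_enorm (E := Spinor))).tendsto 0).comp
        h5
      simpa [Function.comp_def] using h6
  have h7 := (ENNReal.continuous_rpow_const (y := 1 / 2)).tendsto 0 |>.comp h2
  rw [ENNReal.zero_rpow_of_pos (by norm_num)] at h7
  refine h7.congr fun t => ?_
  rw [Function.comp, ← ENNReal.rpow_natCast, ← ENNReal.rpow_mul]
  norm_num

theorem integrable_schwartz_smul (h : 𝓢(Space3, ℂ)) (g : Lp Spinor 2 (volume : Measure Space3)) :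
    Integrable (fun ξ => h ξ • g ξ) :=
  memLp_one_iff_integrable.1 ((Lp.memLp g).smul (h.memLp 2))

/-- The inverse transform turns `∂ₖΦ` into `-2πi ξₖ 𝓕⁻Φ`, which reproduces the symbol. The growth of
the symbol is thus carried by Schwartz functions, so the integral can be differentiated for any
square integrable `g`. -/
theorem hasDerivAt_integral_fourierEvolution (hA : ∀ k, IsSelfAdjoint (A k))
    (hB : IsSelfAdjoint B) (g : Lp Spinor 2 (volume : Measure Space3))
    (Φ : 𝓢(Space3, ℂ)) (t : ℝ) :
    HasDerivAt (fun s => ∫ ξ, 𝓕⁻ Φ ξ • fourierEvolution hA hB g s ξ)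
      (∑ k, A k (∫ ξ, 𝓕⁻ (∂_{stdBasis k} Φ) ξ • fourierEvolution hA hB g t ξ) -
        Complex.I • B (∫ ξ, 𝓕⁻ Φ ξ • fourierEvolution hA hB g t ξ)) t := by
  set F : ℝ → Space3 → Spinor := fun s ξ => 𝓕⁻ Φ ξ • propagator A B s ξ (g ξ) with hF
  set F' : ℝ → Space3 → Spinor := fun s ξ =>
    ∑ k, A k (𝓕⁻ (∂_{stdBasis k} Φ) ξ • propagator A B s ξ (g ξ)) -
      Complex.I • B (𝓕⁻ Φ ξ • propagator A B s ξ (g ξ)) with hF'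
  have e : ∀ (h : 𝓢(Space3, ℂ)) (s : ℝ), ∫ ξ, h ξ • fourierEvolution hA hB g s ξ =
      ∫ ξ, h ξ • propagator A B s ξ (g ξ) := by
    intro h s
    refine integral_congr_ae ?_
    filter_upwards [coeFn_fourierEvolution hA hB g s] with ξ hξ
    rw [hξ]
  have hi : ∀ (h : 𝓢(Space3, ℂ)) (s : ℝ),
      Integrable fun ξ => h ξ • propagator A B s ξ (g ξ) := by
    intro h s
    refine (integrable_schwartz_smul h (fourierEvolution hA hB g s)).congr ?_
    filter_upwards [coeFn_fourierEvolution hA hB g s] with ξ hξ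
    rw [hξ]
  have hsum : ∀ s, Integrable fun ξ =>
      ∑ k, A k (𝓕⁻ (∂_{stdBasis k} Φ) ξ • propagator A B s ξ (g ξ)) := fun s =>
    integrable_finsetSum _ fun k _ => (A k).integrable_comp (hi _ s)
  have hIB : ∀ s, Integrable fun ξ => Complex.I • B (𝓕⁻ Φ ξ • propagator A B s ξ (g ξ)) :=
    fun s => (B.integrable_comp (hi _ s)).smul Complex.I
  have hderiv : ∀ ξ s, HasDerivAt (fun s => F s ξ) (F' s ξ) s := by
    intro ξ s
    refine ((hasDerivAt_propagator_apply A B s ξ (g ξ)).const_smul (𝓕⁻ Φ ξ)).congr_deriv ?_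
    have hk : ∀ k, 𝓕⁻ (∂_{stdBasis k} Φ) ξ = -(2 * Real.pi * Complex.I) * ((ξ k : ℝ) : ℂ) * 𝓕⁻ Φ ξ := by
      intro k
      rw [SchwartzMap.fourierInv_lineDerivOp_eq]
      rw [smul_apply, SchwartzMap.smulLeftCLM_apply_apply (by fun_prop)]
      rw [EuclideanSpace.inner_single_right]
      simp
      ring
    rw [hF']
    simp only [hk, map_smul]
    generalize propagator A B s ξ (g ξ) = w
    rw [symbolOp, add_apply, sum_apply]
    simp only [smul_apply, smul_add, neg_add, Finset.smul_sum,
      ← Finset.sum_neg_distrib, smul_smul, sub_eq_add_neg, ← neg_smul]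
    congr 1
    · refine Finset.sum_congr rfl fun k _ => ?_
      congr 1
      push_cast
      ring
    · congr 1
      ring
  set bound : Space3 → ℝ := fun ξ => ∑ k, ‖A k‖ * ‖𝓕⁻ (∂_{stdBasis k} Φ) ξ • g ξ‖ +
    ‖B‖ * ‖𝓕⁻ Φ ξ • g ξ‖ with hbound
  have hb : Integrable bound :=
    (integrable_finsetSum _ fun k _ => (integrable_schwartz_smul _ g).norm.const_mul _).add
      ((integrable_schwartz_smul _ g).norm.const_mul _)
  have hle : ∀ ξ s, ‖F' s ξ‖ ≤ bound ξ := by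
    intro ξ s
    have h1 : ∀ z : ℂ, ‖z • propagator A B s ξ (g ξ)‖ = ‖z • g ξ‖ := fun z => by
      rw [norm_smul, norm_smul, norm_propagator_apply hA hB]
    refine (norm_sub_le _ _).trans (add_le_add (norm_sum_le_of_le _ fun k _ => ?_) ?_)
    · rw [← h1]
      exact (A k).le_opNorm _
    · rw [norm_smul, Complex.norm_I, one_mul, ← h1]
      exact B.le_opNorm _
  have hmain := (hasDerivAt_integral_of_dominated_loc_of_deriv_le (F := F) (F' := F') (x₀ := t)
    (bound := bound) (μ := volume) univ_mem (Eventually.of_forall fun s => (hi _ s).1) (hi _ t)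
    ((hsum t).sub (hIB t)).1 (Eventually.of_forall fun ξ s _ => hle ξ s) hb
    (Eventually.of_forall fun ξ s _ => hderiv ξ s)).2
  simp only [e]
  refine hmain.congr_deriv ?_
  rw [hF']
  simp only
  rw [integral_sub (hsum t) (hIB t), integral_finsetSum _ fun k _ => (A k).integrable_comp (hi _ t),
    integral_smul, B.integral_comp_comm (hi _ t)]
  congr 1
  exact Finset.sum_congr rfl fun k _ => (A k).integral_comp_comm (hi _ t)

/-- The system has a solution for square integrable data. -/
theorem exists_isWeakSol_of_Lp (hA : ∀ k, IsSelfAdjoint (A k)) (hB : IsSelfAdjoint B)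
    (f : Lp Spinor 2 (volume : Measure Space3)) :
    ∃ ψ : ℝ → L2Loc, IsWeakSol A B ψ ∧ ψ 0 = L2Loc.ofLp f := by
  let S : ℝ → Lp Spinor 2 (volume : Measure Space3) := fun t => 𝓕⁻ (fourierEvolution hA hB (𝓕 f) t)
  have hS : Continuous S :=
    (Lp.fourierTransformₗᵢ Space3 Spinor).symm.continuous.comp
      (continuous_fourierEvolution hA hB (𝓕 f))
  refine ⟨fun t => L2Loc.ofLp (S t), ⟨L2Loc.continuous_ofLp.comp hS, fun φ hφ hc t => ?_⟩, ?_⟩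
  · have hφ' : ContDiff ℝ (⊤ : ℕ∞) fun x => (φ x : ℂ) := Complex.ofRealCLM.contDiff.comp hφ
    have hc' : HasCompactSupport fun x => (φ x : ℂ) := hc.comp_left (g := Complex.ofReal) rfl
    let Φ : 𝓢(Space3, ℂ) := hc'.toSchwartzMap hφ'
    -- The inverse Fourier transform passes from the solution to the test function through duality
    -- of tempered distributions.
    have key : ∀ (Θ : 𝓢(Space3, ℂ)) (s : ℝ), ∫ x, Θ x • S s x =
        ∫ ξ, 𝓕⁻ Θ ξ • fourierEvolution hA hB (𝓕 f) s ξ := by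
      intro Θ s
      rw [← Lp.toTemperedDistribution_apply, ← Lp.toTemperedDistribution_apply,
        ← TemperedDistribution.fourierInv_apply, Lp.fourierInv_toTemperedDistribution_eq]
    have h1 : ∀ s, ∫ x, φ x • L2Loc.ofLp (S s) x =
        ∫ ξ, 𝓕⁻ Φ ξ • fourierEvolution hA hB (𝓕 f) s ξ := by
      intro s
      rw [← key]
      refine integral_congr_ae (Eventually.of_forall fun x => ?_)
      exact (Complex.coe_smul (φ x) _).symm
    have h2 : ∀ k, ∫ x, fderiv ℝ φ x (stdBasis k) • L2Loc.ofLp (S t) x =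
        ∫ ξ, 𝓕⁻ (∂_{stdBasis k} Φ) ξ • fourierEvolution hA hB (𝓕 f) t ξ := by
      intro k
      rw [← key]
      refine integral_congr_ae (Eventually.of_forall fun x => ?_)
      have h3 : (∂_{stdBasis k} Φ) x = ((fderiv ℝ φ x (stdBasis k) : ℝ) : ℂ) := by
        rw [SchwartzMap.lineDerivOp_apply_eq_fderiv]
        have h4 : HasFDerivAt (fun x => (φ x : ℂ)) (Complex.ofRealCLM.comp (fderiv ℝ φ x)) x :=
          Complex.ofRealCLM.hasFDerivAt.comp x (hφ.differentiable (by simp) x).hasFDerivAt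
        have h5 : HasFDerivAt Φ (Complex.ofRealCLM.comp (fderiv ℝ φ x)) x := h4
        rw [h5.fderiv]
        rfl
      simp only [h3]
      exact (Complex.coe_smul _ _).symm
    simp only [h1, h2]
    exact hasDerivAt_integral_fourierEvolution hA hB (𝓕 f) Φ t
  · simp only [S, fourierEvolution_zero, FourierTransform.fourierInv_fourier_eq]

end FourierSolution

end DiracStat

end

noncomputable section

namespace DiracStat

/-! ### Solutions with locally square integrable data -/

theorem L2Loc.restrictBall_congr {R : Set.Ioi (0 : ℝ)} {ψ φ : L2Loc}
    (h : ∀ᵐ x, x ∈ Metric.ball (0 : Space3) (R : ℝ) → ψ x = φ x) :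
    L2Loc.restrictBall R ψ = L2Loc.restrictBall R φ := by
  refine Lp.ext ?_
  rw [← ae_restrict_iff' measurableSet_ball] at h
  filter_upwards [L2Loc.coeFn_restrictBall R ψ, L2Loc.coeFn_restrictBall R φ, h] with x h1 h2 h3
  rw [h1, h2, h3]

theorem L2Loc.integral_smul_congr {R : ℝ} {ψ χ : L2Loc} {φ : Space3 → ℝ}
    (hφ : ∀ x, x ∉ Metric.ball (0 : Space3) R → φ x = 0)
    (h : ∀ᵐ x, x ∈ Metric.ball (0 : Space3) R → ψ x = χ x) :
    ∫ x, φ x • ψ x = ∫ x, φ x • χ x := by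
  refine integral_congr_ae ?_
  filter_upwards [h] with x hx
  by_cases hR : x ∈ Metric.ball (0 : Space3) R
  · rw [hx hR]
  · rw [hφ x hR, zero_smul, zero_smul]

variable {A : Fin 3 → Spinor →L[ℂ] Spinor} {B : Spinor →L[ℂ] Spinor}

/-- A family which near every bounded space-time region coincides with a solution is a solution. -/
theorem IsWeakSol.of_local {ψ : ℝ → L2Loc} {ψs : ℕ → ℝ → L2Loc} {c : ℝ} (hc : 0 ≤ c)
    (hs : ∀ n, IsWeakSol A B (ψs n))
    (h : ∀ t (n : ℕ), ∀ᵐ x, ‖x‖ + c * |t| + 4 ≤ n → ψ t x = ψs n t x) : IsWeakSol A B ψ := by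
  have hloc : ∀ R t₀ : ℝ, ∃ n : ℕ, ∀ t ∈ Metric.ball t₀ 1,
      ∀ᵐ x, x ∈ Metric.ball (0 : Space3) R → ψ t x = ψs n t x := by
    intro R t₀
    -- One index must work for all times near `t₀`, since continuity and the time derivative at `t₀`
    -- involve a neighbourhood.
    obtain ⟨n, hn⟩ := exists_nat_ge (R + c * (|t₀| + 1) + 4)
    refine ⟨n, fun t ht => ?_⟩
    rw [Metric.mem_ball, Real.dist_eq] at ht
    filter_upwards [h t n] with x hx hxR
    rw [mem_ball_zero_iff] at hxR
    refine hx ?_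
    have h1 : |t| ≤ |t₀| + 1 := by linarith [abs_sub_abs_le_abs_sub t t₀]
    have : c * |t| ≤ c * (|t₀| + 1) := by gcongr
    linarith
  refine ⟨L2Loc.continuous_of_restrictBall fun R t₀ => ?_, fun φ hφ hcs t₀ => ?_⟩
  · obtain ⟨n, hn⟩ := hloc R t₀
    have h1 := ((L2Loc.continuous_restrictBall R).comp (hs n).continuous).tendsto t₀
    rw [tendsto_iff_norm_sub_tendsto_zero] at h1
    refine h1.congr' ?_
    filter_upwards [Metric.ball_mem_nhds t₀ one_pos] with t ht
    rw [map_sub, L2Loc.restrictBall_congr (hn t ht),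
      L2Loc.restrictBall_congr (hn t₀ (Metric.mem_ball_self one_pos))]
    rfl
  · obtain ⟨R, hR⟩ := hcs.isCompact.isBounded.subset_ball (0 : Space3)
    obtain ⟨n, hn⟩ := hloc R t₀
    have h0 : ∀ x, x ∉ Metric.ball (0 : Space3) R → φ x = 0 := fun x hx =>
      image_eq_zero_of_notMem_tsupport fun h' => hx (hR h')
    have h1 : ∀ k, ∀ x, x ∉ Metric.ball (0 : Space3) R → fderiv ℝ φ x (stdBasis k) = 0 := by
      intro k x hx
      rw [fderiv_of_notMem_tsupport ℝ fun h' => hx (hR h')]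
      rfl
    have ht₀ := hn t₀ (Metric.mem_ball_self one_pos)
    simp only [L2Loc.integral_smul_congr (h1 _) ht₀, L2Loc.integral_smul_congr h0 ht₀]
    refine ((hs n).equation φ hφ hcs t₀).congr_of_eventuallyEq ?_
    filter_upwards [Metric.ball_mem_nhds t₀ one_pos] with t ht
    exact L2Loc.integral_smul_congr h0 (hn t ht)

/-- Data cut off to the ball of radius `n + 1` are square integrable and have solutions. By finite
propagation speed these agree with each other on regions that exhaust space-time, so they can be
glued. -/
theorem exists_isWeakSol (hA : ∀ k, IsSelfAdjoint (A k)) (hB : IsSelfAdjoint B) (ψ₀ : L2Loc) :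
    ∃ ψ : ℝ → L2Loc, IsWeakSol A B ψ ∧ ψ 0 = ψ₀ := by
  set c := ∑ k, ‖A k‖ with hc
  have hc0 : 0 ≤ c := Finset.sum_nonneg fun _ _ => norm_nonneg _
  let r : ℕ → Set.Ioi (0 : ℝ) := fun n => ⟨(n : ℝ) + 1, Set.mem_Ioi.2 (by positivity)⟩
  choose ψs hs hs0 using fun n : ℕ =>
    exists_isWeakSol_of_Lp hA hB (L2Loc.zeroExtend (r n) (L2Loc.restrictBall (r n) ψ₀))
  have hdata : ∀ n : ℕ, ∀ᵐ x, x ∈ Metric.ball (0 : Space3) ((n : ℝ) + 1) → ψs n 0 x = ψ₀ x := by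
    intro n
    rw [hs0]
    exact L2Loc.zeroExtend_restrictBall_ae (r n) ψ₀
  -- The radius is chosen so that the enlargement by `c|t| + 3` gives exactly `j + 1`, where both
  -- data equal `ψ₀`.
  have hcons : ∀ (t : ℝ) (j n : ℕ), j ≤ n →
      ∀ᵐ x, x ∈ Metric.ball (0 : Space3) ((j : ℝ) - 2 - c * |t|) → ψs j t x = ψs n t x := by
    intro t j n hjn
    have hjn' : (j : ℝ) ≤ n := by exact_mod_cast hjn
    rw [← L2Loc.locEnergy_sub_eq_zero_iff]
    refine le_antisymm ((((hs j).sub (hs n)).locEnergy_le hA hB le_rfl t _).trans ?_) zero_le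
    rw [← hc, show (j : ℝ) - 2 - c * |t| + c * |t| + 3 = (j : ℝ) + 1 by ring, Pi.sub_apply]
    refine (L2Loc.locEnergy_sub_eq_zero_iff.2 ?_).le
    filter_upwards [hdata j, hdata n] with x h1 h2 hx
    rw [h1 hx, h2 (Metric.ball_subset_ball (by linarith) hx)]
  -- The `3` puts `x` strictly inside the agreement ball of radius `N - 2 - c|t|`; the ceiling adds
  -- less than `1`, so `N ≤ n` once `‖x‖ + c|t| + 4 ≤ n`.
  let N : ℝ → Space3 → ℕ := fun t x => ⌈‖x‖ + c * |t|⌉₊ + 3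
  let G : ℝ → Space3 → Spinor := fun t x => ψs (N t x) t x
  have hG : ∀ (t : ℝ) (n : ℕ), ∀ᵐ x, ‖x‖ + c * |t| + 4 ≤ n → G t x = ψs n t x := by
    intro t n
    -- The index `N t x` depends on `x`, so a single null set has to serve for all `j`.
    have h1 : ∀ᵐ x, ∀ j : ℕ, j ≤ n → x ∈ Metric.ball (0 : Space3) ((j : ℝ) - 2 - c * |t|) →
        ψs j t x = ψs n t x := by
      rw [ae_all_iff]
      intro j
      by_cases hj : j ≤ n
      · filter_upwards [hcons t j n hj] with x hx _ using hx
      · exact Eventually.of_forall fun x h => absurd h hj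
    filter_upwards [h1] with x hx hxn
    refine hx (N t x) ?_ ?_
    · have h2 : ⌈‖x‖ + c * |t|⌉₊ < ‖x‖ + c * |t| + 1 := Nat.ceil_lt_add_one (by positivity)
      have h3 : ((N t x : ℕ) : ℝ) ≤ n := by
        simp only [N]
        push_cast
        linarith
      exact_mod_cast h3
    · rw [mem_ball_zero_iff]
      have h2 := Nat.le_ceil (‖x‖ + c * |t|)
      simp only [N]
      push_cast
      linarith
  have hmem : ∀ t (R : ℝ), 0 < R → MemLp (G t) 2 (volume.restrict (Metric.ball (0 : Space3) R)) := by
    intro t R hR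
    obtain ⟨n, hn⟩ := exists_nat_ge (R + c * |t| + 4)
    refine (memLp_congr_ae ?_).1 ((ψs n t).memLp_ball hR)
    filter_upwards [ae_restrict_of_ae (hG t n), ae_restrict_mem measurableSet_ball] with x h1 h2
    rw [mem_ball_zero_iff] at h2
    exact (h1 (by linarith)).symm
  have hψ : ∀ t (n : ℕ), ∀ᵐ x, ‖x‖ + c * |t| + 4 ≤ n → L2Loc.ofFun (G t) (hmem t) x = ψs n t x := by
    intro t n
    filter_upwards [hG t n, L2Loc.coeFn_ofFun (hmem t)] with x h1 h2 h3
    rw [h2, h1 h3]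
  refine ⟨fun t => L2Loc.ofFun (G t) (hmem t), IsWeakSol.of_local hc0 hs hψ, ?_⟩
  refine L2Loc.ext ?_
  filter_upwards [ae_all_iff.2 fun n => hψ 0 n, ae_all_iff.2 hdata] with x h1 h2
  obtain ⟨n, hn⟩ := exists_nat_ge (‖x‖ + 4)
  rw [h1 n (by rw [abs_zero]; linarith), h2 n (by rw [mem_ball_zero_iff]; linarith)]

/-! ### The Dirac flow -/

theorem existsUnique_isDiracSolution (m : ℝ) (ψ₀ : L2Loc) :
    ∃! ψ : ℝ → L2Loc, IsDiracSolution m ψ₀ ψ := by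
  obtain ⟨ψ, h, h0⟩ := exists_isWeakSol isSelfAdjoint_alphaOp (isSelfAdjoint_massOp m) ψ₀
  refine ⟨ψ, (isDiracSolution_iff m ψ₀ ψ).2 ⟨h, h0⟩, fun χ hχ => ?_⟩
  obtain ⟨h', h0'⟩ := (isDiracSolution_iff m ψ₀ χ).1 hχ
  exact h'.unique isSelfAdjoint_alphaOp (isSelfAdjoint_massOp m) h (h0'.trans h0.symm)

theorem isDiracSolution_diracFlow (m : ℝ) (ψ₀ : L2Loc) :
    IsDiracSolution m ψ₀ fun t => diracFlow m t ψ₀ := by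
  have h := (existsUnique_isDiracSolution m ψ₀).exists
  have h' : (fun t => diracFlow m t ψ₀) = h.choose := by
    ext1 t
    rw [diracFlow, dif_pos h]
  rw [h']
  exact h.choose_spec

theorem eq_diracFlow {m : ℝ} {ψ₀ : L2Loc} {ψ : ℝ → L2Loc} (h : IsDiracSolution m ψ₀ ψ) (t : ℝ) :
    diracFlow m t ψ₀ = ψ t :=
  congrFun ((existsUnique_isDiracSolution m ψ₀).unique (isDiracSolution_diracFlow m ψ₀) h) t

theorem isWeakSol_diracFlow (m : ℝ) (ψ₀ : L2Loc) :
    IsWeakSol alphaOp (massOp m) fun t => diracFlow m t ψ₀ :=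
  ((isDiracSolution_iff m ψ₀ _).1 (isDiracSolution_diracFlow m ψ₀)).1

theorem diracFlow_zero_time (m : ℝ) (ψ₀ : L2Loc) : diracFlow m 0 ψ₀ = ψ₀ :=
  ((isDiracSolution_iff m ψ₀ _).1 (isDiracSolution_diracFlow m ψ₀)).2

theorem eq_diracFlow_of_isWeakSol {m : ℝ} {ψ : ℝ → L2Loc} (h : IsWeakSol alphaOp (massOp m) ψ)
    (t : ℝ) : diracFlow m t (ψ 0) = ψ t :=
  eq_diracFlow ((isDiracSolution_iff m _ ψ).2 ⟨h, rfl⟩) t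

/-- The dynamics as a linear map. -/
def diracFlowLinear (m t : ℝ) : L2Loc →ₗ[ℂ] L2Loc where
  toFun := diracFlow m t
  map_add' ψ φ := by
    have h := eq_diracFlow_of_isWeakSol ((isWeakSol_diracFlow m ψ).add (isWeakSol_diracFlow m φ)) t
    simpa only [Pi.add_apply, diracFlow_zero_time] using h
  map_smul' c ψ := by
    have h := eq_diracFlow_of_isWeakSol ((isWeakSol_diracFlow m ψ).smul c) t
    simpa only [Pi.smul_apply, diracFlow_zero_time, RingHom.id_apply] using h

theorem diracFlow_translate (m t : ℝ) (a : Space3) (ψ : L2Loc) :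
    diracFlow m t (ψ.translate a) = (diracFlow m t ψ).translate a := by
  have h := eq_diracFlow_of_isWeakSol ((isWeakSol_diracFlow m ψ).translate a) t
  simpa only [diracFlow_zero_time] using h

/-- A bound for the propagation speed. -/
def diracSpeed : ℝ := ∑ k, ‖alphaOp k‖

theorem diracSpeed_nonneg : 0 ≤ diracSpeed := Finset.sum_nonneg fun _ _ => norm_nonneg _

theorem locEnergy_diracFlow_le (m t R : ℝ) (ψ : L2Loc) :
    (diracFlow m t ψ).locEnergy R ≤ ψ.locEnergy (R + diracSpeed * |t| + 3) := by
  have h := (isWeakSol_diracFlow m ψ).locEnergy_le isSelfAdjoint_alphaOp (isSelfAdjoint_massOp m)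
    (c := diracSpeed) le_rfl t R
  simpa only [diracFlow_zero_time] using h

/-- Serves both for continuity of the flow and for regarding the solution in a ball as a bounded
linear function of the data in a larger ball. -/
theorem norm_restrictBall_diracFlow_le (m t : ℝ) (R : Set.Ioi (0 : ℝ)) :
    ∃ S : Set.Ioi (0 : ℝ), ∀ ψ, ‖L2Loc.restrictBall R (diracFlow m t ψ)‖ ≤
      ‖L2Loc.restrictBall S ψ‖ := by
  have hR : (0 : ℝ) < R := R.2
  have := mul_nonneg diracSpeed_nonneg (abs_nonneg t)
  refine ⟨⟨R + diracSpeed * |t| + 3, Set.mem_Ioi.2 (by linarith)⟩, fun ψ => ?_⟩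
  rw [← one_mul ‖L2Loc.restrictBall _ ψ‖]
  refine L2Loc.norm_restrictBall_le zero_le_one ?_
  rw [ENNReal.ofReal_one, one_pow, one_mul]
  exact locEnergy_diracFlow_le m t R ψ

theorem continuous_diracFlow (m t : ℝ) : Continuous (diracFlow m t) := by
  refine L2Loc.continuous_of_restrictBall fun R ψ => ?_
  obtain ⟨S, hS⟩ := norm_restrictBall_diracFlow_le m t R
  have h := (L2Loc.continuous_restrictBall S).tendsto ψ
  rw [tendsto_iff_norm_sub_tendsto_zero] at h
  refine squeeze_zero (fun _ => norm_nonneg _) (fun φ => ?_) h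
  rw [← map_sub]
  refine le_trans (le_of_eq ?_) (hS (φ - ψ))
  congr 2
  exact (map_sub (diracFlowLinear m t) φ ψ).symm

end DiracStat

end

noncomputable section

namespace DiracStat

open scoped InnerProductSpace ComplexConjugate

/-! ### Second moments of random fields -/

section SecondMoments

/-- The coefficients of `w ↦ ⟪v, w⟫` with respect to the real components of `w`. -/
def innerCoeff (v : Spinor) : Fin (4 + 4) → ℂ :=
  Fin.append (fun k => conj (v k)) (fun k => Complex.I * conj (v k))

theorem inner_eq_sum_innerCoeff (v w : Spinor) :
    ⟪v, w⟫_ℂ = ∑ i, innerCoeff v i * (realComp w i : ℂ) := by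
  rw [Fin.sum_univ_add, PiLp.inner_apply, ← Finset.sum_add_distrib]
  refine Finset.sum_congr rfl fun k _ => ?_
  simp only [innerCoeff, realComp, Fin.append_left, Fin.append_right, RCLike.inner_apply]
  conv_lhs => rw [← Complex.re_add_im (w k)]
  ring

theorem measurable_realComp (i : Fin (4 + 4)) : Measurable fun v : Spinor => realComp v i := by
  refine Fin.addCases (fun k => ?_) (fun k => ?_) i
  · simp only [realComp, Fin.append_left]
    exact (Complex.continuous_re.comp (by fun_prop : Continuous fun v : Spinor => v k)).measurable
  · simp only [realComp, Fin.append_right]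
    exact (Complex.continuous_im.comp (by fun_prop : Continuous fun v : Spinor => v k)).measurable

theorem abs_realComp_le (v : Spinor) (i : Fin (4 + 4)) : |realComp v i| ≤ ‖v‖ := by
  refine Fin.addCases (fun k => ?_) (fun k => ?_) i
  · simp only [realComp, Fin.append_left]
    exact (Complex.abs_re_le_norm _).trans (PiLp.norm_apply_le v k)
  · simp only [realComp, Fin.append_right]
    exact (Complex.abs_im_le_norm _).trans (PiLp.norm_apply_le v k)

variable {Ω : Type*} [MeasurableSpace Ω] {μ : Measure Ω} [SFinite μ] {ν : Measure Space3}
  [IsFiniteMeasure ν] {X Y : Ω → Space3 → Spinor} {e : ℝ≥0}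

/-- This justifies Fubini. The crude bound `ab ≤ a² + b²` gives `E|X(x)||X(y)| ≤ 2e`, and `g` is
integrable because `ν` is finite. -/
theorem integrable_pairing_mul_conj
    (hX : AEMeasurable (fun p : Ω × Space3 => X p.1 p.2) (μ.prod ν))
    (he : ∀ᵐ x ∂ν, ∫⁻ ω, ‖X ω x‖ₑ ^ 2 ∂μ = e) (g : Lp Spinor 2 ν) :
    Integrable (fun q : Ω × (Space3 × Space3) =>
      ⟪g q.2.1, X q.1 q.2.1⟫_ℂ * conj ⟪g q.2.2, X q.1 q.2.2⟫_ℂ) (μ.prod (ν.prod ν)) := by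
  have q1 : Measure.QuasiMeasurePreserving (Prod.map id Prod.fst)
      (μ.prod (ν.prod ν)) (μ.prod ν) :=
    QuasiMeasurePreserving.prodMap (Measure.QuasiMeasurePreserving.id μ) Measure.quasiMeasurePreserving_fst
  have q2 : Measure.QuasiMeasurePreserving (Prod.map id Prod.snd)
      (μ.prod (ν.prod ν)) (μ.prod ν) :=
    QuasiMeasurePreserving.prodMap (Measure.QuasiMeasurePreserving.id μ) Measure.quasiMeasurePreserving_snd
  have hg : AEStronglyMeasurable (fun p : Ω × Space3 => g p.2) (μ.prod ν) :=
    (Lp.aestronglyMeasurable g).comp_snd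
  have hm : AEStronglyMeasurable (fun p : Ω × Space3 => ⟪g p.2, X p.1 p.2⟫_ℂ) (μ.prod ν) :=
    hg.inner hX.aestronglyMeasurable
  have hm1 := hm.comp_quasiMeasurePreserving q1
  have hm2 := hm.comp_quasiMeasurePreserving q2
  have hK : AEStronglyMeasurable (fun q : Ω × (Space3 × Space3) =>
      ⟪g q.2.1, X q.1 q.2.1⟫_ℂ * conj ⟪g q.2.2, X q.1 q.2.2⟫_ℂ) (μ.prod (ν.prod ν)) :=
    hm1.mul (Complex.continuous_conj.comp_aestronglyMeasurable hm2)
  refine ⟨hK, ?_⟩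
  rw [HasFiniteIntegral, lintegral_prod_symm _ hK.enorm]
  have hgi : ∫⁻ x, ‖g x‖ₑ ∂ν < ∞ := ((Lp.memLp g).integrable (by norm_num)).2
  have h1 : ∀ᵐ p ∂(ν.prod ν), ∫⁻ ω, ‖⟪g p.1, X ω p.1⟫_ℂ * conj ⟪g p.2, X ω p.2⟫_ℂ‖ₑ ∂μ ≤
      ‖g p.1‖ₑ * ‖g p.2‖ₑ * (e + e) := by
    have hX1 : ∀ᵐ x ∂ν, AEStronglyMeasurable (fun ω => X ω x) μ :=
      hX.aestronglyMeasurable.prodMk_right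
    filter_upwards [Measure.quasiMeasurePreserving_fst.ae he,
      Measure.quasiMeasurePreserving_snd.ae he, Measure.quasiMeasurePreserving_fst.ae hX1]
      with p h1 h2 h3
    have hee : (e + e : ℝ≥0∞) = (∫⁻ ω, ‖X ω p.1‖ₑ ^ 2 ∂μ) + ∫⁻ ω, ‖X ω p.2‖ₑ ^ 2 ∂μ := by
      rw [h1, h2]
    rw [hee, ← lintegral_add_left' (h3.enorm.pow_const 2)]
    rw [← lintegral_const_mul' _ _ (ENNReal.mul_ne_top enorm_ne_top enorm_ne_top)]
    refine lintegral_mono fun ω => ?_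
    rw [enorm_mul, RCLike.enorm_conj]
    have hin : ∀ v w : Spinor, ‖⟪v, w⟫_ℂ‖ₑ ≤ ‖v‖ₑ * ‖w‖ₑ := fun v w => by
      rw [enorm_eq_nnnorm, enorm_eq_nnnorm, enorm_eq_nnnorm, ← ENNReal.coe_mul,
        ENNReal.coe_le_coe]
      exact nnnorm_inner_le_nnnorm v w
    have hab : ∀ a b : ℝ≥0∞, a * b ≤ a ^ 2 + b ^ 2 := fun a b => by
      rcases le_total a b with h | h
      · exact (mul_le_mul_left h b).trans (by rw [sq b]; exact le_add_self)
      · exact (mul_le_mul_right h a).trans (by rw [sq a]; exact le_self_add)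
    calc ‖⟪g p.1, X ω p.1⟫_ℂ‖ₑ * ‖⟪g p.2, X ω p.2⟫_ℂ‖ₑ
        ≤ (‖g p.1‖ₑ * ‖X ω p.1‖ₑ) * (‖g p.2‖ₑ * ‖X ω p.2‖ₑ) := mul_le_mul' (hin _ _) (hin _ _)
      _ = ‖g p.1‖ₑ * ‖g p.2‖ₑ * (‖X ω p.1‖ₑ * ‖X ω p.2‖ₑ) := by ring
      _ ≤ _ := by gcongr; exact hab _ _
  refine (lintegral_mono_ae h1).trans_lt ?_
  rw [lintegral_mul_const' _ _ (by simp), lintegral_prod_mul (Lp.aestronglyMeasurable g).enorm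
    (Lp.aestronglyMeasurable g).enorm]
  exact ENNReal.mul_lt_top (ENNReal.mul_lt_top hgi hgi) (by simp)

/-- The variance of a linear functional of a random field in terms of the covariance. -/
theorem lintegral_pairing_sq
    (hX : AEMeasurable (fun p : Ω × Space3 => X p.1 p.2) (μ.prod ν))
    (he : ∀ᵐ x ∂ν, ∫⁻ ω, ‖X ω x‖ₑ ^ 2 ∂μ = e) (g : Lp Spinor 2 ν) :
    ∫⁻ ω, ‖∫ x, ⟪g x, X ω x⟫_ℂ ∂ν‖ₑ ^ 2 ∂μ =
      ENNReal.ofReal (∫ p, ∑ i, ∑ j, innerCoeff (g p.1) i * conj (innerCoeff (g p.2) j) *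
        ((∫ ω, realComp (X ω p.1) i * realComp (X ω p.2) j ∂μ : ℝ) : ℂ) ∂(ν.prod ν)).re := by
  have hK := integrable_pairing_mul_conj hX he g
  -- The squared modulus of an integral is a double integral, in which the expectation can be taken
  -- first.
  have hZ : ∀ ω, ∫ p : Space3 × Space3, ⟪g p.1, X ω p.1⟫_ℂ * conj ⟪g p.2, X ω p.2⟫_ℂ ∂(ν.prod ν) =
      ((‖∫ x, ⟪g x, X ω x⟫_ℂ ∂ν‖ ^ 2 : ℝ) : ℂ) := fun ω => by
    rw [integral_prod_mul (fun x => ⟪g x, X ω x⟫_ℂ) (fun x => conj ⟪g x, X ω x⟫_ℂ), integral_conj,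
      RCLike.mul_conj]
    norm_cast
  have hint : Integrable (fun ω => ((‖∫ x, ⟪g x, X ω x⟫_ℂ ∂ν‖ ^ 2 : ℝ) : ℂ)) μ := by
    simpa only [hZ] using hK.integral_prod_left
  have hre : Integrable (fun ω => ‖∫ x, ⟪g x, X ω x⟫_ℂ ∂ν‖ ^ 2) μ := hint.re
  have h1 : ∫⁻ ω, ‖∫ x, ⟪g x, X ω x⟫_ℂ ∂ν‖ₑ ^ 2 ∂μ =
      ENNReal.ofReal (∫ ω, ‖∫ x, ⟪g x, X ω x⟫_ℂ ∂ν‖ ^ 2 ∂μ) := by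
    rw [ofReal_integral_eq_lintegral_ofReal hre
      (Eventually.of_forall fun _ => by positivity)]
    refine lintegral_congr fun ω => ?_
    rw [ENNReal.ofReal_pow (norm_nonneg _), ofReal_norm]
  rw [h1]
  congr 1
  have h2 : ((∫ ω, ‖∫ x, ⟪g x, X ω x⟫_ℂ ∂ν‖ ^ 2 ∂μ : ℝ) : ℂ) =
      ∫ p, ∫ ω, ⟪g p.1, X ω p.1⟫_ℂ * conj ⟪g p.2, X ω p.2⟫_ℂ ∂μ ∂(ν.prod ν) := by
    rw [← integral_complex_ofReal, ← integral_integral_swap (μ := μ) (ν := ν.prod ν)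
      (f := fun ω p => ⟪g p.1, X ω p.1⟫_ℂ * conj ⟪g p.2, X ω p.2⟫_ℂ) hK]
    exact integral_congr_ae (Eventually.of_forall fun ω => (hZ ω).symm)
  rw [← Complex.ofReal_re (∫ ω, ‖∫ x, ⟪g x, X ω x⟫_ℂ ∂ν‖ ^ 2 ∂μ), h2]
  congr 1
  have hX1 : ∀ᵐ x ∂ν, AEStronglyMeasurable (fun ω => X ω x) μ :=
    hX.aestronglyMeasurable.prodMk_right
  have hL2 : ∀ᵐ x ∂ν, MemLp (fun ω => X ω x) 2 μ := by
    filter_upwards [hX1, he] with x h1 h2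
    refine ⟨h1, ?_⟩
    rw [eLpNorm_lt_top_iff_lintegral_rpow_enorm_lt_top (by norm_num) (by norm_num)]
    simp [h2]
  have hL2' : ∀ᵐ x ∂ν, ∀ i, MemLp (fun ω => realComp (X ω x) i) 2 μ := by
    filter_upwards [hL2] with x hx i
    exact hx.mono ((measurable_realComp i).comp_aemeasurable
      hx.1.aemeasurable).aestronglyMeasurable (Eventually.of_forall fun ω => abs_realComp_le _ i)
  refine integral_congr_ae ?_
  filter_upwards [Measure.quasiMeasurePreserving_fst.ae hL2',
    Measure.quasiMeasurePreserving_snd.ae hL2'] with p h1 h2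
  have hij : ∀ i j, Integrable (fun ω => realComp (X ω p.1) i * realComp (X ω p.2) j) μ :=
    fun i j => (h1 i).integrable_mul (h2 j)
  have hexp : ∀ ω, ⟪g p.1, X ω p.1⟫_ℂ * conj ⟪g p.2, X ω p.2⟫_ℂ =
      ∑ i, ∑ j, innerCoeff (g p.1) i * conj (innerCoeff (g p.2) j) *
        ((realComp (X ω p.1) i * realComp (X ω p.2) j : ℝ) : ℂ) := fun ω => by
    rw [inner_eq_sum_innerCoeff, inner_eq_sum_innerCoeff, map_sum, Finset.sum_mul_sum]
    refine Finset.sum_congr rfl fun i _ => Finset.sum_congr rfl fun j _ => ?_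
    rw [map_mul, Complex.conj_ofReal, Complex.ofReal_mul]
    ring
  simp only [hexp]
  rw [integral_finsetSum _ fun i _ => integrable_finsetSum _ fun j _ => (hij i j).ofReal.const_mul _]
  refine Finset.sum_congr rfl fun i _ => ?_
  rw [integral_finsetSum _ fun j _ => (hij i j).ofReal.const_mul _]
  refine Finset.sum_congr rfl fun j _ => ?_
  rw [integral_const_mul, integral_complex_ofReal]

/-- Fields with the same covariance have the same second moments. -/
theorem lintegral_pairing_sq_congr
    (hX : AEMeasurable (fun p : Ω × Space3 => X p.1 p.2) (μ.prod ν))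
    (heX : ∀ᵐ x ∂ν, ∫⁻ ω, ‖X ω x‖ₑ ^ 2 ∂μ = e)
    (hY : AEMeasurable (fun p : Ω × Space3 => Y p.1 p.2) (μ.prod ν))
    (heY : ∀ᵐ x ∂ν, ∫⁻ ω, ‖Y ω x‖ₑ ^ 2 ∂μ = e)
    (hXY : ∀ i j, ∀ᵐ p ∂(ν.prod ν), ∫ ω, realComp (X ω p.1) i * realComp (X ω p.2) j ∂μ =
      ∫ ω, realComp (Y ω p.1) i * realComp (Y ω p.2) j ∂μ) (g : Lp Spinor 2 ν) :
    ∫⁻ ω, ‖∫ x, ⟪g x, X ω x⟫_ℂ ∂ν‖ₑ ^ 2 ∂μ = ∫⁻ ω, ‖∫ x, ⟪g x, Y ω x⟫_ℂ ∂ν‖ₑ ^ 2 ∂μ := by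
  rw [lintegral_pairing_sq hX heX g, lintegral_pairing_sq hY heY g]
  congr 2
  refine integral_congr_ae ?_
  filter_upwards [ae_all_iff.2 fun i => ae_all_iff.2 fun j => hXY i j] with p hp
  simp only [hp]

end SecondMoments

end DiracStat

end

noncomputable section

namespace DiracStat

open scoped InnerProductSpace ComplexConjugate

/-! ### Translation invariance of the second moments of the initial field -/

variable {μ₀ : Measure L2Loc} [IsProbabilityMeasure μ₀] {Ψ : L2Loc → Space3 → Spinor}

/-- The shifted field `Ψ ω (x + a)` has the same charge and the same covariance, because `(x + a) -
(y + a) = x - y`. Second moments of linear functionals depend only on the covariance. -/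
theorem lintegral_inner_restrictBall_translate (hΨ : IsRandomField μ₀ Ψ)
    (hS : InitialConditions μ₀ Ψ) (a : Space3) (S : Set.Ioi (0 : ℝ))
    (g : Lp Spinor 2 (volume.restrict (Metric.ball (0 : Space3) (S : ℝ)))) :
    ∫⁻ ω, ‖⟪g, L2Loc.restrictBall S (ω.translate a)⟫_ℂ‖ₑ ^ 2 ∂μ₀ =
      ∫⁻ ω, ‖⟪g, L2Loc.restrictBall S ω⟫_ℂ‖ₑ ^ 2 ∂μ₀ := by
  revert g
  set ν : Measure Space3 := volume.restrict (Metric.ball (0 : Space3) (S : ℝ)) with hν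
  intro g
  have : IsFiniteMeasure ν := isFiniteMeasure_restrict.2 measure_ball_lt_top.ne
  obtain ⟨e, he⟩ := hS.charge
  obtain ⟨q₀, hq⟩ := hS.correlation
  have hac : ν ≪ volume := Measure.restrict_le_self.absolutelyContinuous
  have hs : MeasurePreserving (fun x : Space3 => x + a) volume volume :=
    measurePreserving_add_right volume a
  have hss : MeasurePreserving (Prod.map (fun x : Space3 => x + a) (fun x : Space3 => x + a))
      (volume : Measure (Space3 × Space3)) volume := hs.prod hs
  have hacc : ν.prod ν ≪ (volume : Measure (Space3 × Space3)) := hac.prod hac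
  have hY : AEMeasurable (fun p : L2Loc × Space3 => Ψ p.1 (p.2 + a)) (μ₀.prod volume) :=
    hΨ.1.comp_quasiMeasurePreserving
      (QuasiMeasurePreserving.prodMap (Measure.QuasiMeasurePreserving.id μ₀)
        hs.quasiMeasurePreserving)
  have hmain := lintegral_pairing_sq_congr (μ := μ₀) (ν := ν) (X := fun ω x => Ψ ω (x + a))
    (Y := Ψ) (e := e)
    (hY.mono_ac (Measure.AbsolutelyContinuous.rfl.prod hac))
    (hac.ae_le (hs.quasiMeasurePreserving.ae he))
    (hΨ.1.mono_ac (Measure.AbsolutelyContinuous.rfl.prod hac)) (hac.ae_le he)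
    (fun i j => hacc.ae_le <| by
      filter_upwards [hq i j, hss.quasiMeasurePreserving.ae (hq i j)] with p h1 h2
      rw [h1]
      refine h2.trans ?_
      simp [Prod.map]) g
  have hinner : ∀ ψ : L2Loc, ⟪g, L2Loc.restrictBall S ψ⟫_ℂ = ∫ x, ⟪g x, ψ x⟫_ℂ ∂ν := fun ψ => by
    rw [L2.inner_def]
    refine integral_congr_ae ?_
    filter_upwards [L2Loc.coeFn_restrictBall S ψ] with x hx
    rw [hx]
  refine (lintegral_congr_ae ?_).trans (hmain.trans (lintegral_congr_ae ?_))
  · filter_upwards [hΨ.2] with ω hω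
    rw [hinner]
    congr 2
    refine integral_congr_ae (hac.ae_le ?_)
    filter_upwards [ω.coeFn_translate a, hs.quasiMeasurePreserving.ae hω] with x h1 h2
    rw [h1, h2]
  · filter_upwards [hΨ.2] with ω hω
    rw [hinner]
    congr 2
    refine integral_congr_ae (hac.ae_le ?_)
    filter_upwards [hω] with x h2
    rw [h2]

/-- Orthonormal vectors are at distance `√2`, so balls of radius `1/2` about them are disjoint.
Countability permits exchanging the expansion in a Hilbert basis with the expectation. -/
theorem Orthonormal.countable_range {E : Type*} [NormedAddCommGroup E] [InnerProductSpace ℂ E]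
    [SeparableSpace E] {w : Set E} (hw : Orthonormal ℂ ((↑) : w → E)) : w.Countable := by
  refine Set.PairwiseDisjoint.countable_of_isOpen (s := fun x => Metric.ball x (1 / 2)) ?_
    (fun _ _ => Metric.isOpen_ball) fun x _ => ⟨x, Metric.mem_ball_self (by norm_num)⟩
  intro x hx y hy hxy
  refine Metric.ball_disjoint_ball ?_
  have h0 : ⟪x, y⟫_ℂ = 0 := hw.2 (i := ⟨x, hx⟩) (j := ⟨y, hy⟩) fun h => hxy (congrArg Subtype.val h)
  have h1 : ‖x‖ = 1 := hw.1 ⟨x, hx⟩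
  have h2 : ‖y‖ = 1 := hw.1 ⟨y, hy⟩
  have h3 : ‖x - y‖ ^ 2 = 2 := by
    rw [@norm_sub_sq ℂ, h0, h1, h2]; norm_num
  rw [dist_eq_norm]
  nlinarith [norm_nonneg (x - y)]

theorem enorm_sq_eq_tsum {E : Type*} [NormedAddCommGroup E] [InnerProductSpace ℂ E]
    {ι : Type*} (b : HilbertBasis ι ℂ E) (x : E) :
    ‖x‖ₑ ^ 2 = ∑' i, ‖⟪b i, x⟫_ℂ‖ₑ ^ 2 := by
  have h := b.hasSum_inner_mul_inner x x
  have h' : HasSum (fun i => ‖⟪b i, x⟫_ℂ‖ ^ 2) (‖x‖ ^ 2) := by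
    have h2 := (Complex.hasSum_re h)
    rw [inner_self_eq_norm_sq_to_K] at h2
    convert h2 using 1
    · funext i
      rw [← inner_conj_symm x (b i), RCLike.conj_mul]
      norm_cast
    · norm_cast
  rw [← ofReal_norm, ← ENNReal.ofReal_pow (norm_nonneg _), ← h'.tsum_eq,
    ENNReal.ofReal_tsum_of_nonneg (fun _ => by positivity) h'.summable]
  refine tsum_congr fun i => ?_
  rw [ENNReal.ofReal_pow (norm_nonneg _), ofReal_norm]

/-- Parseval reduces the claim to the coefficients `⟪b i, L f⟫ = ⟪L* (b i), f⟫`, which are scalar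
functionals of the field. -/
theorem lintegral_enorm_sq_translate (hΨ : IsRandomField μ₀ Ψ)
    (hS : InitialConditions μ₀ Ψ) (a : Space3) (S : Set.Ioi (0 : ℝ)) {E : Type*}
    [NormedAddCommGroup E] [InnerProductSpace ℂ E] [CompleteSpace E] [SeparableSpace E]
    (L : Lp Spinor 2 (volume.restrict (Metric.ball (0 : Space3) (S : ℝ))) →L[ℂ] E) :
    ∫⁻ ω, ‖L (L2Loc.restrictBall S (ω.translate a))‖ₑ ^ 2 ∂μ₀ =
      ∫⁻ ω, ‖L (L2Loc.restrictBall S ω)‖ₑ ^ 2 ∂μ₀ := by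
  obtain ⟨w, b, hb⟩ := exists_hilbertBasis ℂ E
  have hw : Countable w := (Orthonormal.countable_range (hb ▸ b.orthonormal)).to_subtype
  have hc := L2Loc.continuous_restrictBall S
  simp only [enorm_sq_eq_tsum b]
  rw [lintegral_tsum, lintegral_tsum]
  · refine tsum_congr fun i => ?_
    simp only [← ContinuousLinearMap.adjoint_inner_left]
    exact lintegral_inner_restrictBall_translate hΨ hS a S _
  · exact fun i => ((continuous_const.inner (L.continuous.comp hc)).enorm.measurable.pow_const
      2).aemeasurable
  · exact fun i => ((continuous_const.inner (L.continuous.comp (hc.comp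
      (L2Loc.continuous_translate a)))).enorm.measurable.pow_const 2).aemeasurable

/-- The mean local energy of the solution at any time is translation invariant. -/
theorem lintegral_locEnergy_translate (hΨ : IsRandomField μ₀ Ψ)
    (hS : InitialConditions μ₀ Ψ) (m t : ℝ) (a : Space3) (R : Set.Ioi (0 : ℝ)) :
    ∫⁻ ω, ((diracFlow m t ω).translate a).locEnergy R ∂μ₀ =
      ∫⁻ ω, (diracFlow m t ω).locEnergy R ∂μ₀ := by
  obtain ⟨S, hS'⟩ := norm_restrictBall_diracFlow_le m t R
  -- Extend the data by zero outside the ball of radius `S`, evolve, restrict to radius `R`: a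
  -- contraction between Hilbert spaces by the energy estimate.
  let L₀ : Lp Spinor 2 (volume.restrict (Metric.ball (0 : Space3) (S : ℝ))) →ₗ[ℂ]
      Lp Spinor 2 (volume.restrict (Metric.ball (0 : Space3) (R : ℝ))) :=
    L2Loc.restrictBall R ∘ₗ diracFlowLinear m t ∘ₗ L2Loc.ofLp ∘ₗ L2Loc.zeroExtend S
  let L := L₀.mkContinuous 1 fun f => by
    rw [one_mul]
    refine (hS' _).trans_eq ?_
    rw [LinearMap.comp_apply, L2Loc.restrictBall_zeroExtend]
  -- Replacing `ψ` by its extension by zero changes it only outside the domain of dependence.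
  have hL : ∀ ψ : L2Loc, L (L2Loc.restrictBall S ψ) = L2Loc.restrictBall R (diracFlow m t ψ) := by
    intro ψ
    have h := hS' (L2Loc.ofLp (L2Loc.zeroExtend S (L2Loc.restrictBall S ψ)) - ψ)
    rw [map_sub, L2Loc.restrictBall_zeroExtend, sub_self, norm_zero] at h
    have h2 := norm_eq_zero.1 (h.antisymm (norm_nonneg _))
    have h3 : L2Loc.restrictBall R (diracFlowLinear m t
      (L2Loc.ofLp (L2Loc.zeroExtend S (L2Loc.restrictBall S ψ)) - ψ)) = 0 := h2
    rw [map_sub, map_sub, sub_eq_zero] at h3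
    exact h3
  have : Fact ((2 : ℝ≥0∞) ≠ ∞) := ⟨by norm_num⟩
  have := lintegral_enorm_sq_translate hΨ hS a S L
  simp only [hL, L2Loc.enorm_restrictBall_sq, diracFlow_translate] at this
  exact this

end DiracStat

end

noncomputable section

namespace DiracStat

/-! ### The mean energy of the solution is bounded uniformly in time -/

variable {μ₀ : Measure L2Loc} [IsProbabilityMeasure μ₀] {Ψ : L2Loc → Space3 → Spinor}

theorem measurable_locEnergy_comp {F : L2Loc → L2Loc} (hF : Continuous F) {R : ℝ} (hR : 0 < R) :
    Measurable fun ω => (F ω).locEnergy R := by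
  simp only [← L2Loc.enorm_restrictBall_sq ⟨R, Set.mem_Ioi.2 hR⟩]
  exact (((L2Loc.continuous_restrictBall _).comp hF).enorm.measurable.pow_const 2)

theorem lintegral_locEnergy (hΨ : IsRandomField μ₀ Ψ) {e : ℝ≥0}
    (he : ∀ᵐ x : Space3, ∫⁻ ω, ‖Ψ ω x‖ₑ ^ 2 ∂μ₀ = e) (R : ℝ) :
    ∫⁻ ω, ω.locEnergy R ∂μ₀ = e * volume (Metric.ball (0 : Space3) R) := by
  have h1 : ∫⁻ ω, ω.locEnergy R ∂μ₀ =
      ∫⁻ ω, (∫⁻ x in Metric.ball (0 : Space3) R, ‖Ψ ω x‖ₑ ^ 2) ∂μ₀ := by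
    refine lintegral_congr_ae ?_
    filter_upwards [hΨ.2] with ω hω
    refine lintegral_congr_ae (ae_restrict_of_ae ?_)
    filter_upwards [hω] with x hx
    rw [hx]
  have hm : AEMeasurable (fun p : L2Loc × Space3 => ‖Ψ p.1 p.2‖ₑ ^ 2)
      (μ₀.prod (volume.restrict (Metric.ball (0 : Space3) R))) :=
    (hΨ.1.mono_ac (Measure.AbsolutelyContinuous.rfl.prod
      Measure.restrict_le_self.absolutelyContinuous)).enorm.pow_const 2
  rw [h1, ← lintegral_prod _ hm, lintegral_prod_symm _ hm,
    lintegral_congr_ae (ae_restrict_of_ae he), lintegral_const, Measure.restrict_apply_univ]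

/-- The points `2R(k₁, k₂, k₃)` of a cubic lattice. -/
def latticePoint (R : ℝ) {K : ℕ} (k : Fin 3 → Fin K) : Space3 :=
  WithLp.toLp 2 fun i => 2 * R * (k i : ℝ)

theorem disjoint_ball_latticePoint {R : ℝ} (hR : 0 < R) {K : ℕ} {k l : Fin 3 → Fin K}
    (h : k ≠ l) : Disjoint (Metric.ball (latticePoint R k) R) (Metric.ball (latticePoint R l) R) := by
  refine Metric.ball_disjoint_ball ?_
  obtain ⟨i, hi⟩ := Function.ne_iff.1 h
  rw [dist_eq_norm]
  refine le_trans ?_ (PiLp.norm_apply_le (latticePoint R k - latticePoint R l) i)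
  have h1 : (1 : ℝ) ≤ |(k i : ℝ) - l i| := by
    have h2 : ((k i : ℕ) : ℤ) - (l i : ℕ) ≠ 0 := by
      have := Fin.val_ne_of_ne hi
      omega
    have h3 := Int.one_le_abs h2
    have h4 : ((1 : ℤ) : ℝ) ≤ (|((k i : ℕ) : ℤ) - (l i : ℕ)| : ℤ) := by exact_mod_cast h3
    simpa using h4
  have h5 : (latticePoint R k - latticePoint R l) i = 2 * R * ((k i : ℝ) - l i) := by
    simp only [latticePoint, PiLp.sub_apply]
    ring
  rw [h5, Real.norm_eq_abs, abs_mul, abs_of_pos (by positivity)]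
  nlinarith

theorem ball_latticePoint_subset {R : ℝ} (hR : 0 < R) {K : ℕ} (k : Fin 3 → Fin K) :
    Metric.ball (latticePoint R k) R ⊆ Metric.ball (0 : Space3) (5 * R * K) := by
  have hk : ∀ i, ((k i : ℕ) : ℝ) + 1 ≤ K := fun i => by exact_mod_cast (k i).2
  have hK : (1 : ℝ) ≤ K := by have := hk 0; have : (0 : ℝ) ≤ (k 0 : ℕ) := Nat.cast_nonneg _; linarith
  -- Each coordinate is at most `2RK`, so the norm is at most `2√3 RK ≤ 4RK`; the radius `R ≤ RK` of
  -- the ball then leads to `5RK`.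
  have hn : ‖latticePoint R k‖ ≤ 4 * R * K := by
    refine abs_le_of_sq_le_sq' ?_ (by positivity) |>.2
    rw [EuclideanSpace.norm_sq_eq]
    have h1 : ∀ i, ‖latticePoint R k i‖ ^ 2 ≤ 4 * R ^ 2 * K ^ 2 := fun i => by
      have h2 : latticePoint R k i = 2 * R * (k i : ℝ) := rfl
      have h3 : ((k i : ℕ) : ℝ) ^ 2 ≤ (K : ℝ) ^ 2 := by
        gcongr
        exact (k i).2.le
      rw [h2, Real.norm_eq_abs, sq_abs]
      nlinarith [sq_nonneg R]
    calc ∑ i, ‖latticePoint R k i‖ ^ 2 ≤ ∑ _i : Fin 3, 4 * R ^ 2 * (K : ℝ) ^ 2 :=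
          Finset.sum_le_sum fun i _ => h1 i
      _ ≤ (4 * R * K) ^ 2 := by
          rw [Finset.sum_const, Finset.card_univ, Fintype.card_fin]
          have : 0 ≤ R ^ 2 * (K : ℝ) ^ 2 := by positivity
          simp only [nsmul_eq_mul]
          push_cast
          nlinarith
  refine Metric.ball_subset_ball' ?_
  rw [dist_zero_right]
  nlinarith

theorem sum_locEnergy_translate_le (ψ : L2Loc) {R : ℝ} (hR : 0 < R) (K : ℕ) :
    ∑ k : Fin 3 → Fin K, (ψ.translate (latticePoint R k)).locEnergy R ≤
      ψ.locEnergy (5 * R * K) := by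
  simp only [L2Loc.locEnergy_translate]
  rw [← tsum_fintype (L := .unconditional _), ← lintegral_iUnion (fun k => measurableSet_ball)
    (fun k l h => disjoint_ball_latticePoint hR h)]
  exact lintegral_mono_set (Set.iUnion_subset fun k => ball_latticePoint_subset hR k)

/-- The mean energy in a ball is bounded uniformly in time. -/
theorem exists_lintegral_locEnergy_diracFlow_le (hΨ : IsRandomField μ₀ Ψ)
    (hS : InitialConditions μ₀ Ψ) (m : ℝ) {R : ℝ} (hR : 0 < R) :
    ∃ C : ℝ≥0, ∀ t, ∫⁻ ω, (diracFlow m t ω).locEnergy R ∂μ₀ ≤ C := by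
  obtain ⟨e, he⟩ := hS.charge
  have hV : volume (Metric.ball (0 : Space3) 1) ≠ ∞ := measure_ball_lt_top.ne
  have hD : (e : ℝ≥0∞) * (ENNReal.ofReal ((6 * R) ^ 3) * volume (Metric.ball (0 : Space3) 1)) ≠ ∞ :=
    ENNReal.mul_ne_top ENNReal.coe_ne_top (ENNReal.mul_ne_top ENNReal.ofReal_ne_top hV)
  refine ⟨(ENNReal.toNNReal _), fun t => (?_ : _ ≤ _).trans_eq (ENNReal.coe_toNNReal hD).symm⟩
  -- `K` grows with `|t|` so that the enlargement `c|t| + 3` of the domain of dependence is at most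
  -- `RK`. The packed ball of radius `5RK` then depends only on data in radius `6RK`, a volume still
  -- proportional to `K³`.
  obtain ⟨K, hK⟩ := exists_nat_ge ((diracSpeed * |t| + 3) / R)
  rw [div_le_iff₀ hR] at hK
  have hc : 0 ≤ diracSpeed * |t| := mul_nonneg diracSpeed_nonneg (abs_nonneg t)
  have hKpos : (0 : ℝ) < K := by
    by_contra h
    nlinarith
  set N := ∫⁻ ω, (diracFlow m t ω).locEnergy R ∂μ₀ with hN
  have h1 : ((K : ℝ≥0∞)) ^ 3 * N = ∫⁻ ω, ∑ k : Fin 3 → Fin K,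
      ((diracFlow m t ω).translate (latticePoint R k)).locEnergy R ∂μ₀ := by
    have hm : ∀ k ∈ Finset.univ, Measurable fun ω =>
        ((diracFlow m t ω).translate (latticePoint (K := K) R k)).locEnergy R := fun k _ =>
      measurable_locEnergy_comp ((L2Loc.continuous_translate _).comp (continuous_diracFlow m t)) hR
    rw [lintegral_finsetSum _ hm]
    have h2 : ∀ k : Fin 3 → Fin K,
        ∫⁻ ω, ((diracFlow m t ω).translate (latticePoint R k)).locEnergy R ∂μ₀ = N :=
      fun k => lintegral_locEnergy_translate hΨ hS m t _ ⟨R, Set.mem_Ioi.2 hR⟩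
    rw [Finset.sum_congr rfl fun k _ => h2 k]
    simp
  have h3 : ((K : ℝ≥0∞)) ^ 3 * N ≤ (K : ℝ≥0∞) ^ 3 * ((e : ℝ≥0∞) *
      (ENNReal.ofReal ((6 * R) ^ 3) * volume (Metric.ball (0 : Space3) 1))) := by
    rw [h1]
    calc _ ≤ ∫⁻ ω, ω.locEnergy (6 * R * K) ∂μ₀ := lintegral_mono fun ω =>
          (sum_locEnergy_translate_le _ hR K).trans ((locEnergy_diracFlow_le m t _ ω).trans
            (L2Loc.locEnergy_mono ω (by linarith)))
      _ = e * (ENNReal.ofReal ((6 * R * K) ^ 3) * volume (Metric.ball (0 : Space3) 1)) := by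
          rw [lintegral_locEnergy hΨ he, Measure.addHaar_ball_of_pos _ _ (by positivity)]
          simp
      _ = _ := by
          rw [mul_pow (6 * R), ENNReal.ofReal_mul (by positivity), ENNReal.ofReal_pow (p := (K : ℝ))
            (by positivity), ENNReal.ofReal_natCast]
          ring
  -- Cancelling `K³` leaves a bound without `t`.
  refine (ENNReal.mul_le_mul_iff_right ?_ ?_).1 h3
  · exact pow_ne_zero _ (by exact_mod_cast hKpos.ne')
  · exact ENNReal.pow_ne_top (ENNReal.natCast_ne_top K)

end DiracStat

end

noncomputable section

namespace DiracStat

open scoped FourierTransform RealInnerProductSpace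

/-! ### The local Sobolev seminorms of square integrable functions -/

/-- On `L¹ ∩ L²` the `L²`-Fourier transform is given by the Fourier integral. -/
theorem fourier_toLp_ae_eq {F : Space3 → Spinor} (h1 : Integrable F) (h2 : MemLp F 2 volume) :
    (𝓕 (h2.toLp F) : Lp Spinor 2 (volume : Measure Space3)) =ᵐ[volume] 𝓕 F := by
  have hcont : Continuous (𝓕 F) := VectorFourier.fourierIntegral_continuous
    Real.continuous_fourierChar (by exact continuous_inner) h1
  refine ae_eq_of_integral_contDiff_smul_eq
    ((Lp.memLp _).locallyIntegrable (by norm_num)) hcont.locallyIntegrable fun g hg hgc => ?_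
  have hgC : ContDiff ℝ (⊤ : ℕ∞) fun x => (g x : ℂ) := Complex.ofRealCLM.contDiff.comp hg
  have hgCc : HasCompactSupport fun x => (g x : ℂ) := hgc.comp_left Complex.ofReal_zero
  let G : 𝓢(Space3, ℂ) := hgCc.toSchwartzMap hgC
  have hG : ∀ x, G x = (g x : ℂ) := fun x => rfl
  have e1 : ∫ x, g x • (𝓕 (h2.toLp F) : Lp Spinor 2 (volume : Measure Space3)) x =
      ∫ x, 𝓕 G x • (h2.toLp F) x := by
    have h := congrArg (fun T : 𝓢'(Space3, Spinor) => T G)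
      (Lp.fourier_toTemperedDistribution_eq (h2.toLp F))
    simp only [TemperedDistribution.fourier_apply, Lp.toTemperedDistribution_apply] at h
    rw [h]
    simp only [hG, Complex.coe_smul]
  have e2 : ∫ x, g x • 𝓕 F x = ∫ x, 𝓕 (G : Space3 → ℂ) x • F x := by
    have h := VectorFourier.integral_fourierIntegral_smul_eq_flip (L := innerₗ Space3)
      (μ := volume) (ν := volume) Real.continuous_fourierChar continuous_inner G.integrable h1
    refine Eq.trans ?_ h.symm
    refine integral_congr_ae (Eventually.of_forall fun x => ?_)
    simp only [flip_innerₗ, hG, Complex.coe_smul]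
    rfl
  rw [e1, e2]
  refine integral_congr_ae ?_
  filter_upwards [h2.coeFn_toLp] with x hx
  rw [hx, SchwartzMap.fourier_coe]

theorem norm_besselSymbol_le_one {s : ℝ} (hs : s ≤ 0) (ξ : Space3) : ‖besselSymbol s ξ‖ ≤ 1 := by
  rw [besselSymbol, Complex.norm_real, Real.norm_eq_abs, abs_of_nonneg (by positivity)]
  exact Real.rpow_le_one_of_one_le_of_nonpos (by nlinarith [norm_nonneg ((2 * Real.pi) • ξ)])
    (by linarith)

/-- For `s ≤ 0` the symbol is bounded, so the multiplier acts on `L²`; the identity is checked among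
tempered distributions, into which `L²` embeds injectively. -/
theorem fourier_of_eq_bessel {s : ℝ} (hs : s ≤ 0) {v w : Lp Spinor 2 (volume : Measure Space3)}
    (h : (w : 𝓢'(Space3, Spinor)) = bessel s (v : 𝓢'(Space3, Spinor))) :
    (𝓕 w : Lp Spinor 2 (volume : Measure Space3)) =ᵐ[volume]
      fun ξ => besselSymbol s ξ • (𝓕 v : Lp Spinor 2 (volume : Measure Space3)) ξ := by
  have hg := besselSymbol_hasTemperateGrowth s
  have hm : MemLp (besselSymbol s) ∞ (volume : Measure Space3) :=
    memLp_top_of_bound hg.1.continuous.aestronglyMeasurable 1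
      (Eventually.of_forall (norm_besselSymbol_le_one hs))
  have h1 : (𝓕 w : Lp Spinor 2 (volume : Measure Space3)) =
      (hm.toLp _ • (𝓕 v : Lp Spinor 2 (volume : Measure Space3)) : Lp Spinor 2 volume) := by
    apply SobolevLoc.toTemperedDistribution_injective
    change ((𝓕 w : Lp Spinor 2 (volume : Measure Space3)) : 𝓢'(Space3, Spinor)) =
      ((hm.toLp _ • (𝓕 v : Lp Spinor 2 (volume : Measure Space3)) : Lp Spinor 2 volume) :
        𝓢'(Space3, Spinor))
    rw [Lp.toTemperedDistribution_smul_eq hg hm, ← Lp.fourier_toTemperedDistribution_eq, h,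
      ← Lp.fourier_toTemperedDistribution_eq, bessel,
      TemperedDistribution.fourierMultiplierCLM_apply]
    exact FourierTransform.fourier_fourierInv_eq _
  rw [h1]
  filter_upwards [Lp.coeFn_lpSMul (r := 2) (hm.toLp (besselSymbol s))
    (𝓕 v : Lp Spinor 2 (volume : Measure Space3)), hm.coeFn_toLp] with ξ h2 h3
  rw [h2, Pi.smul_apply', h3]

/-- The product `χ ψ`. -/
def cutoffFun (χ : 𝓓((⊤ : Opens Space3), ℂ)) (ψ : L2Loc) : Space3 → Spinor := fun x => χ x • ψ x

/-- The `L²` bound controls the Fourier transform in the mean by Plancherel, the `L¹` bound controls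
it pointwise. Both constants are uniform in `ψ`. -/
theorem exists_cutoffFun_bounds (χ : 𝓓((⊤ : Opens Space3), ℂ)) :
    ∃ (R : Set.Ioi (0 : ℝ)) (C : ℝ≥0), ∀ ψ : L2Loc,
      MemLp (cutoffFun χ ψ) 2 volume ∧ Integrable (cutoffFun χ ψ) ∧
        eLpNorm (cutoffFun χ ψ) 2 volume ≤ C * ‖L2Loc.restrictBall R ψ‖ₑ ∧
        eLpNorm (cutoffFun χ ψ) 1 volume ≤ C * ‖L2Loc.restrictBall R ψ‖ₑ := by
  obtain ⟨r, hr⟩ := χ.hasCompactSupport.isCompact.isBounded.subset_ball (0 : Space3)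
  have hr' : tsupport χ ⊆ Metric.ball (0 : Space3) (max r 1) :=
    hr.trans (Metric.ball_subset_ball (le_max_left _ _))
  set R : Set.Ioi (0 : ℝ) := ⟨max r 1, Set.mem_Ioi.2 (lt_max_of_lt_right one_pos)⟩ with hR
  have hsupp : ∀ ψ, Function.support (cutoffFun χ ψ) ⊆ Metric.ball (0 : Space3) R := fun ψ =>
    (Function.support_smul_subset_left _ _).trans ((subset_tsupport _).trans hr')
  set ν : Measure Space3 := volume.restrict (Metric.ball (0 : Space3) R) with hν
  have hfin : IsFiniteMeasure ν := isFiniteMeasure_restrict.2 measure_ball_lt_top.ne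
  obtain ⟨M, hM⟩ := χ.hasCompactSupport.exists_bound_of_continuous χ.continuous
  set K : ℝ≥0 := (ν Set.univ ^ (1 / (1 : ℝ≥0∞).toReal - 1 / (2 : ℝ≥0∞).toReal)).toNNReal with hK
  have hKne : ν Set.univ ^ (1 / (1 : ℝ≥0∞).toReal - 1 / (2 : ℝ≥0∞).toReal) ≠ ∞ :=
    ENNReal.rpow_ne_top_of_nonneg (by norm_num) (measure_ne_top _ _)
  refine ⟨R, max M.toNNReal (M.toNNReal * K), fun ψ => ?_⟩
  have hme : AEStronglyMeasurable (cutoffFun χ ψ) volume :=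
    χ.continuous.aestronglyMeasurable.smul ψ.aestronglyMeasurable
  have hind : ∀ p : ℝ≥0∞, eLpNorm (cutoffFun χ ψ) p volume = eLpNorm (cutoffFun χ ψ) p ν :=
    fun p => by
      rw [hν, ← eLpNorm_indicator_eq_eLpNorm_restrict measurableSet_ball,
        Set.indicator_eq_self.2 (hsupp ψ)]
  have h2 : eLpNorm (cutoffFun χ ψ) 2 ν ≤ M.toNNReal * ‖L2Loc.restrictBall R ψ‖ₑ := by
    rw [Lp.enorm_def, eLpNorm_congr_ae (L2Loc.coeFn_restrictBall R ψ)]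
    refine (eLpNorm_le_nnreal_smul_eLpNorm_of_ae_le_mul (f := cutoffFun χ ψ)
      (g := (ψ : Space3 → Spinor)) (c := M.toNNReal) (Eventually.of_forall fun x => ?_) 2).trans_eq ?_
    · rw [cutoffFun, nnnorm_smul]
      gcongr
      rw [← NNReal.coe_le_coe]
      exact (hM x).trans (Real.le_coe_toNNReal M)
    · rfl
  have h1 : eLpNorm (cutoffFun χ ψ) 1 ν ≤ (M.toNNReal * K : ℝ≥0) * ‖L2Loc.restrictBall R ψ‖ₑ := by
    refine (eLpNorm_le_eLpNorm_mul_rpow_measure_univ (q := 2) (by norm_num) hme.restrict).trans ?_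
    rw [← ENNReal.coe_toNNReal hKne, ← hK, ENNReal.coe_mul, mul_right_comm]
    gcongr
  have hb1 : ((M.toNNReal : ℝ≥0) : ℝ≥0∞) ≤ (max M.toNNReal (M.toNNReal * K) : ℝ≥0) :=
    ENNReal.coe_le_coe.2 (le_max_left _ _)
  have hb2 : ((M.toNNReal * K : ℝ≥0) : ℝ≥0∞) ≤ (max M.toNNReal (M.toNNReal * K) : ℝ≥0) :=
    ENNReal.coe_le_coe.2 (le_max_right _ _)
  refine ⟨⟨hme, ?_⟩, memLp_one_iff_integrable.1 ⟨hme, ?_⟩, ?_, ?_⟩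
  · rw [hind]; exact h2.trans_lt (ENNReal.mul_lt_top ENNReal.coe_lt_top enorm_lt_top)
  · rw [hind]; exact h1.trans_lt (ENNReal.mul_lt_top ENNReal.coe_lt_top enorm_lt_top)
  · rw [hind]; exact h2.trans (by gcongr)
  · rw [hind]; exact h1.trans (by gcongr)

theorem memLp_cutoffFun (χ : 𝓓((⊤ : Opens Space3), ℂ)) (ψ : L2Loc) :
    MemLp (cutoffFun χ ψ) 2 volume := by
  obtain ⟨R, C, h⟩ := exists_cutoffFun_bounds χ
  exact (h ψ).1

theorem integrable_cutoffFun (χ : 𝓓((⊤ : Opens Space3), ℂ)) (ψ : L2Loc) :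
    Integrable (cutoffFun χ ψ) := by
  obtain ⟨R, C, h⟩ := exists_cutoffFun_bounds χ
  exact (h ψ).2.1

theorem toTemperedDistribution_cutoffFun (χ : 𝓓((⊤ : Opens Space3), ℂ)) (ψ : L2Loc) :
    (((memLp_cutoffFun χ ψ).toLp _ : Lp Spinor 2 (volume : Measure Space3)) : 𝓢'(Space3, Spinor)) =
      cutoffDistribution χ ψ.toDistribution := by
  ext1 f
  rw [Lp.toTemperedDistribution_apply]
  change _ = distEval ψ.toDistribution (cutoff χ f)
  rw [distEval_apply, L2Loc.toDistribution_apply, L2Loc.toDistribution_apply, ← integral_smul,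
    ← MeasureTheory.integral_add]
  · refine integral_congr_ae ?_
    filter_upwards [(memLp_cutoffFun χ ψ).coeFn_toLp] with x hx
    rw [hx, cutoffFun]
    change _ = (χ x * f x).re • ψ x + Complex.I • (χ x * f x).im • ψ x
    generalize ψ x = a
    ext i
    simp only [PiLp.add_apply, PiLp.smul_apply, smul_eq_mul, Complex.real_smul]
    linear_combination (-a i) * Complex.re_add_im (χ x * f x)
  · exact TestFunction.integrable_bilin (ContinuousLinearMap.lsmul ℝ ℝ)
      (ψ.locallyIntegrable.locallyIntegrableOn _) _
  · exact Integrable.smul Complex.I <| TestFunction.integrable_bilin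
      (ContinuousLinearMap.lsmul ℝ ℝ) (ψ.locallyIntegrable.locallyIntegrableOn _) _

/-- The Sobolev seminorms of a locally square integrable function in terms of its localized
Fourier transforms. -/
theorem enorm_localize_embed_sq (ζ : 𝓓((⊤ : Opens Space3), ℂ)) {s : ℝ} (hs : s ≤ 0)
    (R : Set.Ioi (0 : ℝ)) (ψ : L2Loc) :
    ‖SobolevLoc.localize R (embed ζ hs ψ)‖ₑ ^ 2 =
      ∫⁻ ξ, ‖besselSymbol s ξ‖ₑ ^ 2 * ‖𝓕 (cutoffFun (dilate ζ R) ψ) ξ‖ₑ ^ 2 := by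
  set w := SobolevLoc.localize R (embed ζ hs ψ) with hw
  have h1 := SobolevLoc.localize_spec R (embed ζ hs ψ)
  rw [← hw] at h1
  have h2 := fourier_of_eq_bessel hs
    (h1.trans (congrArg (bessel s) (toTemperedDistribution_cutoffFun (dilate ζ R) ψ).symm))
  have h3 : ‖w‖ₑ = ‖(𝓕 w : Lp Spinor 2 (volume : Measure Space3))‖ₑ := by
    rw [← ofReal_norm, ← ofReal_norm, Lp.norm_fourier_eq]
  rw [h3, L2Loc.enorm_Lp_two_sq]
  refine lintegral_congr_ae ?_
  filter_upwards [h2, fourier_toLp_ae_eq (integrable_cutoffFun (dilate ζ R) ψ)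
    (memLp_cutoffFun (dilate ζ R) ψ)] with ξ h4 h5
  rw [h4, h5, enorm_smul, mul_pow]

/-- Plancherel's identity for the localized function. -/
theorem lintegral_fourier_cutoffFun_sq (χ : 𝓓((⊤ : Opens Space3), ℂ)) (ψ : L2Loc) :
    ∫⁻ ξ, ‖𝓕 (cutoffFun χ ψ) ξ‖ₑ ^ 2 = eLpNorm (cutoffFun χ ψ) 2 volume ^ 2 := by
  have h := fourier_toLp_ae_eq (integrable_cutoffFun χ ψ) (memLp_cutoffFun χ ψ)
  have h3 : ‖(𝓕 ((memLp_cutoffFun χ ψ).toLp _) : Lp Spinor 2 (volume : Measure Space3))‖ₑ =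
      eLpNorm (cutoffFun χ ψ) 2 volume := by
    rw [← ofReal_norm, Lp.norm_fourier_eq, ofReal_norm, Lp.enorm_def]
    exact eLpNorm_congr_ae (memLp_cutoffFun χ ψ).coeFn_toLp
  rw [← h3, L2Loc.enorm_Lp_two_sq]
  refine lintegral_congr_ae ?_
  filter_upwards [h] with ξ hξ
  rw [hξ]

end DiracStat

end

noncomputable section

namespace DiracStat

open scoped FourierTransform RealInnerProductSpace

/-! ### The embedding into the local Sobolev spaces -/

theorem embed_sub (ζ : 𝓓((⊤ : Opens Space3), ℂ)) {s : ℝ} (hs : s ≤ 0) (ψ φ : L2Loc) :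
    embed ζ hs (ψ - φ) = embed ζ hs ψ - embed ζ hs φ := by
  refine Subtype.ext ?_
  change (ψ - φ).toDistribution = ψ.toDistribution - φ.toDistribution
  ext1 f
  change _ = ψ.toDistribution f - φ.toDistribution f
  rw [L2Loc.toDistribution_apply, L2Loc.toDistribution_apply, L2Loc.toDistribution_apply]
  exact IsWeakSol.integral_sub f f.continuous f.hasCompactSupport ψ φ

theorem tendsto_embed {ι : Type*} {l : Filter ι} (ζ : 𝓓((⊤ : Opens Space3), ℂ)) {s : ℝ} (hs : s ≤ 0)
    {u : ι → L2Loc} {ψ : L2Loc}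
    (h : ∀ R, Tendsto (fun i => ‖SobolevLoc.localize R (embed ζ hs (u i - ψ))‖ₑ ^ 2) l (𝓝 0)) :
    Tendsto (fun i => embed ζ hs (u i)) l (𝓝 (embed ζ hs ψ)) := by
  rw [SobolevLoc.withSeminorms.tendsto_nhds]
  intro R ε hε
  have h1 : 0 < ENNReal.ofReal ε ^ 2 := by positivity
  filter_upwards [(h R).eventually (gt_mem_nhds h1)] with i hi
  have h2 := lt_of_not_ge fun h3 => hi.not_ge (pow_le_pow_left' h3 2)
  rw [← ofReal_norm, ENNReal.ofReal_lt_ofReal_iff hε, embed_sub] at h2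
  exact h2

theorem continuous_embed (ζ : 𝓓((⊤ : Opens Space3), ℂ)) {s : ℝ} (hs : s ≤ 0) :
    Continuous (embed ζ hs) := by
  refine continuous_iff_continuousAt.2 fun ψ => tendsto_embed ζ hs fun R => ?_
  obtain ⟨S, C, hC⟩ := exists_cutoffFun_bounds (dilate ζ R)
  have h1 : Tendsto (fun φ => ((C : ℝ≥0∞) * ‖L2Loc.restrictBall S (φ - ψ)‖ₑ) ^ 2) (𝓝 ψ) (𝓝 0) := by
    have h2 : Tendsto (fun φ => ‖L2Loc.restrictBall S (φ - ψ)‖ₑ) (𝓝 ψ) (𝓝 0) := by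
      have h3 := ((L2Loc.continuous_restrictBall S).tendsto ψ).sub_const (L2Loc.restrictBall S ψ)
      rw [sub_self] at h3
      simp only [map_sub]
      simpa using h3.enorm
    have h4 := ENNReal.Tendsto.const_mul (a := (C : ℝ≥0∞)) h2 (Or.inr ENNReal.coe_ne_top)
    rw [mul_zero] at h4
    have h5 := ((ENNReal.continuous_pow 2).tendsto 0).comp h4
    rwa [zero_pow two_ne_zero] at h5
  refine tendsto_of_tendsto_of_tendsto_of_le_of_le tendsto_const_nhds h1 (fun _ => zero_le)
    fun φ => ?_
  refine (enorm_localize_embed_sq ζ hs R (φ - ψ)).trans_le ?_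
  calc _ ≤ ∫⁻ ξ, ‖𝓕 (cutoffFun (dilate ζ R) (φ - ψ)) ξ‖ₑ ^ 2 := by
        refine lintegral_mono fun ξ => mul_le_of_le_one_left' (pow_le_one₀ zero_le ?_)
        rw [← ofReal_norm]
        exact ENNReal.ofReal_le_one.2 (norm_besselSymbol_le_one hs ξ)
    _ = eLpNorm (cutoffFun (dilate ζ R) (φ - ψ)) 2 volume ^ 2 := lintegral_fourier_cutoffFun_sq _ _
    _ ≤ _ := by gcongr; exact (hC _).2.2.1

theorem bessel_injective (s : ℝ) : Function.Injective (bessel s) := by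
  have h : ∀ u, bessel (-s) (bessel s u) = u := fun u => by
    rw [bessel, bessel, TemperedDistribution.fourierMultiplierCLM_fourierMultiplierCLM_apply
      (besselSymbol_hasTemperateGrowth s) (besselSymbol_hasTemperateGrowth (-s))]
    have h1 : besselSymbol s * besselSymbol (-s) = fun _ => (1 : ℂ) := by
      funext ξ
      simp only [besselSymbol, Pi.mul_apply]
      rw [← Complex.ofReal_mul, ← Real.rpow_add (by positivity)]
      simp [neg_div]
    rw [h1]
    simp
  exact Function.LeftInverse.injective h

/-- Since `ζ(0) ≠ 0`, for large `R` the function `ζ(·/R)` has no zero on `supp φ`. Then `φ / ζ(·/R)`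
is again a test function, and `u φ` is a value of the localized distribution. -/
theorem eq_zero_of_cutoffDistribution {ζ : 𝓓((⊤ : Opens Space3), ℂ)} (hζ : ζ 0 ≠ 0)
    {u : 𝓓'((⊤ : Opens Space3), Spinor)} (h : ∀ R, cutoffDistribution (dilate ζ R) u = 0) :
    u = 0 := by
  ext1 φ
  obtain ⟨ρ, hρ⟩ := φ.hasCompactSupport.isCompact.isBounded.subset_ball (0 : Space3)
  have hnear : ∀ᶠ y in 𝓝 (0 : Space3), ζ y ≠ 0 := ζ.continuous.continuousAt.eventually_ne hζ
  obtain ⟨r, hr, hrζ⟩ := Metric.eventually_nhds_iff_ball.1 hnear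
  -- Dilation by this `R` takes the ball of radius `r`, where `ζ` does not vanish, to one containing
  -- `supp φ`; the maximum with `1` keeps `R` positive.
  set R : Set.Ioi (0 : ℝ) := ⟨max ρ 1 / r, Set.mem_Ioi.2 (by positivity)⟩ with hR
  set χ := dilate ζ R with hχ
  have hχ0 : ∀ x ∈ tsupport φ, χ x ≠ 0 := by
    intro x hx
    have hx' := hρ hx
    rw [mem_ball_zero_iff] at hx'
    refine hrζ _ ?_
    rw [mem_ball_zero_iff, norm_smul, norm_inv, Real.norm_eq_abs, abs_of_pos R.2]
    have : (R : ℝ) * r = max ρ 1 := div_mul_cancel₀ _ hr.ne'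
    rw [inv_mul_lt_iff₀ R.2, this]
    exact hx'.trans_le (le_max_left _ _)
  have hsupp : HasCompactSupport fun x => (φ x : ℂ) / χ x :=
    φ.hasCompactSupport.mono fun x hx h0 => hx (by simp [h0])
  have hdiff : ContDiff ℝ (⊤ : ℕ∞) fun x => (φ x : ℂ) / χ x := by
    rw [contDiff_iff_contDiffAt]
    intro x
    by_cases hx : x ∈ tsupport φ
    · simp only [div_eq_mul_inv]
      exact (Complex.ofRealCLM.contDiff.comp φ.contDiff).contDiffAt.mul
        (χ.contDiff.contDiffAt.inv (hχ0 x hx))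
    · refine (contDiffAt_const (c := (0 : ℂ))).congr_of_eventuallyEq ?_
      filter_upwards [notMem_tsupport_iff_eventuallyEq.1 hx] with y hy
      rw [hy]; simp
  let f : 𝓢(Space3, ℂ) := hsupp.toSchwartzMap hdiff
  have hf : ∀ x, cutoff χ f x = (φ x : ℂ) := by
    intro x
    rw [cutoff_apply]
    change χ x * ((φ x : ℂ) / χ x) = _
    by_cases hx : x ∈ tsupport φ
    · rw [mul_div_cancel₀ _ (hχ0 x hx)]
    · rw [image_eq_zero_of_notMem_tsupport hx]; simp
  have h1 : distEval u (cutoff χ f) = 0 := congrArg (fun T : 𝓢'(Space3, Spinor) => T f) (h R)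
  have hre : TestFunction.postcompCLM Complex.reCLM (cutoff χ f) = φ := by
    ext x
    change (cutoff χ f x).re = φ x
    rw [hf, Complex.ofReal_re]
  have him : TestFunction.postcompCLM Complex.imCLM (cutoff χ f) =
      (0 : 𝓓((⊤ : Opens Space3), ℝ)) := by
    ext x
    change (cutoff χ f x).im = 0
    rw [hf, Complex.ofReal_im]
  rw [distEval_apply, hre, him, map_zero, smul_zero, add_zero] at h1
  exact h1

/-- The seminorms separate points because `Λ^s` is injective and the cutoffs determine the
distribution. In a Hausdorff space the compact sets used for tightness are closed, hence Borel. -/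
theorem t2Space_sobolevLoc {ζ : 𝓓((⊤ : Opens Space3), ℂ)} (hζ : ζ 0 ≠ 0) (s : ℝ) :
    T2Space (SobolevLoc ζ s) := by
  have h1 : T1Space (SobolevLoc ζ s) := by
    refine SobolevLoc.withSeminorms.T1_of_separating fun u hu => ?_
    by_contra! hR
    refine hu (Subtype.ext (eq_zero_of_cutoffDistribution hζ fun R => bessel_injective s ?_))
    have h2 : SobolevLoc.localize R u = 0 := norm_eq_zero.1 (hR R)
    rw [← SobolevLoc.localize_spec R u, h2, map_zero]
    exact map_zero (Lp.toTemperedDistributionCLM Spinor volume 2)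
  have := (SobolevLoc.withSeminorms (ζ := ζ) (s := s)).topologicalAddGroup
  infer_instance

end DiracStat

end

noncomputable section

namespace DiracStat

open scoped FourierTransform InnerProductSpace

/-! ### Compactness of the embedding -/

theorem enorm_fourier_le (F : Space3 → Spinor) (ξ : Space3) : ‖𝓕 F ξ‖ₑ ≤ eLpNorm F 1 volume := by
  rw [Real.fourier_eq, eLpNorm_one_eq_lintegral_enorm]
  refine (enorm_integral_le_lintegral_enorm _).trans_eq (lintegral_congr fun x => ?_)
  rw [← ofReal_norm, Circle.norm_smul, ofReal_norm]

theorem continuous_fourier_cutoffFun (χ : 𝓓((⊤ : Opens Space3), ℂ)) (ψ : L2Loc) :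
    Continuous (𝓕 (cutoffFun χ ψ)) :=
  VectorFourier.fourierIntegral_continuous Real.continuous_fourierChar
    (by exact continuous_inner) (integrable_cutoffFun χ ψ)

theorem exists_norm_besselSymbol_le {ε : ℝ} (hε : 0 < ε) {κ : ℝ} (hκ : 0 < κ) :
    ∃ N : ℝ, ∀ ξ : Space3, N ≤ ‖ξ‖ → ‖besselSymbol (-ε) ξ‖ ≤ κ := by
  obtain ⟨N, hN⟩ := eventually_atTop.1
    ((tendsto_rpow_neg_atTop (half_pos hε)).eventually (ge_mem_nhds hκ))
  refine ⟨N, fun ξ hξ => ?_⟩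
  rw [besselSymbol, Complex.norm_real, Real.norm_eq_abs, abs_of_nonneg (by positivity), neg_div]
  refine hN _ (hξ.trans ?_)
  rw [norm_smul, Real.norm_eq_abs, abs_of_pos Real.two_pi_pos]
  have h1 : 6 ≤ 2 * Real.pi := by linarith [Real.pi_gt_three]
  have h2 : 6 * ‖ξ‖ ≤ 2 * Real.pi * ‖ξ‖ := by gcongr
  nlinarith [norm_nonneg ξ]

/-- Pointwise convergence of the localized Fourier transforms of a locally bounded sequence implies
convergence of the Sobolev seminorms of negative order. -/
theorem tendsto_localize_of_tendsto_fourier (ζ : 𝓓((⊤ : Opens Space3), ℂ)) {ε : ℝ} (hε : 0 < ε)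
    (R : Set.Ioi (0 : ℝ)) {δ : ℕ → L2Loc}
    (hb : ∀ S, ∃ B : ℝ≥0, ∀ n, ‖L2Loc.restrictBall S (δ n)‖ₑ ≤ B)
    (hδ : ∀ ξ, Tendsto (fun n => 𝓕 (cutoffFun (dilate ζ R) (δ n)) ξ) atTop (𝓝 0)) :
    Tendsto (fun n => ‖SobolevLoc.localize R (embed ζ (neg_nonpos.2 hε.le) (δ n))‖ₑ ^ 2)
      atTop (𝓝 0) := by
  obtain ⟨S, C, hC⟩ := exists_cutoffFun_bounds (dilate ζ R)
  obtain ⟨B, hB⟩ := hb S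
  set F : ℕ → Space3 → Spinor := fun n => 𝓕 (cutoffFun (dilate ζ R) (δ n)) with hF
  set D : ℝ≥0 := C * B with hD
  have hD1 : ∀ n, eLpNorm (cutoffFun (dilate ζ R) (δ n)) 1 volume ≤ D := fun n =>
    ((hC _).2.2.2.trans (by gcongr; exact hB n)).trans_eq (ENNReal.coe_mul _ _).symm
  have hD2 : ∀ n, ∫⁻ ξ, ‖F n ξ‖ₑ ^ 2 ≤ (D : ℝ≥0∞) ^ 2 := fun n => by
    rw [hF, lintegral_fourier_cutoffFun_sq]
    gcongr
    exact ((hC _).2.2.1.trans (by gcongr; exact hB n)).trans_eq (ENNReal.coe_mul _ _).symm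
  have hFm : ∀ n, Measurable fun ξ => ‖F n ξ‖ₑ ^ 2 := fun n =>
    (continuous_fourier_cutoffFun _ _).enorm.measurable.pow_const 2
  rw [ENNReal.tendsto_nhds_zero]
  intro η hη
  -- High frequencies: where the symbol is below `κ`, Plancherel bounds the contribution by `κ² D²`,
  -- uniformly in `n`.
  obtain ⟨κ, hκ, hκη⟩ : ∃ κ : ℝ≥0, 0 < κ ∧ (κ : ℝ≥0∞) ^ 2 * (D : ℝ≥0∞) ^ 2 ≤ η / 2 := by
    have h1 : Tendsto (fun κ : ℝ≥0 => (κ : ℝ≥0∞) ^ 2 * (D : ℝ≥0∞) ^ 2) (𝓝 0) (𝓝 0) := by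
      have h2 : Continuous fun κ : ℝ≥0 => (((κ ^ 2 * D ^ 2 : ℝ≥0)) : ℝ≥0∞) := by fun_prop
      have h3 := h2.tendsto 0
      simpa using h3
    have h4 : ∀ᶠ κ : ℝ≥0 in 𝓝[>] 0, (κ : ℝ≥0∞) ^ 2 * (D : ℝ≥0∞) ^ 2 ≤ η / 2 :=
      (h1.mono_left nhdsWithin_le_nhds).eventually (ge_mem_nhds (ENNReal.half_pos hη.ne'))
    obtain ⟨κ, h5, h6⟩ := (h4.and self_mem_nhdsWithin).exists
    exact ⟨κ, h6, h5⟩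
  obtain ⟨N, hN⟩ := exists_norm_besselSymbol_le hε (κ := κ) (by exact_mod_cast hκ)
  -- Low frequencies: pointwise convergence, dominated by the constant `D²` on a ball of finite
  -- volume.
  have hlow : Tendsto (fun n => ∫⁻ ξ in Metric.ball (0 : Space3) N, ‖F n ξ‖ₑ ^ 2) atTop (𝓝 0) := by
    have h := tendsto_lintegral_of_dominated_convergence
      (μ := volume.restrict (Metric.ball (0 : Space3) N)) (F := fun n ξ => ‖F n ξ‖ₑ ^ 2)
      (f := fun _ => 0) (fun _ => (D : ℝ≥0∞) ^ 2) hFm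
      (fun n => Eventually.of_forall fun ξ =>
        pow_le_pow_left' ((enorm_fourier_le _ ξ).trans (hD1 n)) 2)
      (by
        rw [lintegral_const, Measure.restrict_apply_univ]
        exact ENNReal.mul_ne_top (by simp) measure_ball_lt_top.ne)
      (Eventually.of_forall fun ξ => by
        have h1 := ((ENNReal.continuous_pow 2).tendsto _).comp (hδ ξ).enorm
        simpa [Function.comp_def] using h1)
    simpa using h
  filter_upwards [hlow.eventually (ge_mem_nhds (ENNReal.half_pos hη.ne'))] with n hn
  rw [enorm_localize_embed_sq, ← lintegral_add_compl _ (measurableSet_ball (x := 0) (ε := N)),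
    ← ENNReal.add_halves η]
  refine add_le_add (le_trans (lintegral_mono fun ξ => ?_) hn) ?_
  · refine mul_le_of_le_one_left' (pow_le_one₀ zero_le ?_)
    rw [← ofReal_norm]
    exact ENNReal.ofReal_le_one.2 (norm_besselSymbol_le_one (neg_nonpos.2 hε.le) ξ)
  · refine le_trans ?_ hκη
    calc _ ≤ ∫⁻ ξ in (Metric.ball (0 : Space3) N)ᶜ, (κ : ℝ≥0∞) ^ 2 * ‖F n ξ‖ₑ ^ 2 := by
          refine setLIntegral_mono' measurableSet_ball.compl fun ξ hξ => ?_
          gcongr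
          rw [Set.mem_compl_iff, mem_ball_zero_iff, not_lt] at hξ
          rw [← ofReal_norm]
          exact (ENNReal.ofReal_le_ofReal (hN ξ hξ)).trans_eq (ENNReal.ofReal_coe_nnreal)
      _ ≤ ∫⁻ ξ, (κ : ℝ≥0∞) ^ 2 * ‖F n ξ‖ₑ ^ 2 := setLIntegral_le_lintegral _ _
      _ ≤ _ := by
          rw [lintegral_const_mul _ (hFm n)]
          gcongr
          exact hD2 n

/-- The localized Fourier transform at a fixed frequency. -/
def fourierAt (χ : 𝓓((⊤ : Opens Space3), ℂ)) (ξ : Space3) : L2Loc →ₗ[ℂ] Spinor where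
  toFun ψ := 𝓕 (cutoffFun χ ψ) ξ
  map_add' ψ φ := by
    have h : cutoffFun χ (ψ + φ) =ᵐ[volume] cutoffFun χ ψ + cutoffFun χ φ := by
      filter_upwards [L2Loc.coeFn_add ψ φ] with x hx
      rw [cutoffFun, hx, Pi.add_apply, Pi.add_apply, smul_add]; rfl
    rw [Real.fourier_congr_ae h]
    exact congrFun (VectorFourier.fourierIntegral_add Real.continuous_fourierChar
      (by exact continuous_inner) (integrable_cutoffFun χ ψ) (integrable_cutoffFun χ φ)) ξ
  map_smul' c ψ := by
    have h : cutoffFun χ (c • ψ) =ᵐ[volume] c • cutoffFun χ ψ := by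
      filter_upwards [L2Loc.coeFn_smul c ψ] with x hx
      rw [cutoffFun, hx, Pi.smul_apply, Pi.smul_apply, smul_comm]; rfl
    rw [Real.fourier_congr_ae h]
    exact congrFun (VectorFourier.fourierIntegral_const_smul _ _ _ _ c) ξ

theorem exists_norm_fourierAt_le (χ : 𝓓((⊤ : Opens Space3), ℂ)) :
    ∃ (S : Set.Ioi (0 : ℝ)) (C : ℝ≥0), ∀ ξ ψ, ‖fourierAt χ ξ ψ‖ ≤ C * ‖L2Loc.restrictBall S ψ‖ := by
  obtain ⟨S, C, h⟩ := exists_cutoffFun_bounds χ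
  refine ⟨S, C, fun ξ ψ => ?_⟩
  have h1 : ‖fourierAt χ ξ ψ‖ₑ ≤ C * ‖L2Loc.restrictBall S ψ‖ₑ :=
    (enorm_fourier_le _ ξ).trans (h ψ).2.2.2
  rw [← ofReal_norm, ← ofReal_norm, ← ENNReal.ofReal_coe_nnreal, ← ENNReal.ofReal_mul (NNReal.coe_nonneg C)] at h1
  exact (ENNReal.ofReal_le_ofReal_iff (by positivity)).1 h1

/-! ### Radial step multipliers and compact images of balls of `L²`. -/

/-- The radial step function with value `h n` for `n ≤ |x| < n + 1`. -/
def shellWeight (h : ℕ → ℝ) (x : Space3) : ℝ := h ⌊‖x‖⌋₊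

theorem measurable_shellWeight (h : ℕ → ℝ) : Measurable (shellWeight h) :=
  (measurable_from_nat (f := h)).comp (Nat.measurable_floor.comp measurable_norm)

theorem abs_shellWeight_le (h : ℕ → ℝ) {R : ℝ} {x : Space3} (hx : x ∈ Metric.ball (0 : Space3) R) :
    |shellWeight h x| ≤ ∑ n ∈ Finset.range (⌊R⌋₊ + 1), |h n| := by
  refine Finset.single_le_sum (f := fun n => |h n|) (fun n _ => abs_nonneg _)
    (Finset.mem_range.2 (Nat.lt_succ_of_le (Nat.floor_mono ?_)))
  exact (mem_ball_zero_iff.1 hx).le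

theorem ae_norm_shellWeight_smul_le (h : ℕ → ℝ) (R : ℝ) (f : Space3 → Spinor) :
    ∀ᵐ x ∂(volume.restrict (Metric.ball (0 : Space3) R)), ‖shellWeight h x • f x‖ ≤
      (∑ n ∈ Finset.range (⌊R⌋₊ + 1), |h n|) * ‖f x‖ := by
  filter_upwards [ae_restrict_mem measurableSet_ball] with x hx
  rw [norm_smul, Real.norm_eq_abs]
  gcongr
  exact abs_shellWeight_le h hx

theorem memLp_shellWeight_smul (h : ℕ → ℝ) (f : Lp Spinor 2 (volume : Measure Space3)) (R : ℝ) :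
    MemLp (fun x => shellWeight h x • f x) 2 (volume.restrict (Metric.ball (0 : Space3) R)) :=
  ((Lp.memLp f).restrict _).of_le_mul
    (((measurable_shellWeight h).aestronglyMeasurable.smul (Lp.aestronglyMeasurable f)).restrict)
    (ae_norm_shellWeight_smul_le h R f)

/-- Multiplication of square integrable functions by a radial step function. -/
def shellMul (h : ℕ → ℝ) : Lp Spinor 2 (volume : Measure Space3) →ₗ[ℂ] L2Loc where
  toFun f := L2Loc.ofFun (fun x => shellWeight h x • f x) fun R _ => memLp_shellWeight_smul h f R
  map_add' f g := by
    refine L2Loc.ext ?_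
    filter_upwards [L2Loc.coeFn_ofFun (fun R _ => memLp_shellWeight_smul h (f + g) R),
      L2Loc.coeFn_ofFun (fun R _ => memLp_shellWeight_smul h f R),
      L2Loc.coeFn_ofFun (fun R _ => memLp_shellWeight_smul h g R), Lp.coeFn_add f g,
      L2Loc.coeFn_add (L2Loc.ofFun _ (fun R _ => memLp_shellWeight_smul h f R))
        (L2Loc.ofFun _ (fun R _ => memLp_shellWeight_smul h g R))] with x h1 h2 h3 h4 h5
    rw [h1, h5, Pi.add_apply, h2, h3, h4, Pi.add_apply, smul_add]
  map_smul' c f := by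
    refine L2Loc.ext ?_
    filter_upwards [L2Loc.coeFn_ofFun (fun R _ => memLp_shellWeight_smul h (c • f) R),
      L2Loc.coeFn_ofFun (fun R _ => memLp_shellWeight_smul h f R), Lp.coeFn_smul c f,
      L2Loc.coeFn_smul c (L2Loc.ofFun _ (fun R _ => memLp_shellWeight_smul h f R))]
      with x h1 h2 h3 h4
    rw [h1, RingHom.id_apply, h4, Pi.smul_apply, h2, h3, Pi.smul_apply, smul_comm]

theorem coeFn_shellMul (h : ℕ → ℝ) (f : Lp Spinor 2 (volume : Measure Space3)) :
    shellMul h f =ᵐ[volume] fun x => shellWeight h x • f x :=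
  L2Loc.coeFn_ofFun fun R _ => memLp_shellWeight_smul h f R

theorem exists_norm_restrictBall_shellMul_le (h : ℕ → ℝ) (S : Set.Ioi (0 : ℝ)) :
    ∃ B : ℝ≥0, ∀ f, ‖L2Loc.restrictBall S (shellMul h f)‖ ≤ B * ‖f‖ := by
  set B : ℝ := ∑ n ∈ Finset.range (⌊(S : ℝ)⌋₊ + 1), |h n| with hB
  have hB0 : 0 ≤ B := Finset.sum_nonneg fun _ _ => abs_nonneg _
  refine ⟨⟨B, hB0⟩, fun f => ?_⟩
  have h1 : eLpNorm (fun x => shellWeight h x • f x) 2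
      (volume.restrict (Metric.ball (0 : Space3) (S : ℝ))) ≤ ENNReal.ofReal B * ‖f‖ₑ := by
    refine (eLpNorm_le_mul_eLpNorm_of_ae_le_mul (g := f)
      (ae_norm_shellWeight_smul_le h S f) 2).trans ?_
    rw [Lp.enorm_def]
    refine mul_le_mul_right ?_ _
    exact eLpNorm_mono_measure _ Measure.restrict_le_self
  have h2 : ‖L2Loc.restrictBall S (shellMul h f)‖ₑ ≤ ENNReal.ofReal B * ‖f‖ₑ := by
    rw [Lp.enorm_def, eLpNorm_congr_ae ((L2Loc.coeFn_restrictBall S _).trans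
      (ae_restrict_of_ae (coeFn_shellMul h f)))]
    exact h1
  rw [← ofReal_norm, ← ofReal_norm, ← ENNReal.ofReal_mul hB0] at h2
  exact (ENNReal.ofReal_le_ofReal_iff (by positivity)).1 h2

/-- At a fixed frequency the map is bounded and linear from `L²` to the finite-dimensional `ℂ⁴`, so
it takes weakly null sequences to null sequences. The step function may be unbounded, but only its
values on the support of `χ` matter. -/
theorem tendsto_fourierAt_shellMul (χ : 𝓓((⊤ : Opens Space3), ℂ)) (h : ℕ → ℝ) (ξ : Space3)
    {f : ℕ → Lp Spinor 2 (volume : Measure Space3)}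
    (hf : ∀ g, Tendsto (fun n => ⟪f n, g⟫_ℂ) atTop (𝓝 0)) :
    Tendsto (fun n => fourierAt χ ξ (shellMul h (f n))) atTop (𝓝 0) := by
  obtain ⟨S, C, hC⟩ := exists_norm_fourierAt_le χ
  obtain ⟨B, hB⟩ := exists_norm_restrictBall_shellMul_le h S
  let Φ : Lp Spinor 2 (volume : Measure Space3) →L[ℂ] Spinor :=
    (fourierAt χ ξ ∘ₗ shellMul h).mkContinuous (C * B) fun f => by
      rw [mul_assoc]
      exact (hC ξ _).trans (mul_le_mul_of_nonneg_left (hB f) C.2)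
  have h1 : ∀ i, Tendsto (fun n => Φ (f n) i) atTop (𝓝 0) := fun i => by
    have h2 : ∀ n, Φ (f n) i =
        starRingEnd ℂ ⟪f n, ContinuousLinearMap.adjoint Φ (EuclideanSpace.single i 1)⟫_ℂ := fun n => by
      rw [inner_conj_symm, ContinuousLinearMap.adjoint_inner_left, EuclideanSpace.inner_single_left]
      simp
    simp only [h2]
    have h3 := (Complex.continuous_conj.tendsto 0).comp
      (hf (ContinuousLinearMap.adjoint Φ (EuclideanSpace.single i 1)))
    rwa [map_zero] at h3
  have h4 : Tendsto (fun n => Φ (f n)) atTop (𝓝 0) := by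
    rw [(EuclideanSpace.equiv (Fin 4) ℂ).toHomeomorph.isInducing.tendsto_nhds_iff, tendsto_pi_nhds]
    exact h1
  exact h4

/-- Multiplication by a step function, followed by the embedding into a Sobolev space of negative
order, maps closed balls of `L²` to compact sets. -/
theorem isCompact_embed_shellMul (ζ : 𝓓((⊤ : Opens Space3), ℂ)) {ε : ℝ} (hε : 0 < ε) (h : ℕ → ℝ)
    (M : ℝ) :
    IsCompact ((fun f => embed ζ (neg_nonpos.2 hε.le) (shellMul h f)) ''
      Metric.closedBall (0 : Lp Spinor 2 (volume : Measure Space3)) M) := by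
  have : Fact ((2 : ℝ≥0∞) ≠ ∞) := ⟨by norm_num⟩
  let G := Lp Spinor 2 (volume : Measure Space3)
  -- By the Riesz isomorphism the closed ball of `L²` becomes a weak-* compact set. It is metrizable
  -- since `L²` is separable, so continuity can be tested on sequences.
  let K : Set (WeakDual ℂ G) := WeakDual.toStrongDual ⁻¹' Metric.closedBall 0 M
  have hK : IsCompact K := WeakDual.isCompact_closedBall 0 M
  have : CompactSpace K := isCompact_iff_compactSpace.1 hK
  have : MetrizableSpace K := WeakDual.metrizable_of_isCompact ℂ G K hK
  let r : K → G := fun x => (InnerProductSpace.toDual ℂ G).symm (WeakDual.toStrongDual x.1)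
  have hr : ∀ x y, ⟪r x, y⟫_ℂ = x.1 y := fun x y => InnerProductSpace.toDual_symm_apply
  have hrM : ∀ x, ‖r x‖ ≤ M := fun x => by
    have h1 := x.2
    rw [Set.mem_preimage, mem_closedBall_zero_iff] at h1
    rwa [LinearIsometryEquiv.norm_map]
  have himage : (fun f => embed ζ (neg_nonpos.2 hε.le) (shellMul h f)) ''
      Metric.closedBall (0 : G) M =
      Set.range fun x => embed ζ (neg_nonpos.2 hε.le) (shellMul h (r x)) := by
    ext u
    constructor
    · rintro ⟨f, hf, rfl⟩
      refine ⟨⟨WeakDual.toStrongDual.symm (InnerProductSpace.toDual ℂ G f), ?_⟩, ?_⟩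
      · change InnerProductSpace.toDual ℂ G f ∈ Metric.closedBall 0 M
        rw [mem_closedBall_zero_iff, LinearIsometryEquiv.norm_map]
        exact mem_closedBall_zero_iff.1 hf
      · change embed ζ _ (shellMul h ((InnerProductSpace.toDual ℂ G).symm
          (InnerProductSpace.toDual ℂ G f))) = _
        rw [LinearIsometryEquiv.symm_apply_apply]
    · rintro ⟨x, rfl⟩
      exact ⟨r x, mem_closedBall_zero_iff.2 (hrM x), rfl⟩
  rw [himage]
  refine isCompact_range (continuous_iff_seqContinuous.2 fun x y hxy => ?_)
  refine tendsto_embed ζ _ fun R => ?_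
  simp only [← map_sub]
  refine tendsto_localize_of_tendsto_fourier ζ hε R (fun S => ?_) fun ξ => ?_
  · obtain ⟨B, hB⟩ := exists_norm_restrictBall_shellMul_le h S
    refine ⟨(B * (M + M)).toNNReal, fun n => ?_⟩
    rw [← ofReal_norm]
    refine ENNReal.ofReal_le_ofReal ((hB _).trans ?_)
    gcongr
    exact (norm_sub_le _ _).trans (add_le_add (hrM _) (hrM _))
  · refine tendsto_fourierAt_shellMul _ h ξ fun g => ?_
    simp only [inner_sub_left, hr]
    have h1 : Tendsto (fun n => (x n).1 g) atTop (𝓝 (y.1 g)) :=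
      ((WeakDual.eval_continuous g).comp continuous_subtype_val).continuousAt.tendsto.comp hxy
    simpa using h1.sub_const (y.1 g)

end DiracStat

end

noncomputable section

namespace DiracStat

/-! ### Tightness -/

/-- On the shell `n ≤ |x| < n + 1` the weight is `a n`, and the shell lies in the ball of radius `n
+ 1`. -/
theorem lintegral_shellWeight_smul_le (a : ℕ → ℝ) (ψ : L2Loc) :
    ∫⁻ x, ‖shellWeight a x • ψ x‖ₑ ^ 2 ≤ ∑' n : ℕ, ‖a n‖ₑ ^ 2 * ψ.locEnergy (n + 1) := by
  have h1 : ∀ x, ‖shellWeight a x • ψ x‖ₑ ^ 2 ≤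
      ∑' n : ℕ, (Metric.ball (0 : Space3) (n + 1)).indicator
        (fun x => ‖a n‖ₑ ^ 2 * ‖ψ x‖ₑ ^ 2) x := fun x => by
    refine le_trans (le_of_eq ?_) (ENNReal.le_tsum ⌊‖x‖⌋₊)
    rw [Set.indicator_of_mem (by rw [mem_ball_zero_iff]; exact Nat.lt_floor_add_one _), shellWeight,
      enorm_smul, mul_pow]
  have hm : AEMeasurable (fun x => ‖ψ x‖ₑ ^ 2) volume := ψ.aestronglyMeasurable.enorm.pow_const 2
  refine (lintegral_mono h1).trans_eq ?_
  rw [lintegral_tsum fun n => (hm.const_mul _).indicator measurableSet_ball]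
  refine tsum_congr fun n => ?_
  rw [lintegral_indicator measurableSet_ball, lintegral_const_mul'' _ hm.restrict]
  rfl

/-- A function of bounded weighted energy is the product of a step function and an element of a
ball of `L²`. -/
theorem mem_image_shellMul {a : ℕ → ℝ} (ha : ∀ n, a n ≠ 0) {ψ : L2Loc} {M : ℝ≥0}
    (h : ∑' n : ℕ, ‖a n‖ₑ ^ 2 * ψ.locEnergy (n + 1) ≤ (M : ℝ≥0∞) ^ 2) :
    ψ ∈ shellMul (fun n => (a n)⁻¹) '' Metric.closedBall 0 M := by
  have h1 := (lintegral_shellWeight_smul_le a ψ).trans h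
  have hm : AEStronglyMeasurable (fun x => shellWeight a x • ψ x) volume :=
    (measurable_shellWeight a).aestronglyMeasurable.smul ψ.aestronglyMeasurable
  have hL : MemLp (fun x => shellWeight a x • ψ x) 2 volume := by
    refine ⟨hm, ?_⟩
    rw [eLpNorm_lt_top_iff_lintegral_rpow_enorm_lt_top (by norm_num) (by norm_num)]
    simpa using h1.trans_lt (ENNReal.pow_lt_top ENNReal.coe_lt_top)
  refine ⟨hL.toLp _, ?_, ?_⟩
  · have h2 : ‖hL.toLp _‖ₑ ^ 2 ≤ (M : ℝ≥0∞) ^ 2 := by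
      rw [L2Loc.enorm_Lp_two_sq]
      refine le_trans (le_of_eq (lintegral_congr_ae ?_)) h1
      filter_upwards [hL.coeFn_toLp] with x hx
      rw [hx]
    rw [ENNReal.pow_le_pow_left_iff two_ne_zero, ← ofReal_norm] at h2
    rw [mem_closedBall_zero_iff]
    exact ENNReal.ofReal_le_coe.1 h2
  · refine L2Loc.ext ?_
    filter_upwards [coeFn_shellMul (fun n => (a n)⁻¹) (hL.toLp _), hL.coeFn_toLp] with x h1 h2
    rw [h1, h2, shellWeight, shellWeight, smul_smul, inv_mul_cancel₀ (ha _), one_smul]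

variable {μ₀ : Measure L2Loc} [IsProbabilityMeasure μ₀] {Ψ : L2Loc → Space3 → Spinor}

/-- The mean energies in the balls of radius `n + 1` have bounds `C n` independent of time. Any
positive `b n` with `∑ b n * C n < 1` gives weights `a n = √(b n)`. -/
theorem exists_weights_lintegral_le (hΨ : IsRandomField μ₀ Ψ) (hS : InitialConditions μ₀ Ψ) (m : ℝ) :
    ∃ a : ℕ → ℝ, (∀ n, a n ≠ 0) ∧ ∀ t,
      ∫⁻ ω, ∑' n : ℕ, ‖a n‖ₑ ^ 2 * (diracFlow m t ω).locEnergy (n + 1) ∂μ₀ ≤ 1 := by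
  choose C hC using fun n : ℕ =>
    exists_lintegral_locEnergy_diracFlow_le hΨ hS m (R := (n : ℝ) + 1) (by positivity)
  obtain ⟨b, hb, hbC⟩ := ENNReal.exists_pos_tsum_mul_lt_of_countable one_ne_zero
    (fun n : ℕ => (C n : ℝ≥0∞)) (fun n => ENNReal.coe_ne_top)
  have hb2 : ∀ n, ‖(Real.sqrt (b n) : ℝ)‖ₑ ^ 2 = (b n : ℝ≥0∞) := fun n => by
    rw [← ofReal_norm, ← ENNReal.ofReal_pow (norm_nonneg _), Real.norm_eq_abs, sq_abs,
      Real.sq_sqrt (NNReal.coe_nonneg _), ENNReal.ofReal_coe_nnreal]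
  refine ⟨fun n => Real.sqrt (b n), fun n => (Real.sqrt_pos.2 (by exact_mod_cast hb n)).ne',
    fun t => ?_⟩
  have hm : ∀ n : ℕ, Measurable fun ω => (diracFlow m t ω).locEnergy (n + 1) := fun n =>
    measurable_locEnergy_comp (continuous_diracFlow m t) (by positivity)
  simp only [hb2]
  rw [lintegral_tsum fun n => ((hm n).const_mul _).aemeasurable]
  refine le_trans (ENNReal.tsum_le_tsum fun n => ?_) hbC.le
  rw [lintegral_const_mul _ (hm n), mul_comm]
  gcongr
  exact hC n t

/-- The laws of the solution, as measures on a Sobolev space of negative order, are tight. -/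
theorem isTightMeasureSet_map_timeLaw (hΨ : IsRandomField μ₀ Ψ) (hS : InitialConditions μ₀ Ψ)
    (m : ℝ) {ζ : 𝓓((⊤ : Opens Space3), ℂ)} (hζ : ζ 0 ≠ 0) {ε : ℝ} (hε : 0 < ε) :
    IsTightMeasureSet (Set.range fun t =>
      (timeLaw m μ₀ t).map (embed ζ (neg_nonpos.2 hε.le))) := by
  have := t2Space_sobolevLoc hζ (-ε)
  obtain ⟨a, ha, hE⟩ := exists_weights_lintegral_le hΨ hS m
  rw [isTightMeasureSet_iff_exists_isCompact_measure_compl_le]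
  intro η hη
  -- Markov's inequality will bound the probability of weighted energy at least `M²` by `1 / M²`.
  obtain ⟨M, hM, hMη⟩ : ∃ M : ℝ≥0, 0 < M ∧ ((M : ℝ≥0∞) ^ 2)⁻¹ ≤ η := by
    obtain ⟨n, hn⟩ := ENNReal.exists_inv_nat_lt hη.ne'
    refine ⟨n + 1, by positivity, le_trans (ENNReal.inv_le_inv.2 ?_) hn.le⟩
    have h1 : (n : ℝ≥0) ≤ (n + 1) ^ 2 := by
      have : (0 : ℝ≥0) ≤ n := zero_le
      calc (n : ℝ≥0) ≤ n + 1 := le_self_add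
        _ ≤ (n + 1) ^ 2 := le_self_pow₀ le_add_self two_ne_zero
    exact_mod_cast h1
  have hK := isCompact_embed_shellMul ζ hε (fun n => (a n)⁻¹) M
  refine ⟨_, hK, ?_⟩
  rintro _ ⟨t, rfl⟩
  have hflow := (continuous_diracFlow m t).measurable
  rw [Measure.map_apply (continuous_embed ζ _).measurable hK.isClosed.measurableSet.compl, timeLaw,
    Measure.map_apply hflow ((continuous_embed ζ _).measurable hK.isClosed.measurableSet.compl)]
  have hsub : diracFlow m t ⁻¹' (embed ζ (neg_nonpos.2 hε.le) ⁻¹'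
      ((fun f => embed ζ (neg_nonpos.2 hε.le) (shellMul (fun n => (a n)⁻¹) f)) ''
        Metric.closedBall 0 (M : ℝ))ᶜ) ⊆
      -- A solution of smaller weighted energy is `1/a` times an element of the ball of radius `M`
      -- in `L²`, so its image lies in the compact set.
      {ω | (M : ℝ≥0∞) ^ 2 ≤ ∑' n : ℕ, ‖a n‖ₑ ^ 2 * (diracFlow m t ω).locEnergy (n + 1)} := by
    intro ω hω
    by_contra hlt
    rw [Set.mem_ofPred_eq, not_le] at hlt
    obtain ⟨f, hf, hfω⟩ := mem_image_shellMul ha hlt.le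
    exact hω ⟨f, hf, congrArg _ hfω⟩
  have hm : Measurable fun ω => ∑' n : ℕ, ‖a n‖ₑ ^ 2 * (diracFlow m t ω).locEnergy (n + 1) :=
    Measurable.tsum fun n => (measurable_locEnergy_comp (continuous_diracFlow m t)
      (by positivity)).const_mul _
  refine (measure_mono hsub).trans (le_trans ?_ hMη)
  refine (meas_ge_le_lintegral_div hm.aemeasurable (by positivity) (by simp)).trans ?_
  rw [div_eq_mul_inv]
  exact mul_le_of_le_one_left' (hE t)

end DiracStat

end

theorem proposition2p7 (m : ℝ) (hm : 0 < m)
    (μ₀ : Measure L2Loc) [IsProbabilityMeasure μ₀]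
    (Ψ : L2Loc → Space3 → Spinor) (hΨ : IsRandomField μ₀ Ψ) (hS : InitialConditions μ₀ Ψ)
    (ζ : 𝓓((⊤ : Opens Space3), ℂ)) (hζ : ζ 0 ≠ 0)
    (ε : ℝ) (hε : 0 < ε) :
    (∀ ψ₀ : L2Loc, ∃! ψ : ℝ → L2Loc, IsDiracSolution m ψ₀ ψ) ∧
    (∀ t : ℝ, Continuous (diracFlow m t)) ∧
    Continuous (embed ζ (neg_nonpos.2 hε.le)) ∧
    IsCompact (closure {ν : ProbabilityMeasure (SobolevLoc ζ (-ε)) |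
      ∃ t : ℝ, (ν : Measure (SobolevLoc ζ (-ε))) =
        (timeLaw m μ₀ t).map (embed ζ (neg_nonpos.2 hε.le))}) := by
  have := t2Space_sobolevLoc hζ (-ε)
  -- The last component is Prokhorov's theorem in the direction from tightness to relative
  -- compactness.
  refine ⟨existsUnique_isDiracSolution m, continuous_diracFlow m, continuous_embed ζ _,
    isCompact_closure_of_isTightMeasureSet ((isTightMeasureSet_map_timeLaw hΨ hS m hζ hε).subset ?_)⟩
  rintro _ ⟨ν, ⟨t, ht⟩, rfl⟩
  exact ⟨t, ht.symm⟩
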